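/- Conventions. A graph $E=(E^0,E^1,r,s)$ is directed, with finitely many vertices and at most countably many edges (loops and parallel edges allowed). A vertex is regular if it emits a finite nonzero number of edges, an infinite emitter if it emits infinitely many, and a source if it receives none. Paths have positive length. Moves. (O): let $w$ not be a sink, and partition $s^{-1}(w)=\mathcal E_1\sqcup\dots\sqcup\mathcal E_n$ into nonempty sets, at most one of them infinite. Replace $w$ by $w^1,\dots,w^n$, where $w^j$ emits the edges in $\mathcal E_j$, and replace each edge $e$ into $w$ by $n$ copies, one into each $w^i$ (a copy of an edge $e\in\mathcal E_j$ starts at $w^j$). (I+): for a regular vertex $w$ of a graph $G$ and a partition of $r^{-1}(w)$ into $n\ge 1$ possibly empty sets $\mathcal E_1,\dots,\mathcal E_n$, insplitting replaces $w$ by $w^1,\dots,w^n$, where $w^j$ receives the edges in $\mathcal E_j$, and each edge out of $w$ by $n$ copies, one out of each $w^i$. Two graphs are (I+) equivalent if both are insplittings of one $G$ at one $w$ with the same $n$. (R+): for a regular vertex $w$ without a loop, replace $w$ and all edges meeting it by a new edge $[ef]$ from $s(e)$ to $r(f)$ for all edges $e$ into $w$ and $f$ out of $w$, a new source $\tilde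 w$, and an edge from $\tilde w$ to $r(f)$ for every edge $f$ out of $w$. Moves of type (X) are moves (X) and their inverses. Graphs are taken up to isomorphism. Matrices and components. Number the vertices that are not regular sources by $1,\dots,n$. Let $a_{ij}\in\{0,1,\dots,\infty\}$ be the number of edges from $i$ to $j$, let $c_i$ be the number of edges from regular sources to $i$, and set $b_{ij}=a_{ji}-\delta_{ij}$, $d_i=c_i+1$, $\mathsf B=(b_{ij})$, $\mathsf D=(d_i)$. The pair $(\mathsf D,\mathsf B)$ determines a graph with at most one regular source. The component $\gamma(i)\subseteq\{1,\dots,n\}$ consists of $i$ and all $j$ with paths from $i$ to $j$ and from $j$ to $i$; $|\gamma(i)|^\bullet$ is its number of regular vertices. Write $\gamma(i)\le\gamma(j)$ if $\gamma(i)=\gamma(j)$ or there is a path from $j$ to $i$. Let $\mathsf B_{\gamma(i),\gamma(j)}$ be the block of $\mathsf B$ with rows $\gamma(i)$ and columns $\gamma(j)$, let $\mathsf B_{\gamma(i)}=\mathsf B_{\gamma(i),\gamma(i)}$, and let $\mathsf B^\bullet_{\gamma(i)}$ consist of the columns of $\mathsf B_{\gamma(i)}$ at regular vertices. Let $\operatorname{mr}(\gamma(i))=k+\ell$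 where $\operatorname{cok}\mathsf B^\bullet_{\gamma(i)}\simeq\mathbb Z/m_1\oplus\dots\oplus\mathbb Z/m_k\oplus\mathbb Z^\ell$ with $1<m_1\mid m_2\mid\dots\mid m_k$. $E$ is in augmented canonical form if (I) every regular vertex that is not a source supports a loop; and, for all $i,j\in\{1,\dots,n\}$, (II) if there is a path from $i$ to $j$, there is an edge from $i$ to $j$; (III) if there is a path from $i$ to $j$ and $i$ is an infinite emitter, there are infinitely many edges from $i$ to $j$; (IV) if there are two different paths from $i$ to itself, neither visiting $i$ along the way, then $i$ supports at least two loops and $|\gamma(i)|^\bullet\ge\max\{3,\operatorname{mr}(\gamma(i))+2\}$. Row additions. For $i\ne j$, adding row $i$ to row $j$ means passing from a graph with at most one regular source, with pair $(\mathsf D,\mathsf B)$, to the graph whose pair is obtained by adding row $i$ of both $\mathsf D$ and $\mathsf B$ to row $j$. It is basic if $b_{ji}>0$ and $\sum_k b_{ki}>0$, and improved if $i$ supports a loop and there is a path from $i$ to $j$. Proposition. Consider the following algorithm, applied to an arbitrary graph $E$. Step 1. Use moves (O) to ensure that every infinite emitter emits either infinitely many or no edges to any given vertex. Step 2. Use moves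 (R+) to ensure that any regular vertex not supporting a loop is a source. Then use inverse moves (O) to collect regular sources, so that there is at most one. Step 3. Use moves (O) to ensure that no component has only one vertex but two or more edges, so that the properties of Steps 1 and 2 (including that there is at most one regular source) are preserved. Step 4. Use basic and improved row additions to ensure that all entries of $\mathsf B_{\gamma(i)}$ are positive for any component with $|\gamma(i)|>1$. Step 5. As long as some $i$ does not satisfy (IV), use one move (O) at a vertex of $\gamma(i)$ to increase the size of $\gamma(i)$ by one, so that the properties of Steps 1 and 2 are preserved; after each such move, go back to Step 4 if $\mathsf B_{\gamma(j)}$ is not positive for some $j$ with $|\gamma(j)|>1$. Step 6. Use improved row additions to ensure that $b_{ij}>0$ whenever $\gamma(i)\ne\gamma(j)$, $\gamma(i)\le\gamma(j)$ and $|\gamma(j)|>1$. Step 7. Use improved row additions to ensure that $b_{ij}>0$ whenever $\gamma(i)\ne\gamma(j)$, $\gamma(i)\le\gamma(j)$ and $\mathsf B_{\gamma(i),\gamma(j)}\ne 0$. Step 8. If there are $i,j,k$ with an edge from $i$ to $j$ and an edge from $j$ to $k$ but no edge from $i$ to $k$, choose such $i,j,k$, add row $j$ to row $k$ by basic row addition,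 and return to Step 7. Otherwise stop. Whatever choices are made, every step can be carried out when it is reached, the algorithm terminates, every graph met at the end of a step is obtained from $E$ by moves of type (O), (I+) and (R+), and the final graph $E'$ is in augmented canonical form with at most one regular source. In particular, any graph can be transformed by moves of type (O), (I+) and (R+) into a graph in augmented canonical form. -/

import Mathlib

open Relation

universe u

noncomputable section

/-- A directed graph (parallel edges and loops allowed) with finitely many vertices and
at most countably many edges, given by its source and range maps. -/
structure DirGraph where
  V : Type u
  E : Type u
  s : E → V
  r : E → V
  finiteV : Finite V
  countableE : Countable E

namespace DirGraph

instance (G : DirGraph.{u}) : Finite G.V := G.finiteV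

instance (G : DirGraph.{u}) : Countable G.E := G.countableE

/-- Isomorphism of graphs. -/
structure Iso (G H : DirGraph.{u}) where
  onV : G.V ≃ H.V
  onE : G.E ≃ H.E
  s_comm : ∀ e, H.s (onE e) = onV (G.s e)
  r_comm : ∀ e, H.r (onE e) = onV (G.r e)

/-! ### Kinds of vertices, paths -/

/-- The number of edges from `v` to `w`. -/
def adj (G : DirGraph.{u}) (v w : G.V) : ℕ∞ := ENat.card {e : G.E // G.s e = v ∧ G.r e = w}

/-- There is an edge from `v` to `w`. -/
def HasEdge (G : DirGraph.{u}) (v w : G.V) : Prop := ∃ e, G.s e = v ∧ G.r e = w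

/-- There is a path (of positive length) from `v` to `w`. -/
def HasPath (G : DirGraph.{u}) : G.V → G.V → Prop := TransGen G.HasEdge

/-- `v` is regular: it emits a finite, nonzero number of edges. -/
def IsRegular (G : DirGraph.{u}) (v : G.V) : Prop :=
  {e | G.s e = v}.Finite ∧ {e | G.s e = v}.Nonempty

/-- `v` emits infinitely many edges. -/
def IsInfiniteEmitter (G : DirGraph.{u}) (v : G.V) : Prop := {e | G.s e = v}.Infinite

/-- `v` receives no edges. -/
def IsSource (G : DirGraph.{u}) (v : G.V) : Prop := ∀ e, G.r e ≠ v

/-- `v` is both regular and a source. -/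
def IsRegularSource (G : DirGraph.{u}) (v : G.V) : Prop := G.IsRegular v ∧ G.IsSource v

/-- There is at most one regular source. -/
def AtMostOneRegularSource (G : DirGraph.{u}) : Prop :=
  ∀ v w, G.IsRegularSource v → G.IsRegularSource w → v = w

/-! ### The moves -/

open Classical in
/-- Outsplitting at `w`, the edges emitted by `w` being divided into `n` classes by `c`. -/
def outsplit (G : DirGraph.{u}) (w : G.V) {n : ℕ} (c : {e // G.s e = w} → Fin n) :
    DirGraph.{u} where
  V := {v // v ≠ w} ⊕ Fin n
  E := {e // G.r e ≠ w} ⊕ ({e // G.r e = w} × Fin n)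
  s := fun x =>
    let e : G.E := Sum.elim Subtype.val (fun p => p.1.1) x
    if h : G.s e = w then Sum.inr (c ⟨e, h⟩) else Sum.inl ⟨G.s e, h⟩
  r := Sum.elim (fun e => Sum.inl ⟨G.r e.1, e.2⟩) (fun p => Sum.inr p.2)
  finiteV := inferInstance
  countableE := inferInstance

/-- The partitions admitted for outsplitting: `w` is not a sink, all classes are nonempty,
and at most one class is infinite. -/
def IsOutPartition (G : DirGraph.{u}) (w : G.V) {n : ℕ} (c : {e // G.s e = w} → Fin n) : Prop :=
  {e | G.s e = w}.Nonempty ∧ Function.Surjective c ∧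
    ∀ i j, (c ⁻¹' {i}).Infinite → (c ⁻¹' {j}).Infinite → i = j

/-- `H` is formed by performing move (O) to `G`. -/
def MoveO (G H : DirGraph.{u}) : Prop :=
  ∃ (w : G.V) (n : ℕ) (c : {e // G.s e = w} → Fin n),
    G.IsOutPartition w c ∧ Nonempty (Iso (G.outsplit w c) H)

open Classical in
/-- Insplitting at `w`, the edges received by `w` being divided into `n` (possibly empty)
classes by `c`. -/
def insplit (G : DirGraph.{u}) (w : G.V) {n : ℕ} (c : {e // G.r e = w} → Fin n) :
    DirGraph.{u} where
  V := {v // v ≠ w} ⊕ Fin n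
  E := {e // G.s e ≠ w} ⊕ ({e // G.s e = w} × Fin n)
  s := Sum.elim (fun e => Sum.inl ⟨G.s e.1, e.2⟩) (fun p => Sum.inr p.2)
  r := fun x =>
    let e : G.E := Sum.elim Subtype.val (fun p => p.1.1) x
    if h : G.r e = w then Sum.inr (c ⟨e, h⟩) else Sum.inl ⟨G.r e, h⟩
  finiteV := inferInstance
  countableE := inferInstance

/-- `E` and `F` are move (I+) equivalent: they are insplittings of one graph at one regular
vertex, by two partitions into the same number of sets. -/
def MoveIPlus (E F : DirGraph.{u}) : Prop :=
  ∃ (G : DirGraph.{u}) (w : G.V) (n : ℕ) (c c' : {e // G.r e = w} → Fin n),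
    G.IsRegular w ∧ 0 < n ∧ Nonempty (Iso (G.insplit w c) E) ∧ Nonempty (Iso (G.insplit w c') F)

/-- Unital reduction at `w`, a vertex not supporting a loop. The three kinds of edges are the
edges of `G` avoiding `w`, the edges `[ef]`, and the edges emitted by the new source. -/
def reduce (G : DirGraph.{u}) (w : G.V) (hw : ¬ G.HasEdge w w) : DirGraph.{u} where
  V := {v // v ≠ w} ⊕ Unit
  E := {e // G.s e ≠ w ∧ G.r e ≠ w} ⊕ ({e // G.r e = w} × {f // G.s f = w}) ⊕ {f // G.s f = w}
  s := Sum.elim (fun e => Sum.inl ⟨G.s e.1, e.2.1⟩)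
    (Sum.elim (fun p => Sum.inl ⟨G.s p.1.1, fun h => hw ⟨p.1.1, h, p.1.2⟩⟩)
      (fun _ => Sum.inr ()))
  r := Sum.elim (fun e => Sum.inl ⟨G.r e.1, e.2.2⟩)
    (Sum.elim (fun p => Sum.inl ⟨G.r p.2.1, fun h => hw ⟨p.2.1, p.2.2, h⟩⟩)
      (fun f => Sum.inl ⟨G.r f.1, fun h => hw ⟨f.1, f.2, h⟩⟩))
  finiteV := inferInstance
  countableE := inferInstance

/-- `H` is formed by performing move (R+) to `G`. -/
def MoveRPlus (G H : DirGraph.{u}) : Prop :=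
  ∃ (w : G.V) (hw : ¬ G.HasEdge w w), G.IsRegular w ∧ Nonempty (Iso (G.reduce w hw) H)

/-- One move (O), (I+) or (R+). -/
def Move (G H : DirGraph.{u}) : Prop := MoveO G H ∨ MoveIPlus G H ∨ MoveRPlus G H

/-- `G` can be transformed into `H` by finitely many moves of type (O), (I+), (R+), that is, by
such moves and their inverses. -/
def MoveEquivalent : DirGraph.{u} → DirGraph.{u} → Prop :=
  ReflTransGen fun G H => Move G H ∨ Move H G

/-! ### Components and the matrix description -/

/-- The vertices that are not regular sources. -/
abbrev Vt (G : DirGraph.{u}) : Type u := {v : G.V // ¬ G.IsRegularSource v}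

/-- The component of `i`. -/
def comp (G : DirGraph.{u}) (i : G.Vt) : Set G.Vt :=
  {j | j = i ∨ (G.HasPath i.1 j.1 ∧ G.HasPath j.1 i.1)}

/-- The order relation between the components of `i` and `j`. -/
def CompLE (G : DirGraph.{u}) (i j : G.Vt) : Prop := G.HasPath j.1 i.1 ∨ G.comp i = G.comp j

/-- The column vector `D`: one plus the number of edges received from regular sources. -/
def D (G : DirGraph.{u}) (i : G.Vt) : ℕ∞ :=
  ENat.card {e : G.E // G.IsRegularSource (G.s e) ∧ G.r e = i.1} + 1

open Classical in
/-- The matrix `B`, with `B i j = adj j i - δ i j`. -/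
def B (G : DirGraph.{u}) : Matrix G.Vt G.Vt (WithTop ℤ) :=
  fun i j => ENat.map (fun n : ℕ => (n : ℤ)) (G.adj j.1 i.1) + ((if i = j then -1 else 0 : ℤ))

/-- The cokernel of the submatrix of `B` with rows the vertices of the component of `i` and
columns the regular vertices of that component (the entries of these columns are finite). -/
abbrev cokB (G : DirGraph.{u}) (i : G.Vt) : Type u :=
  (G.comp i → ℤ) ⧸ Submodule.span ℤ
    (Set.range fun (l : {l : G.comp i // G.IsRegular l.1.1}) (k : G.comp i) =>
      (G.B k.1 l.1.1).untopD 0)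

/-- The number `k + ℓ`, where the cokernel is `ℤ/d₁ ⊕ ⋯ ⊕ ℤ/dₖ ⊕ ℤ^ℓ` with `1 < d₁ ∣ ⋯ ∣ dₖ`.
By the structure theorem for finitely generated abelian groups there is exactly one such
number. -/
def mr (G : DirGraph.{u}) (i : G.Vt) : ℕ :=
  sInf {m | ∃ (k l : ℕ) (d : Fin k → ℕ), (∀ a, 1 < d a) ∧ (∀ a b, a ≤ b → d a ∣ d b) ∧
    m = k + l ∧ Nonempty (G.cokB i ≃+ ((a : Fin k) → ZMod (d a)) × (Fin l → ℤ))}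

/-- The list of edges `p` is a path from `v` to `v` that does not visit `v` on the way. -/
def IsReturnPath (G : DirGraph.{u}) (v : G.V) (p : List G.E) : Prop :=
  p.IsChain (fun e f => G.r e = G.s f) ∧ p.head?.map G.s = some v ∧
    p.getLast?.map G.r = some v ∧ ∀ e ∈ p.dropLast, G.r e ≠ v

/-- Condition (IV) of augmented canonical form at the vertex `i`. -/
def CondIV (G : DirGraph.{u}) (i : G.Vt) : Prop :=
  (∃ p q, p ≠ q ∧ G.IsReturnPath i.1 p ∧ G.IsReturnPath i.1 q) →
    2 ≤ G.adj i.1 i.1 ∧ max 3 (G.mr i + 2) ≤ {j ∈ G.comp i | G.IsRegular j.1}.ncard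

/-- Augmented canonical form. -/
structure IsAugmentedCanonical (G : DirGraph.{u}) : Prop where
  loops : ∀ v, G.IsRegular v → ¬ G.IsSource v → G.HasEdge v v
  paths : ∀ i j : G.Vt, G.HasPath i.1 j.1 → G.HasEdge i.1 j.1
  infemit : ∀ i j : G.Vt, G.HasPath i.1 j.1 → G.IsInfiniteEmitter i.1 → G.adj i.1 j.1 = ⊤
  large : ∀ i : G.Vt, G.CondIV i

/-! ### Row additions -/

open Classical in
/-- `F` is the graph whose pair `(D, B)` arises from the pair of `E` by adding row `i` to
row `j`. -/
def RowAdd (E F : DirGraph.{u}) (i j : E.Vt) : Prop :=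
  E.AtMostOneRegularSource ∧ F.AtMostOneRegularSource ∧
    ∃ φ : E.Vt ≃ F.Vt, F.D ∘ φ = Function.update E.D j (E.D j + E.D i) ∧
      F.B.submatrix φ φ = E.B.updateRow j (E.B j + E.B i)

/-- Basic row addition of row `i` to row `j`. -/
def BasicRowAdd (E F : DirGraph.{u}) (i j : E.Vt) : Prop :=
  i ≠ j ∧ 0 < E.B j i ∧ 0 < ∑ᶠ k, E.B k i ∧ RowAdd E F i j

/-- Improved row addition of row `i` to row `j`. -/
def ImprovedRowAdd (E F : DirGraph.{u}) (i j : E.Vt) : Prop :=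
  i ≠ j ∧ E.HasEdge i.1 i.1 ∧ E.HasPath i.1 j.1 ∧ RowAdd E F i j

/-! ### The algorithm -/

/-- An infinite emitter emits infinitely many or no edges to any given vertex. -/
def Prop1 (G : DirGraph.{u}) : Prop :=
  ∀ v, G.IsInfiniteEmitter v → ∀ w, G.adj v w = 0 ∨ G.adj v w = ⊤

/-- A regular vertex not supporting a loop is a source. -/
def Prop2 (G : DirGraph.{u}) : Prop := ∀ v, G.IsRegular v → ¬ G.HasEdge v v → G.IsSource v

/-- No component has only one vertex but two or more edges. -/
def Prop3 (G : DirGraph.{u}) : Prop :=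
  ∀ i : G.Vt, (G.comp i).ncard = 1 →
    ENat.card {e // (∃ j ∈ G.comp i, G.s e = j.1) ∧ (∃ j ∈ G.comp i, G.r e = j.1)} < 2

/-- The diagonal blocks of `B` for components with more than one vertex are positive. -/
def Prop4 (G : DirGraph.{u}) : Prop :=
  ∀ i : G.Vt, 1 < (G.comp i).ncard → ∀ k ∈ G.comp i, ∀ l ∈ G.comp i, 0 < G.B k l

/-- `B i j` is positive if the component of `j` is different from and above that of `i` and has
more than one vertex. -/
def Prop6 (G : DirGraph.{u}) : Prop :=
  ∀ i j : G.Vt, G.comp i ≠ G.comp j → G.CompLE i j → 1 < (G.comp j).ncard → 0 < G.B i j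

/-- Nonzero off-diagonal blocks of `B` are positive. -/
def Prop7 (G : DirGraph.{u}) : Prop :=
  ∀ i j : G.Vt, G.comp i ≠ G.comp j → G.CompLE i j →
    (∃ k ∈ G.comp i, ∃ l ∈ G.comp j, G.B k l ≠ 0) → 0 < G.B i j

/-- `F` arises from `E` by collecting regular sources into one regular source `w` of `F`; this
is an inverse move (O). -/
def CollectSources (E F : DirGraph.{u}) : Prop :=
  ∃ (w : F.V) (n : ℕ) (c : {e // F.s e = w} → Fin n),
    F.IsRegularSource w ∧ F.IsOutPartition w c ∧ Nonempty (Iso (F.outsplit w c) E)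

/-- `F` arises from `E` by a move (O) at a vertex `w` of the component of `i`, in such a way
that the component (the one of some copy of `w`) then has exactly one vertex more. -/
def EnlargesComp (E F : DirGraph.{u}) (i : E.Vt) : Prop :=
  ∃ w ∈ E.comp i, ∃ (n : ℕ) (c : {e // E.s e = w.1} → Fin n),
    E.IsOutPartition w.1 c ∧ Nonempty (Iso (E.outsplit w.1 c) F) ∧
    ∃ (k : Fin n) (v : (E.outsplit w.1 c).Vt),
      v.1 = Sum.inr k ∧ ((E.outsplit w.1 c).comp v).ncard = (E.comp i).ncard + 1

/-- The positions that an execution of the algorithm can be in. -/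
inductive Phase
  | step1 | step2 | collect | step3 | step4 | step5 | step6 | step7 | step8 | done

/-- The single (nondeterministic) transitions of the algorithm, between pairs of a position and
a graph. -/
inductive AlgStep : Phase × DirGraph.{u} → Phase × DirGraph.{u} → Prop
  | step1 {E F} : ReflTransGen MoveO E F → F.Prop1 → AlgStep (.step1, E) (.step2, F)
  | step2 {E F} : ReflTransGen MoveRPlus E F → F.Prop2 → AlgStep (.step2, E) (.collect, F)
  | collect {E F} : ReflTransGen CollectSources E F → F.AtMostOneRegularSource →
      AlgStep (.collect, E) (.step3, F)
  | step3 {E F} : ReflTransGen MoveO E F → F.Prop1 → F.Prop2 → F.Prop3 →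
      F.AtMostOneRegularSource → AlgStep (.step3, E) (.step4, F)
  | step4 {E F} :
      ReflTransGen (fun G H => ∃ i j, BasicRowAdd G H i j ∨ ImprovedRowAdd G H i j) E F →
      F.Prop4 → AlgStep (.step4, E) (.step5, F)
  | step5_back {E F} (i : E.Vt) : ¬ E.CondIV i → EnlargesComp E F i → F.Prop1 → F.Prop2 →
      ¬ F.Prop4 → AlgStep (.step5, E) (.step4, F)
  | step5_again {E F} (i : E.Vt) : ¬ E.CondIV i → EnlargesComp E F i → F.Prop1 → F.Prop2 →
      F.Prop4 → AlgStep (.step5, E) (.step5, F)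
  | step5_next {E} : (∀ i, E.CondIV i) → AlgStep (.step5, E) (.step6, E)
  | step6 {E F} : ReflTransGen (fun G H => ∃ i j, ImprovedRowAdd G H i j) E F →
      F.Prop6 → AlgStep (.step6, E) (.step7, F)
  | step7 {E F} : ReflTransGen (fun G H => ∃ i j, ImprovedRowAdd G H i j) E F →
      F.Prop7 → AlgStep (.step7, E) (.step8, F)
  | step8_back {E F} (i j k : E.Vt) : E.HasEdge i.1 j.1 → E.HasEdge j.1 k.1 →
      ¬ E.HasEdge i.1 k.1 → BasicRowAdd E F j k → AlgStep (.step8, E) (.step7, F)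
  | step8_done {E} : (∀ i j k : E.Vt, E.HasEdge i.1 j.1 → E.HasEdge j.1 k.1 →
      E.HasEdge i.1 k.1) → AlgStep (.step8, E) (.done, E)

/-- An execution of the algorithm started on `E` can arrive at the position `p` with the
graph `F`. -/
def Reaches (E : DirGraph.{u}) (p : Phase) (F : DirGraph.{u}) : Prop :=
  ReflTransGen AlgStep (.step1, E) (p, F)

end DirGraph

end

namespace DirGraph

/-! ### Descriptions in terms of the numbers of edges -/

/-! The algorithm is analysed through numbers of edges. Vertex sets are finite and edge sets
countable, so a graph is determined up to isomorphism by its adjacency numbers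
(`nonempty_iso_of_adj`), and a graph with at most one regular source by `vadj` and `D`
(`SameData.nonempty_iso`).

In terms of `vadj`, adding row i to row j adds the edges a → i to the edges a → j, with one edge
subtracted when a = i (`rowA`). Once infinite emitters emit infinitely many or no edges to any
vertex and regular vertices that are not sources support loops, an edge a → b forces a loop at a or
infinitely many edges a → b (`hasLoop_or_top`). Hence a permitted row addition never decreases a
number of edges. As there is a path from i to j, it changes neither reachability nor, consequently,
components. It also preserves regularity and the cokernels (`Grow`, `IsRowOp.grow`). So whatever an
earlier step has achieved persists, and the number of nonpositive entries of B measures progress in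
Steps 4, 6, 7 and 8.

Row additions are compositions of moves. For a basic one, (O) separates a single edge i → j, (R+)
removes the copy of i that emits it, and the regular sources are collected (`exists_split_reduce`,
`dataEquivalent_basic`). An improved one follows by induction along a path from i to j, using a
commutator identity for elementary matrices (`rowA_comm`, `dataEquivalent_improved`). Moves (O) and
(R+) and their inverses suffice throughout.

In Step 5, preservation of the properties of Steps 1 and 2 forces every class of the outsplitting to
contain a loop. Such a splitting into two classes keeps the reachability between originals, keeps
all cokernels, and gives exactly one component one more regular vertex (`LoopSplit`,
`LoopSplit.mr_eq_of_mem`). The total number of missing regular vertices therefore falls, while row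
additions do not raise it. A lexicographic rank combining these measures decreases in every
transition, and the invariants at each position show that a next transition exists and that the
final graph is canonical. -/

theorem adj_eq_encard (G : DirGraph.{u}) (v w : G.V) :
    G.adj v w = {e | G.s e = v ∧ G.r e = w}.encard := rfl

theorem hasEdge_iff {G : DirGraph.{u}} {v w : G.V} : G.HasEdge v w ↔ G.adj v w ≠ 0 := by
  rw [adj_eq_encard, Set.encard_ne_zero]; rfl

theorem isInfiniteEmitter_iff {G : DirGraph.{u}} {v : G.V} :
    G.IsInfiniteEmitter v ↔ ∃ w, G.adj v w = ⊤ := by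
  have h : {e | G.s e = v} = ⋃ w, {e | G.s e = v ∧ G.r e = w} := by ext; simp
  simp only [adj_eq_encard, Set.encard_eq_top_iff, IsInfiniteEmitter]
  rw [h, Set.Infinite, ← not_forall_not]
  refine not_congr ⟨fun hf w => ?_, fun hf => Set.finite_iUnion fun w => ?_⟩
  · exact not_not.2 (hf.subset (Set.subset_iUnion (fun w => {e | G.s e = v ∧ G.r e = w}) w))
  · exact not_not.1 (hf w)

theorem isRegular_iff {G : DirGraph.{u}} {v : G.V} :
    G.IsRegular v ↔ (∀ w, G.adj v w ≠ ⊤) ∧ ∃ w, G.adj v w ≠ 0 := by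
  refine and_congr ?_ ?_
  · have := not_congr (isInfiniteEmitter_iff (v := v))
    rw [IsInfiniteEmitter, Set.not_infinite] at this
    simpa using this
  · simp only [← hasEdge_iff]
    exact ⟨fun ⟨e, he⟩ => ⟨G.r e, e, he, rfl⟩, fun ⟨_, e, he, _⟩ => ⟨e, he⟩⟩

theorem isSource_iff {G : DirGraph.{u}} {v : G.V} : G.IsSource v ↔ ∀ u, G.adj u v = 0 := by
  have : ∀ u, G.adj u v = 0 ↔ ¬ G.HasEdge u v := fun u => by rw [hasEdge_iff, not_not]
  simp only [this]
  exact ⟨fun h u ⟨e, _, he⟩ => h e he, fun h e he => h (G.s e) ⟨e, rfl, he⟩⟩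

theorem not_isRegularSource_of_hasEdge {G : DirGraph.{u}} {v w : G.V} (h : G.HasEdge v w) :
    ¬ G.IsRegularSource w := fun hw => by
  obtain ⟨e, _, he⟩ := h
  exact hw.2 e he

theorem adj_eq_zero_of_isRegularSource {G : DirGraph.{u}} {w : G.V} (v : G.V)
    (hw : G.IsRegularSource w) : G.adj v w = 0 := isSource_iff.1 hw.2 v

theorem IsInfiniteEmitter.not_isRegular {G : DirGraph.{u}} {v : G.V}
    (h : G.IsInfiniteEmitter v) : ¬ G.IsRegular v := fun hr => h hr.1

theorem HasEdge.isRegular_or {G : DirGraph.{u}} {v w : G.V} (h : G.HasEdge v w) :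
    G.IsRegular v ∨ G.IsInfiniteEmitter v := by
  obtain ⟨e, he, _⟩ := h
  by_cases hf : {e | G.s e = v}.Finite
  · exact .inl ⟨hf, e, he⟩
  · exact .inr hf

theorem encard_emitted_to {G : DirGraph.{u}} (P : G.V → Prop) (v : G.V) :
    ENat.card {e : G.E // P (G.s e) ∧ G.r e = v} = ∑ᶠ u : {u // P u}, G.adj u.1 v := by
  classical
  have := Fintype.ofFinite {u // P u}
  rw [finsum_eq_sum_of_fintype]
  have h : {e | P (G.s e) ∧ G.r e = v} = ⋃ u : {u // P u}, {e | G.s e = u.1 ∧ G.r e = v} := by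
    ext e; simp
  change Set.encard {e | P (G.s e) ∧ G.r e = v} = _
  rw [h, Set.encard_iUnion_of_finite, finsum_eq_sum_of_fintype]
  · rfl
  · intro a b hab
    refine Set.disjoint_left.2 fun e he he' => hab (Subtype.ext (he.1.symm.trans he'.1))

theorem D_eq (G : DirGraph.{u}) (i : G.Vt) :
    G.D i = ∑ᶠ u : {u // G.IsRegularSource u}, G.adj u.1 i.1 + 1 := by
  rw [D, encard_emitted_to]

theorem D_ne_top (G : DirGraph.{u}) (i : G.Vt) : G.D i ≠ ⊤ := by
  classical
  have := Fintype.ofFinite {u // G.IsRegularSource u}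
  rw [D_eq, finsum_eq_sum_of_fintype]
  have : ∀ u : {u // G.IsRegularSource u}, G.adj u.1 i.1 ≠ ⊤ := fun u =>
    (isRegular_iff.1 u.2.1).1 i.1
  refine WithTop.add_ne_top.2 ⟨?_, ENat.one_ne_top⟩
  exact WithTop.sum_ne_top.2 fun u _ => this u

theorem one_le_D (G : DirGraph.{u}) (i : G.Vt) : 1 ≤ G.D i := le_add_self

/-! ### Isomorphisms -/

theorem Iso.adj {G H : DirGraph.{u}} (f : Iso G H) (v w : G.V) :
    H.adj (f.onV v) (f.onV w) = G.adj v w := by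
  refine (ENat.card_congr (f.onE.subtypeEquiv fun e => ?_)).symm
  rw [f.s_comm, f.r_comm, f.onV.injective.eq_iff, f.onV.injective.eq_iff]

/-- The identity isomorphism. -/
def Iso.refl (G : DirGraph.{u}) : Iso G G := ⟨.refl _, .refl _, fun _ => rfl, fun _ => rfl⟩

/-- `ENat.card` does not separate infinite cardinals; countability leaves only one of them. -/
theorem nonempty_equiv_of_enatCard_eq {α β : Type*} [Countable α] [Countable β]
    (h : ENat.card α = ENat.card β) : Nonempty (α ≃ β) := by
  rcases finite_or_infinite α with hα | hα
  · have hβ : Finite β := by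
      rw [← ENat.card_lt_top, ← h]; exact ENat.card_lt_top.2 hα
    rw [ENat.card_eq_coe_natCard, ENat.card_eq_coe_natCard, Nat.cast_inj] at h
    exact ⟨(Finite.equivFin α).trans ((finCongr h).trans (Finite.equivFin β).symm)⟩
  · have hβ : Infinite β := by
      rw [← ENat.card_eq_top, ← h, ENat.card_eq_top]; exact hα
    obtain ⟨a⟩ := nonempty_denumerable α
    obtain ⟨b⟩ := nonempty_denumerable β
    exact ⟨Denumerable.equiv₂ α β⟩

/-- The edges are the disjoint union of the sets of edges with prescribed ends, so bijections
between these sets, chosen independently, glue. -/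
theorem nonempty_iso_of_adj {G H : DirGraph.{u}} (φ : G.V ≃ H.V)
    (h : ∀ v w, H.adj (φ v) (φ w) = G.adj v w) : Nonempty (Iso G H) := by
  have hf : ∀ p : G.V × G.V, Nonempty ({e // (G.s e, G.r e) = p} ≃
      {e // (φ.symm (H.s e), φ.symm (H.r e)) = p}) := fun p => by
    apply nonempty_equiv_of_enatCard_eq
    refine Eq.trans ?_ ((h p.1 p.2).symm.trans ?_)
    · exact ENat.card_congr (Equiv.subtypeEquivRight fun e => by rw [Prod.ext_iff])
    · exact ENat.card_congr (Equiv.subtypeEquivRight fun e => by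
        rw [Prod.ext_iff, Equiv.symm_apply_eq, Equiv.symm_apply_eq])
  have ε := fun p => Classical.choice (hf p)
  have hE' : ∃ E : G.E ≃ H.E,
      ∀ e, (φ.symm (H.s (E e)), φ.symm (H.r (E e))) = (G.s e, G.r e) := by
    refine ⟨(Equiv.sigmaFiberEquiv fun e => (G.s e, G.r e)).symm.trans
    ((Equiv.sigmaCongrRight ε).trans
      (Equiv.sigmaFiberEquiv fun e => (φ.symm (H.s e), φ.symm (H.r e)))), fun e =>
    (ε (G.s e, G.r e) ⟨e, rfl⟩).2⟩
  obtain ⟨E, hE⟩ := hE'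
  refine ⟨⟨φ, E, fun e => ?_, fun e => ?_⟩⟩
  · exact (φ.symm_apply_eq.1 (Prod.ext_iff.1 (hE e)).1)
  · exact (φ.symm_apply_eq.1 (Prod.ext_iff.1 (hE e)).2)

/-- The inverse of an isomorphism. -/
def Iso.symm {G H : DirGraph.{u}} (f : Iso G H) : Iso H G where
  onV := f.onV.symm
  onE := f.onE.symm
  s_comm e := by rw [Equiv.eq_symm_apply, ← f.s_comm, Equiv.apply_symm_apply]
  r_comm e := by rw [Equiv.eq_symm_apply, ← f.r_comm, Equiv.apply_symm_apply]

/-- The composition of isomorphisms. -/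
def Iso.trans {G H K : DirGraph.{u}} (f : Iso G H) (g : Iso H K) : Iso G K where
  onV := f.onV.trans g.onV
  onE := f.onE.trans g.onE
  s_comm e := by simp [g.s_comm, f.s_comm]
  r_comm e := by simp [g.r_comm, f.r_comm]

theorem Iso.isRegular {G H : DirGraph.{u}} (f : Iso G H) (v : G.V) :
    H.IsRegular (f.onV v) ↔ G.IsRegular v := by
  simp only [isRegular_iff, ← f.adj, f.onV.forall_congr_left, f.onV.exists_congr_left,
    Equiv.apply_symm_apply]

theorem Iso.isSource {G H : DirGraph.{u}} (f : Iso G H) (v : G.V) :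
    H.IsSource (f.onV v) ↔ G.IsSource v := by
  simp only [isSource_iff, ← f.adj, f.onV.forall_congr_left, Equiv.apply_symm_apply]

theorem Iso.isRegularSource {G H : DirGraph.{u}} (f : Iso G H) (v : G.V) :
    H.IsRegularSource (f.onV v) ↔ G.IsRegularSource v :=
  and_congr (f.isRegular v) (f.isSource v)

theorem Iso.atMostOne {G H : DirGraph.{u}} (f : Iso G H) (h : G.AtMostOneRegularSource) :
    H.AtMostOneRegularSource := fun v w hv hw => by
  have := h (f.onV.symm v) (f.onV.symm w) (by rwa [← f.isRegularSource, f.onV.apply_symm_apply])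
    (by rwa [← f.isRegularSource, f.onV.apply_symm_apply])
  exact f.onV.symm.injective this

/-! ### The adjacency matrix of the vertices that are not regular sources -/

/-- The numbers of edges between the vertices that are not regular sources. -/
noncomputable def vadj (G : DirGraph.{u}) (a b : G.Vt) : ℕ∞ := G.adj a.1 b.1

/-- Every entry in a row with an infinite entry is zero or infinite. -/
def TopOrZero {ι : Type*} (A : ι → ι → ℕ∞) : Prop :=
  ∀ a b c, A a b = ⊤ → A a c = 0 ∨ A a c = ⊤

/-- The row of `a` is finite and nonzero. -/
def RegularRow {ι : Type*} (A : ι → ι → ℕ∞) (a : ι) : Prop := (∀ b, A a b ≠ ⊤) ∧ ∃ b, A a b ≠ 0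

/-- The diagonal entries in finite nonzero rows are nonzero. -/
def LoopAtRegular {ι : Type*} (A : ι → ι → ℕ∞) : Prop := ∀ a, RegularRow A a → A a a ≠ 0

/-- Regular sources receive nothing, so ignoring them as targets loses none of the edges emitted by
`a`. -/
theorem isRegular_iff_vadj {G : DirGraph.{u}} {a : G.Vt} :
    G.IsRegular a.1 ↔ RegularRow G.vadj a := by
  rw [isRegular_iff]
  refine and_congr ⟨fun h b => h b.1, fun h w hw => ?_⟩
    ⟨fun ⟨w, hw⟩ => ⟨⟨w, not_isRegularSource_of_hasEdge (hasEdge_iff.2 hw)⟩, hw⟩,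
      fun ⟨b, hb⟩ => ⟨b.1, hb⟩⟩
  exact h ⟨w, not_isRegularSource_of_hasEdge (v := a.1) (hasEdge_iff.2 (by simp [hw]))⟩ hw

theorem isInfiniteEmitter_iff_vadj {G : DirGraph.{u}} {a : G.Vt} :
    G.IsInfiniteEmitter a.1 ↔ ∃ b, G.vadj a b = ⊤ := by
  rw [isInfiniteEmitter_iff]
  exact ⟨fun ⟨w, hw⟩ =>
    ⟨⟨w, not_isRegularSource_of_hasEdge (v := a.1) (hasEdge_iff.2 (by simp [hw]))⟩, hw⟩,
    fun ⟨b, hb⟩ => ⟨b.1, hb⟩⟩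

theorem prop1_iff {G : DirGraph.{u}} : G.Prop1 ↔ TopOrZero G.vadj := by
  constructor
  · intro h a b c hab
    exact h a.1 (isInfiniteEmitter_iff.2 ⟨_, hab⟩) c.1
  · intro h v hv w
    have hv' : ¬ G.IsRegularSource v := fun h => hv.not_isRegular h.1
    by_cases hw : G.IsRegularSource w
    · exact .inl (adj_eq_zero_of_isRegularSource v hw)
    · obtain ⟨b, hb⟩ := (isInfiniteEmitter_iff_vadj (a := ⟨v, hv'⟩)).1 hv
      exact h ⟨v, hv'⟩ b ⟨w, hw⟩ hb

theorem prop2_iff {G : DirGraph.{u}} : G.Prop2 ↔ LoopAtRegular G.vadj := by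
  constructor
  · intro h a ha hl
    have hr := isRegular_iff_vadj.2 ha
    exact a.2 ⟨hr, h a.1 hr fun he => hasEdge_iff.1 he hl⟩
  · intro h v hv hl
    by_contra hs
    exact hl (hasEdge_iff.2 (h ⟨v, fun h => hs h.2⟩ (isRegular_iff_vadj.1 hv)))

/-- Reachability with respect to the nonzero entries of a matrix. -/
def MatPath {ι : Type*} (A : ι → ι → ℕ∞) : ι → ι → Prop := TransGen fun a b => A a b ≠ 0

/-- A regular source can occur only at the start of a path, so a path that starts outside the
regular sources never meets one. -/
theorem hasPath_iff {G : DirGraph.{u}} {a b : G.Vt} :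
    G.HasPath a.1 b.1 ↔ MatPath G.vadj a b := by
  constructor
  · suffices ∀ w, G.HasPath a.1 w → ∀ hw : ¬ G.IsRegularSource w, MatPath G.vadj a ⟨w, hw⟩ from
      fun h => this b.1 h b.2
    intro w h
    induction h with
    | single h => exact fun hw => .single (hasEdge_iff.1 h)
    | @tail x y hx hxy ih =>
      intro hw
      have hx' : ¬ G.IsRegularSource x := by
        rcases hx with hx | ⟨_, hx⟩ <;> exact not_isRegularSource_of_hasEdge hx
      exact .tail (ih hx') (hasEdge_iff.1 hxy)
  · intro h
    exact TransGen.lift Subtype.val (fun _ _ h => hasEdge_iff.2 h) _ _ h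

theorem hasEdge_iff_vadj {G : DirGraph.{u}} {a b : G.Vt} :
    G.HasEdge a.1 b.1 ↔ G.vadj a b ≠ 0 := hasEdge_iff

theorem mem_comp_iff {G : DirGraph.{u}} {i j : G.Vt} :
    j ∈ G.comp i ↔ j = i ∨ (MatPath G.vadj i j ∧ MatPath G.vadj j i) := by
  rw [comp, Set.mem_ofPred_eq, hasPath_iff, hasPath_iff]

theorem self_mem_comp (G : DirGraph.{u}) (i : G.Vt) : i ∈ G.comp i := .inl rfl

theorem mem_comp_symm {G : DirGraph.{u}} {i j : G.Vt} (h : j ∈ G.comp i) : i ∈ G.comp j := by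
  rcases h with rfl | h
  · exact .inl rfl
  · exact .inr h.symm

theorem mem_comp_trans {G : DirGraph.{u}} {i j k : G.Vt} (h : j ∈ G.comp i)
    (h' : k ∈ G.comp j) : k ∈ G.comp i := by
  rcases h with rfl | h
  · exact h'
  · rcases h' with rfl | h'
    · exact .inr h
    · exact .inr ⟨h.1.trans h'.1, h'.2.trans h.2⟩

theorem comp_eq_iff {G : DirGraph.{u}} {i j : G.Vt} : G.comp i = G.comp j ↔ j ∈ G.comp i := by
  refine ⟨fun h => h ▸ self_mem_comp G j, fun h => Set.ext fun k => ?_⟩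
  exact ⟨fun hk => mem_comp_trans (mem_comp_symm h) hk, fun hk => mem_comp_trans h hk⟩

theorem exists_ne_mem_comp {G : DirGraph.{u}} {i : G.Vt} (h : 1 < (G.comp i).ncard) :
    ∃ j ∈ G.comp i, j ≠ i := by
  obtain ⟨a, ha, b, hb, hab⟩ := (Set.one_lt_ncard_iff_nontrivial).1 h
  by_cases hai : a = i
  · exact ⟨b, hb, fun hbi => hab (hai.trans hbi.symm)⟩
  · exact ⟨a, ha, hai⟩

theorem one_lt_ncard_comp {G : DirGraph.{u}} {i j : G.Vt} (hj : j ∈ G.comp i) (h : j ≠ i) :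
    1 < (G.comp i).ncard :=
  Set.one_lt_ncard_iff_nontrivial.2 ⟨j, hj, i, self_mem_comp G i, h⟩

theorem ncard_comp_pos (G : DirGraph.{u}) (i : G.Vt) : 0 < (G.comp i).ncard :=
  (Set.ncard_pos (Set.toFinite _)).2 ⟨i, self_mem_comp G i⟩

theorem matPath_of_mem_comp {G : DirGraph.{u}} {i j : G.Vt} (h : 1 < (G.comp i).ncard)
    (hj : j ∈ G.comp i) : MatPath G.vadj i j := by
  rcases mem_comp_iff.1 hj with rfl | hj
  · obtain ⟨k, hk, hki⟩ := exists_ne_mem_comp h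
    have := (mem_comp_iff.1 hk).resolve_left hki
    exact this.1.trans this.2
  · exact hj.1

/-- A row with a nonzero entry is either finite, hence regular and provided with a loop, or
infinite, in which case its nonzero entries are all infinite. This dichotomy is what keeps row
additions monotone. -/
theorem hasLoop_or_top {ι : Type*} {A : ι → ι → ℕ∞} (h1 : TopOrZero A) (h2 : LoopAtRegular A)
    {a b : ι} (hab : A a b ≠ 0) : A a a ≠ 0 ∨ A a b = ⊤ := by
  by_cases hf : ∀ c, A a c ≠ ⊤
  · exact .inl (h2 a ⟨hf, b, hab⟩)
  · push Not at hf
    obtain ⟨c, hc⟩ := hf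
    exact .inr ((h1 a c b hc).resolve_left hab)

theorem enatMap_natCast_nonneg (n : ℕ∞) : (0 : WithTop ℤ) ≤ ENat.map (fun n : ℕ => (n : ℤ)) n := by
  cases n with
  | top => simp
  | coe n => simp

theorem B_eq_of_ne {G : DirGraph.{u}} {i j : G.Vt} (h : i ≠ j) :
    G.B i j = ENat.map (fun n : ℕ => (n : ℤ)) (G.vadj j i) := by
  simp [B, h, vadj]

theorem B_self {G : DirGraph.{u}} (i : G.Vt) :
    G.B i i = ENat.map (fun n : ℕ => (n : ℤ)) (G.vadj i i) + ((-1 : ℤ) : WithTop ℤ) := by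
  simp [B, vadj]

theorem B_pos_of_ne {G : DirGraph.{u}} {i j : G.Vt} (h : i ≠ j) :
    0 < G.B i j ↔ G.vadj j i ≠ 0 := by
  rw [B_eq_of_ne h]
  cases G.vadj j i with
  | top => simp
  | coe n =>
    have : (0 : WithTop ℤ) < ((n : ℤ) : WithTop ℤ) ↔ (0 : ℤ) < n := by
      rw [← WithTop.coe_zero, WithTop.coe_lt_coe]
    simp only [ENat.map_natCast, this]
    norm_cast
    exact Nat.pos_iff_ne_zero

theorem B_self_pos {G : DirGraph.{u}} {i : G.Vt} : 0 < G.B i i ↔ 2 ≤ G.vadj i i := by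
  rw [B_self]
  cases G.vadj i i with
  | top => simp
  | coe n =>
    simp only [ENat.map_natCast]
    rw [← WithTop.coe_add, ← WithTop.coe_zero, WithTop.coe_lt_coe]
    norm_cast
    omega

theorem hasEdge_of_B_pos {G : DirGraph.{u}} {i j : G.Vt} (h : 0 < G.B i j) : G.vadj j i ≠ 0 := by
  by_cases hij : i = j
  · subst hij
    have := B_self_pos.1 h
    intro h0
    simp [h0] at this
  · exact (B_pos_of_ne hij).1 h

theorem B_le_of_vadj_le {G H : DirGraph.{u}} {φ : G.Vt ≃ H.Vt} {i j : G.Vt}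
    (h : 0 < G.B i j) (hle : G.vadj j i ≤ H.vadj (φ j) (φ i)) : 0 < H.B (φ i) (φ j) := by
  by_cases hij : i = j
  · subst hij
    exact B_self_pos.2 ((B_self_pos.1 h).trans hle)
  · refine (B_pos_of_ne (φ.injective.ne hij)).2 fun h0 => (B_pos_of_ne hij).1 h ?_
    exact le_antisymm (h0 ▸ hle) bot_le

/-! ### The graph determined by a pair `(D, B)` -/

/-- A bijection that preserves the numbers of edges and the column vectors `D`. -/
def SameData {G H : DirGraph.{u}} (φ : G.Vt ≃ H.Vt) : Prop :=
  (∀ a b, H.vadj (φ a) (φ b) = G.vadj a b) ∧ ∀ a, H.D (φ a) = G.D a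

theorem D_eq_of_isRegularSource {G : DirGraph.{u}} (h : G.AtMostOneRegularSource) {s : G.V}
    (hs : G.IsRegularSource s) (a : G.Vt) : G.D a = G.adj s a.1 + 1 := by
  have : Unique {v // G.IsRegularSource v} :=
    ⟨⟨⟨s, hs⟩⟩, fun v => Subtype.ext (h v.1 s v.2 hs)⟩
  have hd : (default : {v // G.IsRegularSource v}) = ⟨s, hs⟩ := Subsingleton.elim _ _
  rw [D_eq, finsum_unique, hd]

theorem D_eq_one {G : DirGraph.{u}} (h : ∀ s, ¬ G.IsRegularSource s) (a : G.Vt) : G.D a = 1 := by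
  have : IsEmpty {v // G.IsRegularSource v} := ⟨fun v => h v.1 v.2⟩
  rw [D_eq, finsum_of_isEmpty, zero_add]

theorem exists_isRegularSource_iff {G : DirGraph.{u}} (h : G.AtMostOneRegularSource) :
    (∃ s, G.IsRegularSource s) ↔ ∃ a, G.D a ≠ 1 := by
  constructor
  · rintro ⟨s, hs⟩
    obtain ⟨w, hw⟩ := (isRegular_iff.1 hs.1).2
    refine ⟨⟨w, not_isRegularSource_of_hasEdge (hasEdge_iff.2 hw)⟩, fun h1 => hw ?_⟩
    rw [D_eq_of_isRegularSource h hs] at h1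
    simpa using h1
  · rintro ⟨a, ha⟩
    by_contra hs
    push Not at hs
    exact ha (D_eq_one hs a)

/-- `D` minus one records the edges emitted by the only regular source. Such a source emits an edge,
so it is absent exactly when `D` is constantly one, and nothing about it is lost. -/
theorem SameData.nonempty_iso {G H : DirGraph.{u}} {φ : G.Vt ≃ H.Vt} (hφ : SameData φ)
    (hG : G.AtMostOneRegularSource) (hH : H.AtMostOneRegularSource) : Nonempty (Iso G H) := by
  classical
  have hiff : Nonempty {v // G.IsRegularSource v} ↔ Nonempty {v // H.IsRegularSource v} := by
    rw [nonempty_subtype, nonempty_subtype, exists_isRegularSource_iff hG,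
      exists_isRegularSource_iff hH, ← φ.exists_congr_right]
    simp only [hφ.2]
  have : Subsingleton {v // G.IsRegularSource v} := ⟨fun a b => Subtype.ext (hG _ _ a.2 b.2)⟩
  have : Subsingleton {v // H.IsRegularSource v} := ⟨fun a b => Subtype.ext (hH _ _ a.2 b.2)⟩
  let e : {v // G.IsRegularSource v} ≃ {v // H.IsRegularSource v} :=
    ⟨fun a => (hiff.1 ⟨a⟩).some, fun b => (hiff.2 ⟨b⟩).some, fun _ => Subsingleton.elim _ _,
      fun _ => Subsingleton.elim _ _⟩
  have key : ∀ x y : {v // G.IsRegularSource v} ⊕ G.Vt,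
      H.adj (Equiv.sumCompl _ (Equiv.sumCongr e φ x)) (Equiv.sumCompl _ (Equiv.sumCongr e φ y)) =
      G.adj (Equiv.sumCompl _ x) (Equiv.sumCompl _ y) := by
    rintro x (y | y)
    · exact (adj_eq_zero_of_isRegularSource _ (e y).2).trans
        (adj_eq_zero_of_isRegularSource _ y.2).symm
    · rcases x with x | x
      · have := hφ.2 y
        rw [D_eq_of_isRegularSource hG x.2, D_eq_of_isRegularSource hH (e x).2] at this
        exact ENat.add_left_injective_of_ne_top ENat.one_ne_top this
      · exact hφ.1 x y
  refine nonempty_iso_of_adj ((Equiv.sumCompl G.IsRegularSource).symm.trans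
    ((Equiv.sumCongr e φ).trans (Equiv.sumCompl H.IsRegularSource))) fun v w => ?_
  simpa using key ((Equiv.sumCompl G.IsRegularSource).symm v)
    ((Equiv.sumCompl G.IsRegularSource).symm w)

/-- The restriction of an isomorphism to the vertices that are not regular sources. -/
def Iso.onVt {G H : DirGraph.{u}} (f : Iso G H) : G.Vt ≃ H.Vt :=
  f.onV.subtypeEquiv fun v => not_congr (f.isRegularSource v).symm

theorem Iso.sameData {G H : DirGraph.{u}} (f : Iso G H) : SameData f.onVt := by
  refine ⟨fun a b => f.adj _ _, fun a => ?_⟩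
  rw [D, D]
  congr 1
  refine (ENat.card_congr (f.onE.subtypeEquiv fun e => ?_)).symm
  rw [f.s_comm, f.isRegularSource, f.r_comm]
  exact and_congr Iff.rfl f.onV.injective.eq_iff.symm

theorem SameData.symm {G H : DirGraph.{u}} {φ : G.Vt ≃ H.Vt} (h : SameData φ) :
    SameData φ.symm :=
  ⟨fun a b => by rw [← h.1, φ.apply_symm_apply, φ.apply_symm_apply],
    fun a => by rw [← h.2, φ.apply_symm_apply]⟩

theorem SameData.trans {G H K : DirGraph.{u}} {φ : G.Vt ≃ H.Vt} {ψ : H.Vt ≃ K.Vt}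
    (h : SameData φ) (h' : SameData ψ) : SameData (φ.trans ψ) :=
  ⟨fun a b => (h'.1 _ _).trans (h.1 a b), fun a => (h'.2 _).trans (h.2 a)⟩

theorem SameData.prop1 {G H : DirGraph.{u}} {φ : G.Vt ≃ H.Vt} (h : SameData φ) (hG : G.Prop1) :
    H.Prop1 := by
  rw [prop1_iff] at *
  intro a b c
  rw [← φ.apply_symm_apply a, ← φ.apply_symm_apply b, ← φ.apply_symm_apply c, h.1, h.1]
  exact hG _ _ _

theorem SameData.prop2 {G H : DirGraph.{u}} {φ : G.Vt ≃ H.Vt} (h : SameData φ) (hG : G.Prop2) :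
    H.Prop2 := by
  rw [prop2_iff] at *
  intro a ⟨ha, b, hb⟩
  rw [← φ.apply_symm_apply a, h.1]
  refine hG _ ⟨fun c => ?_, φ.symm b, ?_⟩
  · rw [← h.1, φ.apply_symm_apply]
    exact ha _
  · rwa [← h.1, φ.apply_symm_apply, φ.apply_symm_apply]

/-- The graph with given numbers of edges. -/
def ofAdj (V : Type u) [Finite V] (A : V → V → ℕ∞) : DirGraph.{u} where
  V := V
  E := Σ p : V × V, ULift.{u} {n : ℕ // (n : ℕ∞) < A p.1 p.2}
  s e := e.1.1
  r e := e.1.2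
  finiteV := inferInstance
  countableE := inferInstance

theorem enatCard_lt (a : ℕ∞) : ENat.card {n : ℕ // (n : ℕ∞) < a} = a := by
  cases a with
  | top =>
    rw [ENat.card_congr (Equiv.subtypeUnivEquiv fun n => ENat.natCast_lt_top n)]
    simp
  | coe m =>
    rw [ENat.card_congr ((Equiv.subtypeEquivRight fun n => by rw [Nat.cast_lt]).trans
      Fin.equivSubtype.symm : {n : ℕ // (n : ℕ∞) < m} ≃ Fin m)]
    simp

theorem adj_ofAdj (V : Type u) [Finite V] (A : V → V → ℕ∞) (v w : V) :
    (ofAdj V A).adj v w = A v w := by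
  refine Eq.trans (ENat.card_congr ?_) (enatCard_lt (A v w))
  exact
    { toFun := fun e => ⟨e.1.2.down.1, by
        obtain ⟨⟨⟨a, b⟩, n⟩, h1, h2⟩ := e
        exact h1 ▸ h2 ▸ n.down.2⟩
      invFun := fun n => ⟨⟨(v, w), ⟨n⟩⟩, rfl, rfl⟩
      left_inv := by
        rintro ⟨⟨⟨a, b⟩, ⟨n, hn⟩⟩, h1, h2⟩
        cases h1
        cases h2
        rfl
      right_inv := fun n => rfl }

theorem exists_adj_eq (V : Type u) [Finite V] (A : V → V → ℕ∞) :
    ∃ (G : DirGraph.{u}) (e : V ≃ G.V), ∀ v w, G.adj (e v) (e w) = A v w :=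
  ⟨ofAdj V A, Equiv.refl V, adj_ofAdj V A⟩

/-- `G` has at most one regular source, the numbers of edges between the other vertices are given
by `A`, and the column vector `D` is given by `d`. -/
def Represents {ι : Type*} (A : ι → ι → ℕ∞) (d : ι → ℕ∞) (G : DirGraph.{u}) : Prop :=
  G.AtMostOneRegularSource ∧
    ∃ φ : ι ≃ G.Vt, (∀ a b, G.vadj (φ a) (φ b) = A a b) ∧ ∀ a, G.D (φ a) = d a

theorem Represents.nonempty_iso {ι : Type*} {A : ι → ι → ℕ∞} {d : ι → ℕ∞} {G H : DirGraph.{u}}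
    (hG : Represents A d G) (hH : Represents A d H) : Nonempty (Iso G H) := by
  obtain ⟨hG1, φ, hφ, hφ'⟩ := hG
  obtain ⟨hH1, ψ, hψ, hψ'⟩ := hH
  refine SameData.nonempty_iso (φ := φ.symm.trans ψ) ⟨fun a b => ?_, fun a => ?_⟩ hG1 hH1
  · obtain ⟨a, rfl⟩ := φ.surjective a
    obtain ⟨b, rfl⟩ := φ.surjective b
    simp [hφ, hψ]
  · obtain ⟨a, rfl⟩ := φ.surjective a
    simp [hφ', hψ']

/-- A source emitting `d a - 1` edges to `a` is added, but only if some `d a` differs from one,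
since otherwise it would be an isolated vertex. The loops at regular rows prevent the vertices of
`ι` from being regular sources. -/
theorem exists_represents {ι : Type u} [Finite ι] {A : ι → ι → ℕ∞} {d : ι → ℕ∞}
    (hA : LoopAtRegular A) (hd : ∀ a, 1 ≤ d a) (hd' : ∀ a, d a ≠ ⊤) :
    ∃ G : DirGraph.{u}, Represents A d G := by
  obtain ⟨G, e, he⟩ := exists_adj_eq (ι ⊕ {_u : PUnit.{u + 1} // ∃ a, d a ≠ 1})
    (Sum.elim (fun a => Sum.elim (A a) 0) (fun _ => Sum.elim (d · - 1) 0))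
  have hr : ∀ u, G.IsRegularSource (e (Sum.inr u)) := by
    intro u
    simp only [IsRegularSource, isRegular_iff, isSource_iff, ← e.forall_congr_right,
      ← e.exists_congr_right, he]
    refine ⟨⟨?_, ?_⟩, ?_⟩
    · rintro (w | w)
      · exact fun h => hd' w (by simpa using h)
      · exact ENat.zero_ne_top
    · obtain ⟨a, ha⟩ := u.2
      exact ⟨Sum.inl a, fun h0 => ha (le_antisymm (tsub_eq_zero_iff_le.1 h0) (hd a))⟩
    · rintro (w | w) <;> rfl
  have hl : ∀ a, ¬ G.IsRegularSource (e (Sum.inl a)) := by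
    intro a
    simp only [IsRegularSource, isRegular_iff, isSource_iff, ← e.forall_congr_right,
      ← e.exists_congr_right, he]
    rintro ⟨⟨h1, h1'⟩, h2⟩
    refine hA a ⟨fun b => h1 (Sum.inl b), ?_⟩ (h2 (Sum.inl a))
    obtain ⟨w | w, hw⟩ := h1'
    · exact ⟨w, hw⟩
    · exact absurd rfl hw
  have hone : G.AtMostOneRegularSource := by
    intro v w
    obtain ⟨v, rfl⟩ := e.surjective v
    obtain ⟨w, rfl⟩ := e.surjective w
    rcases v with v | v <;> rcases w with w | w <;> intro hv hw
    · exact absurd hv (hl v)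
    · exact absurd hv (hl v)
    · exact absurd hw (hl w)
    · exact congrArg (fun v => e (Sum.inr v)) (Subsingleton.elim v w)
  let φ : ι ≃ G.Vt := Equiv.ofBijective (fun a => ⟨e (Sum.inl a), hl a⟩) ⟨fun a b h => by
      simpa using Subtype.ext_iff.1 h, by
      rintro ⟨v, hv⟩
      obtain ⟨v | v, rfl⟩ := e.surjective v
      · exact ⟨v, rfl⟩
      · exact absurd (hr v) hv⟩
  refine ⟨G, hone, φ, fun a b => he _ _, fun a => ?_⟩
  by_cases hex : ∃ a, d a ≠ 1
  · rw [D_eq_of_isRegularSource hone (hr ⟨⟨⟩, hex⟩)]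
    exact (congrArg (· + 1) (he _ _)).trans (tsub_add_cancel_of_le (hd a))
  · rw [D_eq_one]
    · push Not at hex
      exact (hex a).symm
    · intro v hv
      obtain ⟨v | v, rfl⟩ := e.surjective v
      · exact hl v hv
      · exact hex v.2

/-! ### The numbers of edges after outsplitting -/

section Outsplit

variable {G : DirGraph.{u}} {w : G.V} {n : ℕ} {c : {e // G.s e = w} → Fin n}

/-- The vertices of an outsplit graph. -/
def outV (c : {e // G.s e = w} → Fin n) : {v // v ≠ w} ⊕ Fin n ≃ (G.outsplit w c).V :=
  Equiv.refl _

/-- The vertex of which a vertex of an outsplit graph is a copy. -/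
def outProj (w : G.V) (n : ℕ) : {v // v ≠ w} ⊕ Fin n → G.V := Sum.elim Subtype.val fun _ => w

/-- The number of edges in the `j`th class with range `v`. -/
noncomputable def classAdj (c : {e // G.s e = w} → Fin n) (j : Fin n) (v : G.V) : ℕ∞ :=
  {e : {e // G.s e = w} | c e = j ∧ G.r e.1 = v}.encard

open Classical in
/-- The source of the copies of an edge in an outsplit graph. -/
noncomputable def outSrc (c : {e // G.s e = w} → Fin n) (e : G.E) : {v // v ≠ w} ⊕ Fin n :=
  if h : G.s e = w then Sum.inr (c ⟨e, h⟩) else Sum.inl ⟨G.s e, h⟩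

/-- A copy of an edge is determined by the edge together with the copy of its range, so forgetting
the copy is injective once the range is fixed. -/
theorem adj_outV_aux (x y : {v // v ≠ w} ⊕ Fin n) :
    (G.outsplit w c).adj (outV c x) (outV c y) =
      {e | outSrc c e = x ∧ G.r e = outProj w n y}.encard := by
  classical
  let p : {e // G.r e ≠ w} ⊕ ({e // G.r e = w} × Fin n) → G.E :=
    Sum.elim Subtype.val fun p => p.1.1
  let t : {e // G.r e ≠ w} ⊕ ({e // G.r e = w} × Fin n) → {v // v ≠ w} ⊕ Fin n :=
    Sum.elim (fun e => Sum.inl ⟨G.r e.1, e.2⟩) fun p => Sum.inr p.2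
  have hadj : (G.outsplit w c).adj (outV c x) (outV c y) =
      {z | outSrc c (p z) = x ∧ t z = y}.encard := rfl
  have hpt : ∀ z, G.r (p z) = outProj w n (t z) := by
    rintro (z | z)
    · rfl
    · exact z.1.2
  have hinj : ∀ z z', p z = p z' → t z = t z' → z = z' := by
    rintro (z | ⟨z, i⟩) (z' | ⟨z', i'⟩) h1 h2
    · exact congrArg Sum.inl (Subtype.ext h1)
    · exact absurd h2 (by simp [t])
    · exact absurd h2 (by simp [t])
    · have hz : z = z' := Subtype.ext h1
      have hi : i = i' := Sum.inr_injective h2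
      rw [hz, hi]
  have hsurj : ∀ e y, G.r e = outProj w n y → ∃ z, p z = e ∧ t z = y := by
    rintro e (⟨v, hv⟩ | j) h
    · exact ⟨Sum.inl ⟨e, fun h' => hv (h.symm.trans h')⟩, rfl,
        congrArg Sum.inl (Subtype.ext h)⟩
    · exact ⟨Sum.inr (⟨e, h⟩, j), rfl, rfl⟩
  rw [hadj, ← Set.InjOn.encard_image (f := p)]
  · congr 1
    ext e
    constructor
    · rintro ⟨z, ⟨h1, h2⟩, rfl⟩
      exact ⟨h1, h2 ▸ hpt z⟩
    · rintro ⟨h1, h2⟩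
      obtain ⟨z, rfl, h3⟩ := hsurj e y h2
      exact ⟨z, ⟨h1, h3⟩, rfl⟩
  · exact fun z hz z' hz' h => hinj z z' h (hz.2.trans hz'.2.symm)

theorem adj_outV_inl (u : {v // v ≠ w}) (y : {v // v ≠ w} ⊕ Fin n) :
    (G.outsplit w c).adj (outV c (Sum.inl u)) (outV c y) = G.adj u.1 (outProj w n y) := by
  rw [adj_outV_aux, adj_eq_encard]
  congr 1
  ext e
  refine and_congr_left fun _ => ?_
  by_cases h : G.s e = w
  · simp only [outSrc, h, dite_true, reduceCtorEq, false_iff]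
    exact fun h' => u.2 h'.symm
  · simp [outSrc, h, Subtype.ext_iff]

theorem adj_outV_inr (j : Fin n) (y : {v // v ≠ w} ⊕ Fin n) :
    (G.outsplit w c).adj (outV c (Sum.inr j)) (outV c y) = classAdj c j (outProj w n y) := by
  rw [adj_outV_aux, classAdj, ← Function.Injective.encard_image Subtype.val_injective]
  congr 1
  ext e
  by_cases h : G.s e = w
  · simp [outSrc, h]
  · simp [outSrc, h]

theorem sum_classAdj (c : {e // G.s e = w} → Fin n) (v : G.V) :
    ∑ j, classAdj c j v = G.adj w v := by
  have h : {e : G.E | G.s e = w ∧ G.r e = v} =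
      Subtype.val '' ⋃ j, {e : {e // G.s e = w} | c e = j ∧ G.r e.1 = v} := by
    ext e; simp [and_comm]
  rw [adj_eq_encard, h, Subtype.val_injective.encard_image, Set.encard_iUnion_of_finite,
    finsum_eq_sum_of_fintype]
  · rfl
  · intro i j hij
    exact Set.disjoint_left.2 fun e he he' => hij (he.1.symm.trans he'.1)

theorem classAdj_le (c : {e // G.s e = w} → Fin n) (j : Fin n) (v : G.V) :
    classAdj c j v ≤ G.adj w v := by
  rw [← sum_classAdj c v]
  exact Finset.single_le_sum (f := fun j => classAdj c j v) (fun _ _ => bot_le)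
    (Finset.mem_univ j)

theorem exists_classAdj_ne_zero (hc : Function.Surjective c) (j : Fin n) :
    ∃ v, classAdj c j v ≠ 0 := by
  obtain ⟨e, he⟩ := hc j
  exact ⟨G.r e.1, Set.encard_ne_zero.2 ⟨e, he, rfl⟩⟩

theorem classAdj_eq_top_unique (hc : G.IsOutPartition w c) {i j : Fin n} {v v' : G.V}
    (hi : classAdj c i v = ⊤) (hj : classAdj c j v' = ⊤) : i = j := by
  rw [classAdj, Set.encard_eq_top_iff] at hi hj
  exact hc.2.2 i j (hi.mono fun e he => he.1) (hj.mono fun e he => he.1)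

/-- One edge can be separated from the others by outsplitting. -/
theorem exists_isOutPartition_single {t : G.V} (ht : G.adj w t ≠ 0)
    (ht' : G.adj w t ≠ 1 ∨ ∃ t', t' ≠ t ∧ G.adj w t' ≠ 0) :
    ∃ c : {e // G.s e = w} → Fin 2, G.IsOutPartition w c ∧
      classAdj c 1 t = 1 ∧ (∀ v, v ≠ t → classAdj c 1 v = 0) ∧
      classAdj c 0 t + 1 = G.adj w t ∧ ∀ v, v ≠ t → classAdj c 0 v = G.adj w v := by
  classical
  obtain ⟨e₀, hs, hr⟩ := hasEdge_iff.2 ht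
  -- A second edge emitted by `w` is needed to keep class 0 nonempty.
  have hex : ∃ e₁, G.s e₁ = w ∧ e₁ ≠ e₀ := by
    rcases ht' with h | ⟨t', h, h'⟩
    · have h2 : 1 < G.adj w t := lt_of_le_of_ne (Order.one_le_iff_ne_zero.2 ht) h.symm
      obtain ⟨a, b, ha, hb, hab⟩ := Set.one_lt_encard_iff.1 h2
      by_cases h : a = e₀
      · exact ⟨b, hb.1, fun h' => hab (h.trans h'.symm)⟩
      · exact ⟨a, ha.1, h⟩
    · obtain ⟨e, he, he'⟩ := hasEdge_iff.2 h'
      exact ⟨e, he, fun h0 => h (by rw [← he', h0, hr])⟩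
  obtain ⟨e₁, hs₁, hne⟩ := hex
  let c : {e // G.s e = w} → Fin 2 := fun e => if e.1 = e₀ then 1 else 0
  have h1 : classAdj c 1 t = 1 := by
    rw [classAdj, Set.encard_eq_one]
    refine ⟨⟨e₀, hs⟩, ?_⟩
    ext e
    simp only [c, Set.mem_ofPred_eq, Set.mem_singleton_iff, Subtype.ext_iff]
    constructor
    · rintro ⟨h, -⟩
      by_contra h'
      simp [h'] at h
    · intro h
      simp [h, hr]
  have h1' : ∀ v, v ≠ t → classAdj c 1 v = 0 := by
    intro v hv
    rw [classAdj, Set.encard_eq_zero, Set.eq_empty_iff_forall_notMem]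
    rintro e ⟨h, h'⟩
    by_cases he : e.1 = e₀
    · exact hv (by rw [← h', he, hr])
    · simp [c, he] at h
  refine ⟨c, ⟨⟨e₀, hs⟩, ?_, ?_⟩, h1, h1', ?_, ?_⟩
  · intro j
    fin_cases j
    · exact ⟨⟨e₁, hs₁⟩, by simp [c, hne]⟩
    · exact ⟨⟨e₀, hs⟩, by simp [c]⟩
  · have hfin : ¬ (c ⁻¹' {1}).Infinite := by
      rw [Set.not_infinite]
      refine (Set.finite_singleton (⟨e₀, hs⟩ : {e // G.s e = w})).subset fun e he => ?_
      by_contra h'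
      have : e.1 ≠ e₀ := fun h => h' (Subtype.ext h)
      simp [c, this] at he
    intro i j hi hj
    fin_cases i <;> fin_cases j
    · rfl
    · exact absurd hj hfin
    · exact absurd hi hfin
    · rfl
  · rw [← sum_classAdj c t, Fin.sum_univ_two, h1]
  · intro v hv
    rw [← sum_classAdj c v, Fin.sum_univ_two, h1' v hv, add_zero]

end Outsplit

/-! ### The numbers of edges after unital reduction -/

section Reduce

variable {G : DirGraph.{u}} {w : G.V} {hw : ¬ G.HasEdge w w}

/-- The vertices of a reduced graph. -/
def redV (hw : ¬ G.HasEdge w w) : {v // v ≠ w} ⊕ Unit ≃ (G.reduce w hw).V := Equiv.refl _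

theorem encard_emitted_subtype (v : G.V) :
    {f : {f // G.s f = w} | G.r f.1 = v}.encard = G.adj w v := by
  rw [← Subtype.val_injective.encard_image, adj_eq_encard]
  congr 1
  ext e
  simp [and_comm]

theorem encard_received_subtype (v : G.V) :
    {f : {f // G.r f = w} | G.s f.1 = v}.encard = G.adj v w := by
  rw [← Subtype.val_injective.encard_image, adj_eq_encard]
  congr 1
  ext e
  simp [and_comm]

/-- The edges of a reduced graph. -/
def redE (hw : ¬ G.HasEdge w w) : {e // G.s e ≠ w ∧ G.r e ≠ w} ⊕
    ({e // G.r e = w} × {f // G.s f = w}) ⊕ {f // G.s f = w} ≃ (G.reduce w hw).E := Equiv.refl _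

theorem adj_redV (x y : {v // v ≠ w} ⊕ Unit) : (G.reduce w hw).adj (redV hw x) (redV hw y) =
    {e | (G.reduce w hw).s (redE hw e) = redV hw x ∧
      (G.reduce w hw).r (redE hw e) = redV hw y}.encard := rfl

theorem adj_redV_inl (u v : {v // v ≠ w}) :
    (G.reduce w hw).adj (redV hw (Sum.inl u)) (redV hw (Sum.inl v)) =
      G.adj u.1 v.1 + G.adj u.1 w * G.adj w v.1 := by
  have h : {e | (G.reduce w hw).s (redE hw e) = redV hw (Sum.inl u) ∧
      (G.reduce w hw).r (redE hw e) = redV hw (Sum.inl v)} =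
      Sum.inl '' {e : {e // G.s e ≠ w ∧ G.r e ≠ w} | G.s e.1 = u.1 ∧ G.r e.1 = v.1} ∪
      (Sum.inr ∘ Sum.inl) '' ({f : {f // G.r f = w} | G.s f.1 = u.1} ×ˢ
        {f : {f // G.s f = w} | G.r f.1 = v.1}) := by
    ext (e | p | f)
    · simp only [Set.mem_ofPred_eq, Set.mem_union, Set.mem_image, Function.comp_apply, Sum.inl.injEq, exists_eq_right,
        reduceCtorEq, and_false, exists_false, or_false]
      refine and_congr ?_ ?_
      · exact Sum.inl_injective.eq_iff.trans Subtype.ext_iff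
      · exact Sum.inl_injective.eq_iff.trans Subtype.ext_iff
    · simp only [Set.mem_ofPred_eq, Set.mem_union, Set.mem_image, Function.comp_apply, reduceCtorEq, and_false,
        exists_false, false_or, Sum.inr.injEq, Sum.inl.injEq, exists_eq_right, Set.mem_prod]
      refine and_congr ?_ ?_
      · exact Sum.inl_injective.eq_iff.trans Subtype.ext_iff
      · exact Sum.inl_injective.eq_iff.trans Subtype.ext_iff
    · simp only [Set.mem_ofPred_eq, Set.mem_union, Set.mem_image, Function.comp_apply, reduceCtorEq, and_false,
        exists_false, or_false, Sum.inr.injEq, iff_false]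
      exact fun h => Sum.inr_ne_inl h.1
  rw [adj_redV, h, Set.encard_union_eq]
  · rw [Sum.inl_injective.encard_image,
      (Sum.inr_injective.comp Sum.inl_injective).encard_image, Set.encard_prod,
      encard_received_subtype, encard_emitted_subtype, ← Subtype.val_injective.encard_image]
    congr 1
    rw [adj_eq_encard]
    congr 1
    ext e
    constructor
    · rintro ⟨e, h, rfl⟩
      exact h
    · exact fun h => ⟨⟨e, fun h' => u.2 (h.1.symm.trans h'), fun h' => v.2 (h.2.symm.trans h')⟩,
        h, rfl⟩
  · rw [Set.disjoint_left]
    rintro _ ⟨a, _, rfl⟩ ⟨b, _, hb⟩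
    exact absurd hb (by simp)

theorem adj_redV_inr_inl (t : Unit) (v : {v // v ≠ w}) :
    (G.reduce w hw).adj (redV hw (Sum.inr t)) (redV hw (Sum.inl v)) = G.adj w v.1 := by
  have h : {e | (G.reduce w hw).s (redE hw e) = redV hw (Sum.inr t) ∧
      (G.reduce w hw).r (redE hw e) = redV hw (Sum.inl v)} =
      (Sum.inr ∘ Sum.inr) '' {f : {f // G.s f = w} | G.r f.1 = v.1} := by
    ext (e | p | f)
    · simp only [Set.mem_ofPred_eq, Set.mem_image, Function.comp_apply, reduceCtorEq, and_false, exists_false,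
        iff_false]
      exact fun h => Sum.inl_ne_inr h.1
    · simp only [Set.mem_ofPred_eq, Set.mem_image, Function.comp_apply, Sum.inr.injEq, reduceCtorEq, and_false,
        exists_false, iff_false]
      exact fun h => Sum.inl_ne_inr h.1
    · simp only [Set.mem_ofPred_eq, Set.mem_image, Function.comp_apply, Sum.inr.injEq, exists_eq_right]
      refine (and_iff_right ?_).trans ?_
      · rfl
      · exact Sum.inl_injective.eq_iff.trans Subtype.ext_iff
  rw [adj_redV, h, (Sum.inr_injective.comp Sum.inr_injective).encard_image,
    encard_emitted_subtype]

theorem adj_redV_inr (x : {v // v ≠ w} ⊕ Unit) (t : Unit) :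
    (G.reduce w hw).adj (redV hw x) (redV hw (Sum.inr t)) = 0 := by
  rw [adj_redV, Set.encard_eq_zero, Set.eq_empty_iff_forall_notMem]
  rintro (e | p | f) ⟨-, h⟩
  · exact Sum.inl_ne_inr h
  · exact Sum.inl_ne_inr h
  · exact Sum.inl_ne_inr h

end Reduce

/-! ### Vertices of outsplit graphs -/

section Outsplit

variable {G : DirGraph.{u}} {w : G.V} {n : ℕ} {c : {e // G.s e = w} → Fin n}

theorem IsOutPartition.pos (hc : G.IsOutPartition w c) : 0 < n := by
  obtain ⟨e, he⟩ := hc.1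
  exact (c ⟨e, he⟩).pos

theorem IsOutPartition.outProj_surjective (hc : G.IsOutPartition w c) :
    Function.Surjective (outProj w n) := by
  intro v
  by_cases h : v = w
  · exact ⟨Sum.inr ⟨0, hc.pos⟩, h.symm⟩
  · exact ⟨Sum.inl ⟨v, h⟩, rfl⟩

theorem isRegular_outV_inl (hc : G.IsOutPartition w c) (u : {v // v ≠ w}) :
    (G.outsplit w c).IsRegular (outV c (Sum.inl u)) ↔ G.IsRegular u.1 := by
  simp only [isRegular_iff, ← (outV c).forall_congr_right, ← (outV c).exists_congr_right,
    adj_outV_inl, ← hc.outProj_surjective.forall (p := fun v => G.adj u.1 v ≠ ⊤),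
    ← hc.outProj_surjective.exists (p := fun v => G.adj u.1 v ≠ 0)]

theorem isRegular_outV_inr_iff (hc : G.IsOutPartition w c) (j : Fin n) :
    (G.outsplit w c).IsRegular (outV c (Sum.inr j)) ↔ ∀ v, classAdj c j v ≠ ⊤ := by
  simp only [isRegular_iff, ← (outV c).forall_congr_right, ← (outV c).exists_congr_right,
    adj_outV_inr, ← hc.outProj_surjective.forall (p := fun v => classAdj c j v ≠ ⊤),
    ← hc.outProj_surjective.exists (p := fun v => classAdj c j v ≠ 0)]
  exact and_iff_left (exists_classAdj_ne_zero hc.2.1 j)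

theorem isRegular_outV_inr (hc : G.IsOutPartition w c) (hw : G.IsRegular w) (j : Fin n) :
    (G.outsplit w c).IsRegular (outV c (Sum.inr j)) :=
  (isRegular_outV_inr_iff hc j).2 fun v h =>
    (isRegular_iff.1 hw).1 v (top_le_iff.1 (h ▸ classAdj_le c j v))

/-- Every copy of `w` receives a copy of each edge into `w`, so splitting neither creates nor
destroys sources. -/
theorem isSource_outV (y : {v // v ≠ w} ⊕ Fin n) :
    (G.outsplit w c).IsSource (outV c y) ↔ G.IsSource (outProj w n y) := by
  simp only [isSource_iff, ← (outV c).forall_congr_right]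
  constructor
  · intro h v
    by_cases hv : v = w
    · rw [hv, ← sum_classAdj c]
      refine Finset.sum_eq_zero fun j _ => ?_
      rw [← adj_outV_inr]
      exact h _
    · exact (adj_outV_inl ⟨v, hv⟩ y).symm.trans (h _)
  · rintro h (u | j)
    · rw [adj_outV_inl]
      exact h _
    · rw [adj_outV_inr]
      exact le_antisymm ((classAdj_le c j _).trans (h w).le) bot_le

theorem moveO_outsplit (hc : G.IsOutPartition w c) : MoveO G (G.outsplit w c) :=
  ⟨w, n, c, hc, ⟨Iso.refl _⟩⟩

end Outsplit

/-! ### Termination by a decreasing measure -/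

theorem exists_reflTransGen_of_decreasing {α : Type*} {r : α → α → Prop} (μ : α → ℕ)
    {I T : α → Prop} (h : ∀ a, I a → ¬ T a → ∃ b, r a b ∧ I b ∧ μ b < μ a) (a : α) (ha : I a) :
    ∃ b, ReflTransGen r a b ∧ I b ∧ T b := by
  induction hn : μ a using Nat.strong_induction_on generalizing a with
  | _ n ih =>
    by_cases hT : T a
    · exact ⟨a, .refl, ha, hT⟩
    · obtain ⟨b, hab, hb, hlt⟩ := h a ha hT
      obtain ⟨d, hbd, hd⟩ := ih (μ b) (hn ▸ hlt) b hb rfl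
      exact ⟨d, .head hab hbd, hd⟩

theorem ncard_lt_of_injOn {α β : Type*} [Finite α] [Finite β] {s : Set α} {t : Set β} {b : β}
    (f : α → β) (hf : ∀ a ∈ s, f a ∈ t ∧ f a ≠ b) (hinj : Set.InjOn f s) (hb : b ∈ t) :
    s.ncard < t.ncard := by
  refine lt_of_le_of_lt (Set.ncard_le_ncard_of_injOn f (t := t \ {b}) (fun a ha => hf a ha) hinj)
    (Set.ncard_sdiff_singleton_lt_of_mem hb)

/-! ### Infinite emitters emitting infinitely many or no edges to any vertex -/

theorem prop1_iff_adj {G : DirGraph.{u}} : G.Prop1 ↔ TopOrZero G.adj := by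
  simp only [Prop1, isInfiniteEmitter_iff]
  exact ⟨fun h a b c hab => h a ⟨b, hab⟩ c, fun h a ⟨b, hab⟩ c => h a b c hab⟩

theorem classAdj_eq_of_forall {G : DirGraph.{u}} {w : G.V} {n : ℕ}
    {c : {e // G.s e = w} → Fin n} {j : Fin n} {v : G.V}
    (h : ∀ e : {e // G.s e = w}, G.r e.1 = v → c e = j) : classAdj c j v = G.adj w v := by
  rw [← sum_classAdj c v, eq_comm]
  refine Finset.sum_eq_single j (fun i _ hij => ?_) (by simp)
  rw [classAdj, Set.encard_eq_zero, Set.eq_empty_iff_forall_notMem]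
  exact fun e he => hij (he.1.symm.trans (h e he.2))

theorem classAdj_eq_zero_of_forall {G : DirGraph.{u}} {w : G.V} {n : ℕ}
    {c : {e // G.s e = w} → Fin n} {j : Fin n} {v : G.V}
    (h : ∀ e : {e // G.s e = w}, G.r e.1 = v → c e ≠ j) : classAdj c j v = 0 := by
  rw [classAdj, Set.encard_eq_zero, Set.eq_empty_iff_forall_notMem]
  exact fun e he => h e he.2 he.1

/-- The vertices that emit infinitely many edges to some vertex, and finitely many, but at least
one, to another. -/
def mixedEmitters (G : DirGraph.{u}) : Set G.V :=
  {v | ∃ a b, G.adj v a = ⊤ ∧ G.adj v b ≠ 0 ∧ G.adj v b ≠ ⊤}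

/-- The edges of a mixed emitter are divided according to whether they have infinitely many parallel
ones. One copy then emits infinitely many or no edges to each vertex, the other is regular, and the
other vertices are as mixed as before. -/
theorem exists_outsplit_mixedEmitters_lt {G : DirGraph.{u}} (hG : ¬ G.Prop1) :
    ∃ H, MoveO G H ∧ H.mixedEmitters.ncard < G.mixedEmitters.ncard := by
  classical
  rw [prop1_iff_adj, TopOrZero] at hG
  push Not at hG
  obtain ⟨w, a, b, ha, hb, hb'⟩ := hG
  let c : {e // G.s e = w} → Fin 2 := fun e => if G.adj w (G.r e.1) = ⊤ then 0 else 1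
  have hc0 : ∀ v, G.adj w v = ⊤ → classAdj c 0 v = ⊤ ∧ classAdj c 1 v = 0 := fun v hv =>
    ⟨(classAdj_eq_of_forall fun e he => by simp [c, he, hv]).trans hv,
      classAdj_eq_zero_of_forall fun e he => by simp [c, he, hv]⟩
  have hc1 : ∀ v, G.adj w v ≠ ⊤ → classAdj c 0 v = 0 ∧ classAdj c 1 v ≠ ⊤ := fun v hv =>
    ⟨classAdj_eq_zero_of_forall fun e he => by simp [c, he, hv],
      fun h => hv (top_le_iff.1 (h ▸ classAdj_le c 1 v))⟩
  have hc1' : ∀ v, classAdj c 1 v ≠ ⊤ := fun v => by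
    by_cases hv : G.adj w v = ⊤
    · simp [(hc0 v hv).2]
    · exact (hc1 v hv).2
  obtain ⟨ea, hsa, hra⟩ := hasEdge_iff.2 (show G.adj w a ≠ 0 by simp [ha])
  obtain ⟨eb, hsb, hrb⟩ := hasEdge_iff.2 hb
  -- Class 1 is a union over the finitely many ranges of finite sets of edges.
  have hfin : ¬ (c ⁻¹' {1}).Infinite := by
    have : c ⁻¹' {1} = ⋃ v, {e : {e // G.s e = w} | c e = 1 ∧ G.r e.1 = v} := by ext; simp
    rw [this, Set.not_infinite]
    exact Set.finite_iUnion fun v => Set.encard_ne_top_iff.1 (hc1' v)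
  have hc : G.IsOutPartition w c := by
    refine ⟨⟨ea, hsa⟩, fun j => ?_, fun i j hi hj => ?_⟩
    · fin_cases j
      · exact ⟨⟨ea, hsa⟩, by simp [c, hra, ha]⟩
      · exact ⟨⟨eb, hsb⟩, by simp [c, hrb, hb']⟩
    · fin_cases i <;> fin_cases j
      · rfl
      · exact absurd hj hfin
      · exact absurd hi hfin
      · rfl
  have hmem : ∀ y, outV c y ∈ (G.outsplit w c).mixedEmitters →
      ∃ u, y = Sum.inl u ∧ u.1 ∈ G.mixedEmitters := by
    rintro y ⟨v, v', hv, hv', hv''⟩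
    obtain ⟨v, rfl⟩ := (outV c).surjective v
    obtain ⟨v', rfl⟩ := (outV c).surjective v'
    rcases y with y | j
    · rw [adj_outV_inl] at hv hv' hv''
      exact ⟨y, rfl, _, _, hv, hv', hv''⟩
    · rw [adj_outV_inr] at hv hv' hv''
      fin_cases j
      · by_cases h : G.adj w (outProj w 2 v') = ⊤
        · exact absurd (hc0 _ h).1 hv''
        · exact absurd (hc1 _ h).1 hv'
      · exact absurd hv (hc1' _)
  refine ⟨_, moveO_outsplit hc, ncard_lt_of_injOn (b := w)
    (fun x => outProj w 2 ((outV c).symm x)) (fun x hx => ?_) (fun x hx x' hx' h => ?_)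
    ⟨a, b, ha, hb, hb'⟩⟩
  · obtain ⟨y, rfl⟩ := (outV c).surjective x
    obtain ⟨u, rfl, hu⟩ := hmem y hx
    simpa [outProj] using ⟨hu, u.2⟩
  · obtain ⟨y, rfl⟩ := (outV c).surjective x
    obtain ⟨u, rfl, hu⟩ := hmem y hx
    obtain ⟨y', rfl⟩ := (outV c).surjective x'
    obtain ⟨u', rfl, hu'⟩ := hmem y' hx'
    have : u = u' := Subtype.ext (by simpa [outProj] using h)
    rw [this]

theorem exists_moveO_prop1 (G : DirGraph.{u}) : ∃ H, ReflTransGen MoveO G H ∧ H.Prop1 := by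
  obtain ⟨H, h, -, h'⟩ := exists_reflTransGen_of_decreasing (r := MoveO)
    (fun G => G.mixedEmitters.ncard) (I := fun _ => True) (T := Prop1)
    (fun G _ hG => by
      obtain ⟨H, h, h'⟩ := exists_outsplit_mixedEmitters_lt hG
      exact ⟨H, h, trivial, h'⟩) G trivial
  exact ⟨H, h, h'⟩

/-! ### Unital reduction -/

theorem moveRPlus_reduce {G : DirGraph.{u}} {w : G.V} (hw : ¬ G.HasEdge w w)
    (hr : G.IsRegular w) : MoveRPlus G (G.reduce w hw) := ⟨w, hw, hr, ⟨Iso.refl _⟩⟩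

/-- The removed vertex `w` emits finitely many edges, so an infinite entry of the new matrix can
only occur in the row of an old infinite emitter. The old entries of that row are zero or infinite,
and this is inherited by `adj x z + adj x w * adj w z`. -/
theorem MoveRPlus.prop1 {G H : DirGraph.{u}} (h : MoveRPlus G H) (hG : G.Prop1) : H.Prop1 := by
  obtain ⟨w, hw, hr, ⟨f⟩⟩ := h
  refine f.sameData.prop1 ?_
  rw [prop1_iff_adj] at *
  rw [isRegular_iff] at hr
  intro x y z hxy
  obtain ⟨x, rfl⟩ := (redV hw).surjective x
  obtain ⟨y, rfl⟩ := (redV hw).surjective y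
  obtain ⟨z, rfl⟩ := (redV hw).surjective z
  rcases z with z | z
  swap
  · exact .inl (adj_redV_inr _ _)
  rcases y with y | y
  swap
  · rw [adj_redV_inr] at hxy
    exact absurd hxy ENat.zero_ne_top
  rcases x with x | x
  · rw [adj_redV_inl] at hxy ⊢
    have hinf : ∃ v, G.adj x.1 v = ⊤ := by
      rcases ENat.add_eq_top.1 hxy with h | h
      · exact ⟨_, h⟩
      · by_contra hv
        push Not at hv
        exact WithTop.mul_ne_top (hv w) (hr.1 y.1) h
    obtain ⟨v, hv⟩ := hinf
    rcases hG x.1 v z.1 hv with h1 | h1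
    · rcases hG x.1 v w hv with h2 | h2
      · exact .inl (by simp [h1, h2])
      · rw [h1, h2, zero_add]
        by_cases h3 : G.adj w z.1 = 0
        · exact .inl (by simp [h3])
        · exact .inr (ENat.top_mul h3)
    · exact .inr (by simp [h1])
  · rw [adj_redV_inr_inl] at hxy
    exact absurd hxy (hr.1 _)

/-- The regular vertices that are not sources and do not support a loop. -/
def looplessRegular (G : DirGraph.{u}) : Set G.V :=
  {v | G.IsRegular v ∧ ¬ G.HasEdge v v ∧ ¬ G.IsSource v}

/-- The vertex that replaces `w` is a source, and an offending vertex of the reduced graph already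
offended before, so only `w` disappears from the set. -/
theorem exists_reduce_looplessRegular_lt {G : DirGraph.{u}} (hG : ¬ G.Prop2) :
    ∃ H, MoveRPlus G H ∧ H.looplessRegular.ncard < G.looplessRegular.ncard := by
  rw [Prop2] at hG
  push Not at hG
  obtain ⟨w, hr, hw, hs⟩ := hG
  have hmem : ∀ y, redV hw y ∈ (G.reduce w hw).looplessRegular →
      ∃ u, y = Sum.inl u ∧ u.1 ∈ G.looplessRegular := by
    rintro (u | t) ⟨h1, h2, h3⟩
    · refine ⟨u, rfl, ?_, ?_, ?_⟩
      · rw [isRegular_iff] at h1 hr ⊢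
        -- If infinitely many edges led to `w`, they would reappear as edges to any vertex `t` that
        -- receives an edge from `w`; here `t` differs from `w` because `w` has no loop.
        obtain ⟨t, ht⟩ := hr.2
        have htw : t ≠ w := fun h => hw (hasEdge_iff.2 (h ▸ ht))
        refine ⟨fun v hv => ?_, ?_⟩
        · by_cases hvw : v = w
          · refine h1.1 (redV hw (Sum.inl ⟨t, htw⟩)) ?_
            rw [hvw] at hv
            rw [adj_redV_inl, hv, ENat.top_mul ht, add_top]
          · refine h1.1 (redV hw (Sum.inl ⟨v, hvw⟩)) ?_
            rw [adj_redV_inl, hv, top_add]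
        · obtain ⟨v, hv⟩ := h1.2
          obtain ⟨v | v, rfl⟩ := (redV hw).surjective v
          · rw [adj_redV_inl] at hv
            by_contra hne
            push Not at hne
            exact hv (by simp [hne])
          · exact absurd (adj_redV_inr _ _) hv
      · rw [hasEdge_iff, not_not] at h2 ⊢
        rw [adj_redV_inl] at h2
        exact (add_eq_zero.1 h2).1
      · intro hu
        refine h3 ?_
        rw [isSource_iff] at hu ⊢
        intro x
        obtain ⟨x | x, rfl⟩ := (redV hw).surjective x
        · rw [adj_redV_inl]
          simp [hu]
        · rw [adj_redV_inr_inl]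
          exact hu w
    · refine absurd (isSource_iff.2 fun x => ?_) h3
      obtain ⟨x, rfl⟩ := (redV hw).surjective x
      exact adj_redV_inr _ _
  refine ⟨_, moveRPlus_reduce hw hr, ncard_lt_of_injOn (b := w)
    (fun x => Sum.elim Subtype.val (fun _ => w) ((redV hw).symm x)) (fun x hx => ?_)
    (fun x hx x' hx' h => ?_) ⟨hr, hw, hs⟩⟩
  · obtain ⟨y, rfl⟩ := (redV hw).surjective x
    obtain ⟨u, rfl, hu⟩ := hmem y hx
    simpa using ⟨hu, u.2⟩
  · obtain ⟨y, rfl⟩ := (redV hw).surjective x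
    obtain ⟨u, rfl, hu⟩ := hmem y hx
    obtain ⟨y', rfl⟩ := (redV hw).surjective x'
    obtain ⟨u', rfl, hu'⟩ := hmem y' hx'
    have : u = u' := Subtype.ext (by simpa using h)
    rw [this]

theorem exists_moveRPlus_prop2 (G : DirGraph.{u}) :
    ∃ H, ReflTransGen MoveRPlus G H ∧ H.Prop2 := by
  obtain ⟨H, h, -, h'⟩ := exists_reflTransGen_of_decreasing (r := MoveRPlus)
    (fun G => G.looplessRegular.ncard) (I := fun _ => True) (T := Prop2)
    (fun G _ hG => by
      obtain ⟨H, h, h'⟩ := exists_reduce_looplessRegular_lt hG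
      exact ⟨H, h, trivial, h'⟩) G trivial
  exact ⟨H, h, h'⟩

/-! ### Collecting regular sources -/

open Classical in
theorem D_eq_sum (G : DirGraph.{u}) [Fintype G.V] (i : G.Vt) :
    G.D i = ∑ v, (if G.IsRegularSource v then G.adj v i.1 else 0) + 1 := by
  rw [D_eq, finsum_eq_sum_of_fintype, Finset.sum_ite, Finset.sum_const_zero, add_zero]
  congr 1
  exact (Finset.sum_subtype _ (by simp) fun v => G.adj v i.1).symm

/-- Copies of a regular source are regular sources, and the numbers of edges they emit to a vertex
add up to the original number. Collecting sources is therefore invisible in `vadj` and `D`. -/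
theorem exists_sameData_outsplit {G : DirGraph.{u}} {w : G.V} {n : ℕ}
    {c : {e // G.s e = w} → Fin n} (hw : G.IsRegularSource w) (hc : G.IsOutPartition w c) :
    ∃ φ : G.Vt ≃ (G.outsplit w c).Vt, SameData φ := by
  classical
  have hl : ∀ u, (G.outsplit w c).IsRegularSource (outV c (Sum.inl u)) ↔
      G.IsRegularSource u.1 := fun u => and_congr (isRegular_outV_inl hc u) (isSource_outV _)
  have hr : ∀ j, (G.outsplit w c).IsRegularSource (outV c (Sum.inr j)) := fun j =>
    ⟨isRegular_outV_inr hc hw.1 j, (isSource_outV _).2 hw.2⟩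
  have hne : ∀ a : G.Vt, a.1 ≠ w := fun a h => a.2 (h ▸ hw)
  let φ : G.Vt ≃ (G.outsplit w c).Vt := Equiv.ofBijective
    (fun a => ⟨outV c (Sum.inl ⟨a.1, hne a⟩), fun h => a.2 ((hl _).1 h)⟩) ⟨fun a b h => by
      simpa [Subtype.ext_iff] using h, by
      rintro ⟨v, hv⟩
      obtain ⟨v | j, rfl⟩ := (outV c).surjective v
      · exact ⟨⟨v.1, fun h => hv ((hl v).2 h)⟩, rfl⟩
      · exact absurd (hr j) hv⟩
  refine ⟨φ, fun a b => adj_outV_inl _ _, fun a => ?_⟩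
  have := Fintype.ofFinite G.V
  have := Fintype.ofFinite (G.outsplit w c).V
  rw [D_eq_sum, D_eq_sum, ← (outV c).sum_comp, Fintype.sum_sum_type,
    Fintype.sum_eq_add_sum_subtype_ne _ w, add_comm (ite _ _ _)]
  congr 2
  · refine Finset.sum_congr rfl fun u _ => ?_
    rw [if_congr (hl u) rfl rfl]
    congr 1
    exact adj_outV_inl u (Sum.inl ⟨a.1, hne a⟩)
  · rw [if_pos hw, ← sum_classAdj c]
    refine Finset.sum_congr rfl fun j _ => ?_
    rw [if_pos (hr j)]
    exact adj_outV_inr j (Sum.inl ⟨a.1, hne a⟩)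

theorem CollectSources.exists_sameData {G H : DirGraph.{u}} (h : CollectSources G H) :
    ∃ φ : G.Vt ≃ H.Vt, SameData φ := by
  obtain ⟨w, n, c, hw, hc, ⟨f⟩⟩ := h
  obtain ⟨φ, hφ⟩ := exists_sameData_outsplit hw hc
  exact ⟨_, (hφ.trans f.sameData).symm⟩

theorem CollectSources.moveO {G H : DirGraph.{u}} (h : CollectSources G H) : MoveO H G := by
  obtain ⟨w, n, c, hw, hc, hf⟩ := h
  exact ⟨w, n, c, hc, hf⟩

/-- Two regular sources can be merged. -/
theorem exists_merge {G : DirGraph.{u}} {s t : G.V} (hst : s ≠ t) (hs : G.IsRegularSource s)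
    (ht : G.IsRegularSource t) :
    ∃ (F : DirGraph.{u}) (η : {v // v ≠ t} ≃ F.V)
      (c : {e // F.s e = η ⟨s, hst⟩} → Fin 2), Function.Surjective c ∧
      (∀ u v : {v // v ≠ t}, u.1 ≠ s → F.adj (η u) (η v) = G.adj u.1 v.1) ∧
      (∀ v, classAdj c 0 (η v) = G.adj s v.1) ∧ ∀ v, classAdj c 1 (η v) = G.adj t v.1 := by
  classical
  let F : DirGraph.{u} :=
    { V := {v // v ≠ t}
      E := G.E
      s := fun e => if h : G.s e = t then ⟨s, hst⟩ else ⟨G.s e, h⟩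
      r := fun e => ⟨G.r e, fun h => ht.2 e h⟩
      finiteV := inferInstance
      countableE := inferInstance }
  let η : {v // v ≠ t} ≃ F.V := Equiv.refl _
  let ε : G.E ≃ F.E := Equiv.refl _
  have hFs : ∀ e u, F.s (ε e) = η u ↔ if G.s e = t then u.1 = s else G.s e = u.1 := by
    intro e u
    change (if h : G.s e = t then (⟨s, hst⟩ : {v // v ≠ t}) else ⟨G.s e, h⟩) = u ↔ _
    split_ifs
    · rw [Subtype.ext_iff, eq_comm]
    · rw [Subtype.ext_iff]
  have hFr : ∀ e u, F.r (ε e) = η u ↔ G.r e = u.1 := by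
    intro e u
    change (⟨G.r e, _⟩ : {v // v ≠ t}) = u ↔ _
    rw [Subtype.ext_iff]
  let c : {e // F.s e = η ⟨s, hst⟩} → Fin 2 := fun e => if G.s (ε.symm e.1) = t then 1 else 0
  have hFs' : ∀ e, F.s (ε e) = η ⟨s, hst⟩ ↔ G.s e = t ∨ G.s e = s := by
    intro e
    rw [hFs]
    split_ifs with h <;> simp [h]
  have key : ∀ (j : Fin 2) (x : G.V) (v : {v // v ≠ t}),
      (∀ e, (∃ h : F.s (ε e) = η ⟨s, hst⟩, c ⟨ε e, h⟩ = j) ↔ G.s e = x) →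
      classAdj c j (η v) = G.adj x v.1 := by
    intro j x v h
    rw [classAdj, adj_eq_encard, ← Subtype.val_injective.encard_image,
      ← ε.injective.encard_image]
    congr 1
    ext e
    obtain ⟨e, rfl⟩ := ε.surjective e
    simp only [Set.mem_image, Set.mem_ofPred_eq, EmbeddingLike.apply_eq_iff_eq, exists_eq_right,
      Subtype.exists, ← h]
    constructor
    · rintro ⟨e', h', ⟨hc, hr⟩, rfl⟩
      exact ⟨⟨h', hc⟩, (hFr _ _).1 hr⟩
    · rintro ⟨⟨h', hc⟩, hr⟩
      exact ⟨_, h', ⟨hc, (hFr _ _).2 hr⟩, rfl⟩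
  have hcs : ∀ e, (∃ h : F.s (ε e) = η ⟨s, hst⟩, c ⟨ε e, h⟩ = 0) ↔ G.s e = s := by
    intro e
    by_cases h : G.s e = t
    · simp [c, h, hst.symm]
    · simp [c, h, hFs']
  have hct : ∀ e, (∃ h : F.s (ε e) = η ⟨s, hst⟩, c ⟨ε e, h⟩ = 1) ↔ G.s e = t := by
    intro e
    by_cases h : G.s e = t
    · simp [c, h, hFs']
    · simp [c, h]
  refine ⟨F, η, c, fun j => ?_, fun u v hu => ?_, fun v => key 0 s v hcs, fun v => key 1 t v hct⟩
  · fin_cases j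
    · obtain ⟨e, he⟩ := hs.1.2
      obtain ⟨h, h'⟩ := (hcs e).2 he
      exact ⟨_, h'⟩
    · obtain ⟨e, he⟩ := ht.1.2
      obtain ⟨h, h'⟩ := (hct e).2 he
      exact ⟨_, h'⟩
  · rw [adj_eq_encard, adj_eq_encard,
      ← ε.injective.encard_image {e | G.s e = u.1 ∧ G.r e = v.1}]
    congr 1
    ext e
    obtain ⟨e, rfl⟩ := ε.surjective e
    simp only [Set.mem_image, Set.mem_ofPred_eq, EmbeddingLike.apply_eq_iff_eq, exists_eq_right,
      hFs, hFr]
    refine and_congr_left fun _ => ?_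
    split_ifs with h
    · rw [h]
      exact iff_of_false hu u.2.symm
    · rfl

theorem exists_collectSources_card_lt {G : DirGraph.{u}} (hG : ¬ G.AtMostOneRegularSource) :
    ∃ F, CollectSources G F ∧ Nat.card F.V < Nat.card G.V := by
  classical
  rw [AtMostOneRegularSource] at hG
  push Not at hG
  obtain ⟨s, t, hs, ht, hst⟩ := hG
  obtain ⟨F, η, c, hc, hadj, hc0, hc1⟩ := exists_merge hst hs ht
  have hadj' : ∀ v, F.adj (η ⟨s, hst⟩) (η v) = G.adj s v.1 + G.adj t v.1 := fun v => by
    rw [← sum_classAdj c, Fin.sum_univ_two, hc0, hc1]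
  have hreg : F.IsRegular (η ⟨s, hst⟩) := by
    have hs1 := isRegular_iff.1 hs.1
    have ht1 := isRegular_iff.1 ht.1
    simp only [isRegular_iff, ← η.forall_congr_right, ← η.exists_congr_right, hadj']
    refine ⟨fun v => ?_, ?_⟩
    · rw [Ne, ENat.add_eq_top, not_or]
      exact ⟨hs1.1 _, ht1.1 _⟩
    · obtain ⟨v, hv⟩ := hs1.2
      have hvt : v ≠ t := fun h =>
        not_isRegularSource_of_hasEdge (hasEdge_iff.2 hv) (h.symm ▸ ht)
      exact ⟨⟨v, hvt⟩, fun h => hv (add_eq_zero.1 h).1⟩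
  have hsrc : F.IsSource (η ⟨s, hst⟩) := by
    simp only [isSource_iff, ← η.forall_congr_right]
    intro u
    by_cases hu : u.1 = s
    · have : u = ⟨s, hst⟩ := Subtype.ext hu
      rw [this, hadj', adj_eq_zero_of_isRegularSource _ hs, adj_eq_zero_of_isRegularSource _ hs,
        add_zero]
    · rw [hadj u _ hu]
      exact adj_eq_zero_of_isRegularSource _ hs
  have hpart : F.IsOutPartition (η ⟨s, hst⟩) c := by
    refine ⟨hreg.2, hc, fun i j hi => ?_⟩
    have : Finite {e // F.s e = η ⟨s, hst⟩} := hreg.1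
    exact absurd (Set.toFinite _) hi
  let ψ : {v // v ≠ η ⟨s, hst⟩} ⊕ Fin 2 → G.V := Sum.elim (fun v => (η.symm v.1).1) ![s, t]
  have hψ : Function.Bijective ψ := by
    constructor
    · have h1 : ∀ v : {v // v ≠ η ⟨s, hst⟩}, (η.symm v.1).1 ≠ s := fun v h =>
        v.2 (η.symm_apply_eq.1 (Subtype.ext h))
      have h2 : ∀ v : {v // v ≠ η ⟨s, hst⟩}, (η.symm v.1).1 ≠ t := fun v => (η.symm v.1).2
      rintro (a | a) (b | b) h
      · refine congrArg Sum.inl (Subtype.ext (η.symm.injective (Subtype.ext h)))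
      · fin_cases b
        · exact absurd h (h1 a)
        · exact absurd h (h2 a)
      · fin_cases a
        · exact absurd h.symm (h1 b)
        · exact absurd h.symm (h2 b)
      · fin_cases a <;> fin_cases b
        · rfl
        · exact absurd h hst
        · exact absurd h hst.symm
        · rfl
    · intro v
      by_cases hvt : v = t
      · exact ⟨Sum.inr 1, hvt.symm⟩
      by_cases hvs : v = s
      · exact ⟨Sum.inr 0, hvs.symm⟩
      refine ⟨Sum.inl ⟨η ⟨v, hvt⟩, fun h => hvs ?_⟩, ?_⟩
      · simpa using η.injective h
      · simp [ψ]
  have hproj : ∀ y, (∃ j, y = Sum.inr j) ∨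
      (η.symm (outProj (η ⟨s, hst⟩) 2 y)).1 = ψ y := by
    rintro (y | j)
    · exact .inr rfl
    · exact .inl ⟨j, rfl⟩
  have hiso : Nonempty (Iso (F.outsplit _ c) G) := by
    refine nonempty_iso_of_adj ((outV c).symm.trans (Equiv.ofBijective ψ hψ)) fun x y => ?_
    obtain ⟨x, rfl⟩ := (outV c).surjective x
    obtain ⟨y, rfl⟩ := (outV c).surjective y
    simp only [Equiv.trans_apply, Equiv.symm_apply_apply, Equiv.ofBijective_apply]
    have hout : ∃ v, outProj (η ⟨s, hst⟩) 2 y = η v := ⟨_, (η.apply_symm_apply _).symm⟩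
    obtain ⟨v, hv⟩ := hout
    have hvy : (∃ j, y = Sum.inr j) ∨ v.1 = ψ y := by
      simpa [hv] using hproj y
    have hψr : ∀ j, G.IsRegularSource (ψ (Sum.inr j)) := by
      intro j
      fin_cases j
      · exact hs
      · exact ht
    have hzero : ∀ u, (∃ j, y = Sum.inr j) → G.adj u (ψ y) = G.adj u v.1 := by
      rintro u ⟨j, rfl⟩
      have : v = ⟨s, hst⟩ := η.injective hv.symm
      rw [this, adj_eq_zero_of_isRegularSource u hs, adj_eq_zero_of_isRegularSource u (hψr j)]
    have hu : ∀ u, G.adj u (ψ y) = G.adj u v.1 := fun u =>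
      hvy.elim (hzero u) fun h => by rw [h]
    rw [hu]
    rcases x with x | j
    · rw [adj_outV_inl, hv]
      have hx : x.1 = η (η.symm x.1) := (η.apply_symm_apply _).symm
      rw [hx, hadj]
      · rfl
      · exact fun h => x.2 (η.symm_apply_eq.1 (Subtype.ext h))
    · rw [adj_outV_inr, hv]
      fin_cases j
      · exact (hc0 v).symm
      · exact (hc1 v).symm
  refine ⟨F, ⟨η ⟨s, hst⟩, 2, c, ⟨hreg, hsrc⟩, hpart, hiso⟩, ?_⟩
  rw [← Nat.card_congr η]
  exact Finite.card_subtype_lt (p := fun v => v ≠ t) (not_not.2 rfl)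

theorem exists_collectSources (G : DirGraph.{u}) :
    ∃ H, ReflTransGen CollectSources G H ∧ H.AtMostOneRegularSource := by
  obtain ⟨H, h, -, h'⟩ := exists_reflTransGen_of_decreasing (r := CollectSources)
    (fun G => Nat.card G.V) (I := fun _ => True) (T := AtMostOneRegularSource)
    (fun G _ hG => by
      obtain ⟨H, h, h'⟩ := exists_collectSources_card_lt hG
      exact ⟨H, h, trivial, h'⟩) G trivial
  exact ⟨H, h, h'⟩

theorem exists_sameData_of_collectSources {G H : DirGraph.{u}}
    (h : ReflTransGen CollectSources G H) : ∃ φ : G.Vt ≃ H.Vt, SameData φ := by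
  induction h with
  | refl => exact ⟨Equiv.refl _, fun _ _ => rfl, fun _ => rfl⟩
  | tail _ h ih =>
    obtain ⟨φ, hφ⟩ := ih
    obtain ⟨ψ, hψ⟩ := h.exists_sameData
    exact ⟨_, hφ.trans hψ⟩

/-! ### Move equivalence -/

theorem MoveEquivalent.symm {G H : DirGraph.{u}} (h : MoveEquivalent G H) :
    MoveEquivalent H G := by
  induction h with
  | refl => exact .refl
  | tail _ h ih => exact .head h.symm ih

theorem MoveEquivalent.trans {G H K : DirGraph.{u}} (h : MoveEquivalent G H)
    (h' : MoveEquivalent H K) : MoveEquivalent G K := ReflTransGen.trans h h'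

theorem MoveO.moveEquivalent {G H : DirGraph.{u}} (h : MoveO G H) : MoveEquivalent G H :=
  .single (.inl (.inl h))

theorem MoveRPlus.moveEquivalent {G H : DirGraph.{u}} (h : MoveRPlus G H) : MoveEquivalent G H :=
  .single (.inl (.inr (.inr h)))

theorem moveEquivalent_of_reflTransGen {r : DirGraph.{u} → DirGraph.{u} → Prop}
    (hr : ∀ G H, r G H → MoveEquivalent G H) {G H : DirGraph.{u}} (h : ReflTransGen r G H) :
    MoveEquivalent G H := by
  induction h with
  | refl => exact .refl
  | tail _ h ih => exact ih.trans (hr _ _ h)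

/-- `MoveEquivalent` is reflexive only up to equality, so an isomorphism has to be absorbed by a
move: outsplitting into a single class, which is possible at any vertex that is not a sink. -/
theorem Iso.moveEquivalent {G H : DirGraph.{u}} (f : Iso G H) {w t : G.V} (h : G.adj w t ≠ 0) :
    MoveEquivalent G H := by
  obtain ⟨e, he, -⟩ := hasEdge_iff.2 h
  let c : {e // G.s e = w} → Fin 1 := fun _ => 0
  have hc : G.IsOutPartition w c :=
    ⟨⟨e, he⟩, fun j => ⟨⟨e, he⟩, Subsingleton.elim _ _⟩, fun i j _ _ => Subsingleton.elim i j⟩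
  have hb : Function.Bijective (outProj w 1) := by
    refine ⟨?_, hc.outProj_surjective⟩
    rintro (a | a) (b | b) hab
    · exact congrArg Sum.inl (Subtype.ext hab)
    · exact absurd hab a.2
    · exact absurd hab.symm b.2
    · exact congrArg Sum.inr (Subsingleton.elim a b)
  obtain ⟨g⟩ : Nonempty (Iso (G.outsplit w c) G) := by
    refine nonempty_iso_of_adj ((outV c).symm.trans (Equiv.ofBijective _ hb)) fun x y => ?_
    obtain ⟨x, rfl⟩ := (outV c).surjective x
    obtain ⟨y, rfl⟩ := (outV c).surjective y
    simp only [Equiv.trans_apply, Equiv.symm_apply_apply, Equiv.ofBijective_apply]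
    rcases x with x | j
    · rw [adj_outV_inl]
      rfl
    · rw [adj_outV_inr]
      exact (classAdj_eq_of_forall fun _ _ => Subsingleton.elim _ _).symm
  exact MoveO.moveEquivalent ⟨w, 1, c, hc, ⟨g.trans f⟩⟩

/-! ### Row additions of matrices -/

theorem enat_add_one_sub_one (n : ℕ∞) : n + 1 - 1 = n := by
  cases n with
  | top => simp
  | coe n => norm_cast

theorem enat_sub_one_add_one {n : ℕ∞} (h : n ≠ 0) : n - 1 + 1 = n :=
  tsub_add_cancel_of_le (Order.one_le_iff_ne_zero.2 h)

theorem enat_add_sub_one (m : ℕ∞) {n : ℕ∞} (h : n ≠ 0) : m + n - 1 = m + (n - 1) := by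
  conv_lhs => rw [← enat_sub_one_add_one h, ← add_assoc, enat_add_one_sub_one]

section Matrix

variable {ι : Type*}

open Classical in
/-- The numbers of edges after adding row `i` to row `j`. -/
noncomputable def rowA (A : ι → ι → ℕ∞) (i j : ι) (a b : ι) : ℕ∞ :=
  if b = j then (if a = i then A i j + A i i - 1 else A a j + A a i) else A a b

open Classical in
/-- The column vector `D` after adding row `i` to row `j`. -/
noncomputable def rowD (d : ι → ℕ∞) (i j : ι) : ι → ℕ∞ := Function.update d j (d j + d i)

variable {A : ι → ι → ℕ∞} {d : ι → ℕ∞} {i j : ι}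

theorem rowA_of_ne (a : ι) {b : ι} (h : b ≠ j) : rowA A i j a b = A a b := if_neg h

theorem rowA_target {a : ι} (h : a ≠ i) : rowA A i j a j = A a j + A a i := by simp [rowA, h]

theorem rowA_self : rowA A i j i j = A i j + A i i - 1 := by simp [rowA]

theorem rowA_comp {κ : Type*} (φ : ι ≃ κ) (C : κ → κ → ℕ∞) (a b : ι) :
    rowA (fun a b => C (φ a) (φ b)) i j a b = rowA C (φ i) (φ j) (φ a) (φ b) := by
  by_cases hb : b = j
  · subst hb
    by_cases ha : a = i
    · subst ha
      rw [rowA_self, rowA_self]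
    · rw [rowA_target ha, rowA_target (φ.injective.ne ha)]
  · rw [rowA_of_ne _ hb, rowA_of_ne _ (φ.injective.ne hb)]

theorem rowD_self : rowD d i j j = d j + d i := by simp [rowD]

theorem rowD_of_ne {a : ι} (h : a ≠ j) : rowD d i j a = d a := by simp [rowD, h]

/-- Only the entry at `(i, j)` could decrease, by the subtracted one; a loop at `i` compensates for
it and an infinite entry does not notice it. -/
theorem le_rowA (hl : A i i ≠ 0 ∨ A i j = ⊤) (a b : ι) : A a b ≤ rowA A i j a b := by
  by_cases hb : b = j
  · subst hb
    by_cases ha : a = i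
    · subst ha
      rw [rowA_self]
      rcases hl with hl | hl
      · rw [enat_add_sub_one _ hl]
        exact le_self_add
      · simp [hl]
    · rw [rowA_target ha]
      exact le_self_add
  · rw [rowA_of_ne _ hb]

theorem rowA_ne_zero_of_ne_zero (hl : A i i ≠ 0 ∨ A i j = ⊤) {a b : ι} (h : A a b ≠ 0) :
    rowA A i j a b ≠ 0 := fun h0 => h (le_antisymm (h0 ▸ le_rowA hl a b) bot_le)

theorem exists_top_of_rowA {a b : ι} (h : rowA A i j a b = ⊤) : ∃ c, A a c = ⊤ := by
  by_cases hb : b = j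
  · subst hb
    by_cases ha : a = i
    · subst ha
      rw [rowA_self] at h
      simp only [ENat.sub_eq_top_iff, ENat.add_eq_top] at h
      rcases h.1 with h | h <;> exact ⟨_, h⟩
    · rw [rowA_target ha, ENat.add_eq_top] at h
      rcases h with h | h <;> exact ⟨_, h⟩
  · rw [rowA_of_ne _ hb] at h
    exact ⟨_, h⟩

theorem of_rowA_ne_zero {a b : ι} (h : rowA A i j a b ≠ 0) :
    A a b ≠ 0 ∨ (b = j ∧ (A a i ≠ 0 ∨ a = i)) := by
  by_cases hb : b = j
  · subst hb
    by_cases ha : a = i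
    · exact .inr ⟨rfl, .inr ha⟩
    · rw [rowA_target ha] at h
      by_contra! hne
      exact h (by rw [hne.1, (hne.2 rfl).1, add_zero])
  · rw [rowA_of_ne _ hb] at h
    exact .inl h

theorem TopOrZero.rowA (h : TopOrZero A) : TopOrZero (rowA A i j) := by
  intro a b c hab
  obtain ⟨x, hx⟩ := exists_top_of_rowA hab
  by_cases hc : c = j
  · subst hc
    have h1 := h a x c hx
    have h2 := h a x i hx
    by_cases ha : a = i
    · subst ha
      rw [rowA_self]
      rcases h1 with h1 | h1 <;> rcases h2 with h2 | h2 <;> simp [h1, h2]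
    · rw [rowA_target ha]
      rcases h1 with h1 | h1 <;> rcases h2 with h2 | h2 <;> simp [h1, h2]
  · rw [rowA_of_ne _ hc]
    exact h a x c hx

theorem regularRow_of_rowA (hl : A i i ≠ 0 ∨ A i j = ⊤) {a : ι}
    (h : RegularRow (rowA A i j) a) : RegularRow A a := by
  refine ⟨fun b hb => h.1 b (top_le_iff.1 (hb ▸ le_rowA hl a b)), ?_⟩
  obtain ⟨b, hb⟩ := h.2
  rcases of_rowA_ne_zero hb with hb | ⟨_, hb | rfl⟩
  · exact ⟨_, hb⟩
  · exact ⟨_, hb⟩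
  · rcases hl with hl | hl
    · exact ⟨_, hl⟩
    · exact ⟨j, by simp [hl]⟩

theorem RegularRow.rowA (hl : A i i ≠ 0 ∨ A i j = ⊤) {a : ι} (h : RegularRow A a) :
    RegularRow (rowA A i j) a := by
  refine ⟨fun b hb => ?_, ?_⟩
  · obtain ⟨c, hc⟩ := exists_top_of_rowA hb
    exact h.1 c hc
  · obtain ⟨b, hb⟩ := h.2
    exact ⟨b, rowA_ne_zero_of_ne_zero hl hb⟩

theorem LoopAtRegular.rowA (hl : A i i ≠ 0 ∨ A i j = ⊤) (h : LoopAtRegular A) :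
    LoopAtRegular (rowA A i j) := fun a ha =>
  rowA_ne_zero_of_ne_zero hl (h a (regularRow_of_rowA hl ha))

/-- Each new edge `a → j` comes from an edge `a → i` (or has `a = i`), so it is replaced by an old
path through `i` to `j`. -/
theorem matPath_rowA_iff (hl : A i i ≠ 0 ∨ A i j = ⊤) (hp : MatPath A i j) {a b : ι} :
    MatPath (rowA A i j) a b ↔ MatPath A a b := by
  constructor
  · intro h
    have hstep : ∀ x y, DirGraph.rowA A i j x y ≠ 0 → MatPath A x y := by
      intro x y hxy
      rcases of_rowA_ne_zero hxy with hxy | ⟨rfl, hxy | rfl⟩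
      · exact .single hxy
      · exact .head hxy hp
      · exact hp
    induction h with
    | single h => exact hstep _ _ h
    | tail _ h ih => exact ih.trans (hstep _ _ h)
  · exact TransGen.mono (fun x y hxy => rowA_ne_zero_of_ne_zero hl hxy) a b

/-- This is the commutator relation of elementary matrices: after adding row `i` to `k`, adding `k`
to `j` also carries row `i` into `j`, which can equally be done directly beforehand. The loop at `i`
makes the truncated subtraction associate. -/
theorem rowA_comm {k : ι} (hij : i ≠ j) (hik : i ≠ k) (hkj : k ≠ j) (hi : A i i ≠ 0) :
    rowA (rowA A i k) k j = rowA (rowA (rowA A i j) k j) i k := by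
  funext a b
  by_cases hbj : b = j
  · subst hbj
    rw [rowA_of_ne (b := b) _ hkj.symm]
    by_cases hak : a = k
    · subst hak
      rw [rowA_self, rowA_self, rowA_of_ne _ hkj.symm, rowA_target hik.symm,
        rowA_target hik.symm, rowA_of_ne _ hkj]
      rw [add_assoc, add_comm (A a i)]
    · rw [rowA_target hak, rowA_target hak, rowA_of_ne _ hkj.symm, rowA_of_ne _ hkj]
      by_cases hai : a = i
      · subst hai
        rw [rowA_self, rowA_self, enat_add_sub_one _ hi, enat_add_sub_one _ hi, add_assoc,
          add_comm (A a k)]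
      · rw [rowA_target hai, rowA_target hai, add_assoc, add_comm (A a k)]
  · rw [rowA_of_ne _ hbj]
    by_cases hbk : b = k
    · subst hbk
      by_cases hai : a = i
      · subst hai
        rw [rowA_self, rowA_self, rowA_of_ne _ hbj, rowA_of_ne _ hbj, rowA_of_ne _ hij,
          rowA_of_ne _ hij]
      · rw [rowA_target hai, rowA_target hai, rowA_of_ne _ hbj, rowA_of_ne _ hbj,
          rowA_of_ne _ hij, rowA_of_ne _ hij]
    · rw [rowA_of_ne _ hbk, rowA_of_ne _ hbk, rowA_of_ne _ hbj, rowA_of_ne _ hbj]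

theorem rowD_comm {k : ι} (hij : i ≠ j) (hik : i ≠ k) (hkj : k ≠ j) :
    rowD (rowD d i k) k j = rowD (rowD (rowD d i j) k j) i k := by
  funext a
  by_cases haj : a = j
  · subst haj
    rw [rowD_self, rowD_of_ne hkj.symm, rowD_of_ne hkj.symm, rowD_self, rowD_self, rowD_self,
      rowD_of_ne hkj]
    rw [add_assoc, add_comm (d i)]
  · rw [rowD_of_ne haj]
    by_cases hak : a = k
    · subst hak
      rw [rowD_self, rowD_self, rowD_of_ne haj, rowD_of_ne haj, rowD_of_ne hij, rowD_of_ne hij]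
    · rw [rowD_of_ne hak, rowD_of_ne hak, rowD_of_ne haj, rowD_of_ne haj]

end Matrix

/-! ### Row additions of graphs -/

theorem enatMap_add (m n : ℕ∞) : ENat.map (fun n : ℕ => (n : ℤ)) (m + n) =
    ENat.map (fun n : ℕ => (n : ℤ)) m + ENat.map (fun n : ℕ => (n : ℤ)) n := by
  cases m with
  | top => simp
  | coe m =>
    cases n with
    | top => simp
    | coe n =>
      rw [← Nat.cast_add]
      simp only [ENat.map_natCast]
      rw [← WithTop.coe_add]
      push_cast
      rfl

theorem enatMap_sub_one {n : ℕ∞} (h : n ≠ 0) : ENat.map (fun n : ℕ => (n : ℤ)) (n - 1) =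
    ENat.map (fun n : ℕ => (n : ℤ)) n + ((-1 : ℤ) : WithTop ℤ) := by
  cases n with
  | top => simp
  | coe n =>
    obtain ⟨m, rfl⟩ := Nat.exists_eq_succ_of_ne_zero (n := n) (by simpa using h)
    have : ((m.succ : ℕ) : ℕ∞) - 1 = (m : ℕ∞) := by
      rw [Nat.cast_succ, enat_add_one_sub_one]
    rw [this]
    simp only [ENat.map_natCast]
    rw [← WithTop.coe_add]
    congr 1
    push_cast
    ring

theorem enatMap_injective : Function.Injective (ENat.map fun n : ℕ => (n : ℤ)) :=
  WithTop.map_injective Nat.cast_injective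

open Classical in
theorem B_eq (G : DirGraph.{u}) (i j : G.Vt) :
    G.B i j = ENat.map (fun n : ℕ => (n : ℤ)) (G.vadj j i) +
      ((if i = j then -1 else 0 : ℤ) : WithTop ℤ) := by
  by_cases h : i = j <;> simp [B, h, vadj]

open Classical in
-- The truncated `- 1` in `rowA` agrees with the entry `-1` of the integer matrix only if there is
-- an edge to subtract from; this is what `hl` guarantees.
theorem B_add_B {G : DirGraph.{u}} {i j : G.Vt} (hij : i ≠ j)
    (hl : G.vadj i j ≠ 0 ∨ G.vadj i i ≠ 0) (b : G.Vt) :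
    G.B j b + G.B i b = ENat.map (fun n : ℕ => (n : ℤ)) (rowA G.vadj i j b j) +
      ((if j = b then -1 else 0 : ℤ) : WithTop ℤ) := by
  by_cases hb : b = i
  · subst hb
    rw [B_eq_of_ne hij.symm, B_self, rowA_self, enatMap_sub_one, enatMap_add, add_assoc,
      if_neg hij.symm]
    · simp [add_assoc]
    · rw [Ne, add_eq_zero, not_and_or]
      exact hl
  · rw [B_eq_of_ne (Ne.symm hb), rowA_target hb, enatMap_add, B_eq, add_right_comm]

theorem coe_withTop_add_right_cancel {a b : WithTop ℤ} {z : ℤ}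
    (h : a + (z : WithTop ℤ) = b + (z : WithTop ℤ)) : a = b :=
  WithTop.add_right_cancel WithTop.coe_ne_top h

theorem rowAdd_iff {G H : DirGraph.{u}} {i j : G.Vt} (hij : i ≠ j)
    (hl : G.vadj i j ≠ 0 ∨ G.vadj i i ≠ 0) (hG : G.AtMostOneRegularSource) :
    RowAdd G H i j ↔ H.AtMostOneRegularSource ∧ ∃ φ : G.Vt ≃ H.Vt,
      (∀ a b, H.vadj (φ a) (φ b) = rowA G.vadj i j a b) ∧ ∀ a, H.D (φ a) = rowD G.D i j a := by
  classical
  have key : ∀ φ : G.Vt ≃ H.Vt, H.B.submatrix φ φ = G.B.updateRow j (G.B j + G.B i) ↔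
      ∀ a b, H.vadj (φ a) (φ b) = rowA G.vadj i j a b := by
    intro φ
    have hrhs : ∀ a b, G.B.updateRow j (G.B j + G.B i) b a =
        ENat.map (fun n : ℕ => (n : ℤ)) (rowA G.vadj i j a b) +
          ((if b = a then -1 else 0 : ℤ) : WithTop ℤ) := by
      intro a b
      by_cases hb : b = j
      · subst hb
        rw [Matrix.updateRow_self]
        exact B_add_B hij hl a
      · rw [Matrix.updateRow_ne hb, rowA_of_ne _ hb, B_eq]
    have hlhs : ∀ a b, H.B.submatrix φ φ b a =
        ENat.map (fun n : ℕ => (n : ℤ)) (H.vadj (φ a) (φ b)) +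
          ((if b = a then -1 else 0 : ℤ) : WithTop ℤ) := by
      intro a b
      rw [Matrix.submatrix_apply, B_eq]
      simp only [φ.injective.eq_iff]
    constructor
    · intro h a b
      have := congrFun (congrFun h b) a
      rw [hrhs, hlhs] at this
      exact enatMap_injective (coe_withTop_add_right_cancel this)
    · intro h
      ext b a : 2
      rw [hlhs, hrhs, h]
  have hD : ∀ φ : G.Vt ≃ H.Vt, H.D ∘ φ = Function.update G.D j (G.D j + G.D i) ↔
      ∀ a, H.D (φ a) = rowD G.D i j a := fun φ => by
    rw [funext_iff]
    simp only [rowD, Function.comp_apply]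
    convert Iff.rfl
  constructor
  · rintro ⟨-, h, φ, h1, h2⟩
    exact ⟨h, φ, (key φ).1 (by convert h2), (hD φ).1 (by convert h1)⟩
  · rintro ⟨h, φ, h1, h2⟩
    exact ⟨hG, h, φ, by convert (hD φ).2 h2, by convert (key φ).2 h1⟩

theorem represents_vadj {G : DirGraph.{u}} (hG : G.AtMostOneRegularSource) :
    Represents G.vadj G.D G := ⟨hG, Equiv.refl _, fun _ _ => rfl, fun _ => rfl⟩

/-- Outsplitting one edge from `w` to `t` and reducing the vertex that emits it. -/
theorem exists_split_reduce {G : DirGraph.{u}} {w t : G.V} (hwt : w ≠ t) (ht : G.adj w t ≠ 0)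
    (hl : G.adj w w ≠ 0 ∨ G.adj w t = ⊤) :
    ∃ (H : DirGraph.{u}) (e : G.V ⊕ Unit ≃ H.V), MoveEquivalent G H ∧
      (∀ u v, v ≠ t → H.adj (e (.inl u)) (e (.inl v)) = G.adj u v) ∧
      (∀ u, u ≠ w → H.adj (e (.inl u)) (e (.inl t)) = G.adj u t + G.adj u w) ∧
      H.adj (e (.inl w)) (e (.inl t)) = G.adj w t + G.adj w w - 1 ∧
      (∀ v, v ≠ t → H.adj (e (.inr ())) (e (.inl v)) = 0) ∧
      H.adj (e (.inr ())) (e (.inl t)) = 1 ∧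
      ∀ x, H.adj x (e (.inr ())) = 0 := by
  classical
  -- Class 1 consists of one edge to `t`; a loop at `w`, or another of the infinitely many edges to
  -- `t`, remains in class 0.
  obtain ⟨c, hc, hc1, hc1', hc0, hc0'⟩ := exists_isOutPartition_single ht
    (hl.elim (fun h => .inr ⟨w, hwt, h⟩) fun h => .inl (by simp [h]))
  have hloop : ¬ (G.outsplit w c).HasEdge (outV c (.inr 1)) (outV c (.inr 1)) := by
    rw [hasEdge_iff, not_not, adj_outV_inr]
    exact hc1' w hwt
  have hreg : (G.outsplit w c).IsRegular (outV c (.inr 1)) := by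
    rw [isRegular_outV_inr_iff hc]
    intro v
    by_cases hv : v = t
    · rw [hv, hc1]
      exact ENat.one_ne_top
    · rw [hc1' v hv]
      exact ENat.zero_ne_top
  -- Copy 0 plays the part of `w` from here on; copy 1 is the vertex to be reduced.
  let lift : G.V → {v // v ≠ w} ⊕ Fin 2 := fun v => if h : v = w then .inr 0 else .inl ⟨v, h⟩
  have hproj : ∀ v, outProj w 2 (lift v) = v := by
    intro v
    by_cases h : v = w
    · simp [lift, h, outProj]
    · simp [lift, h, outProj]
  have hlift : ∀ v, outV c (lift v) ≠ outV c (.inr 1) := by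
    intro v h
    have h := (outV c).injective h
    by_cases hv : v = w <;> simp [lift, hv] at h
  have hliftw : lift w = .inr 0 := by simp [lift]
  have hliftn : ∀ v (h : v ≠ w), lift v = .inl ⟨v, h⟩ := fun v h => by simp [lift, h]
  let f : G.V ⊕ Unit → ((G.outsplit w c).reduce (outV c (.inr 1)) hloop).V :=
    Sum.elim (fun v => redV hloop (.inl ⟨outV c (lift v), hlift v⟩)) fun _ => redV hloop (.inr ())
  have hf : Function.Bijective f := by
    constructor
    · rintro (a | a) (b | b) h
      · have h' := (redV hloop).injective h
        have h' : lift a = lift b :=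
          (outV c).injective (Subtype.ext_iff.1 (Sum.inl_injective h'))
        exact congrArg Sum.inl (by rw [← hproj a, h', hproj])
      · exact absurd ((redV hloop).injective h) (by simp)
      · exact absurd ((redV hloop).injective h) (by simp)
      · rfl
    · intro x
      obtain ⟨⟨x, hx⟩ | x, rfl⟩ := (redV hloop).surjective x
      · obtain ⟨x | j, rfl⟩ := (outV c).surjective x
        · refine ⟨.inl x.1, ?_⟩
          simp only [f, Sum.elim_inl, hliftn x.1 x.2]
        · fin_cases j
          · refine ⟨.inl w, ?_⟩
            simp only [f, Sum.elim_inl, hliftw]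
            rfl
          · exact absurd rfl hx
      · exact ⟨.inr (), rfl⟩
  have hadj : ∀ u v, ((G.outsplit w c).reduce (outV c (.inr 1)) hloop).adj
      (f (.inl u)) (f (.inl v)) = (G.outsplit w c).adj (outV c (lift u)) (outV c (lift v)) +
        (G.outsplit w c).adj (outV c (lift u)) (outV c (.inr 1)) * classAdj c 1 v := by
    intro u v
    refine (adj_redV_inl _ _).trans ?_
    rw [adj_outV_inr, hproj]
  have hadjr : ∀ v, ((G.outsplit w c).reduce (outV c (.inr 1)) hloop).adj
      (f (.inr ())) (f (.inl v)) = classAdj c 1 v := by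
    intro v
    refine (adj_redV_inr_inl _ _).trans ?_
    rw [adj_outV_inr, hproj]
  have hn : ∀ u, u ≠ w → ∀ y, (G.outsplit w c).adj (outV c (lift u)) (outV c y) =
      G.adj u (outProj w 2 y) := by
    intro u hu y
    rw [hliftn u hu, adj_outV_inl]
  have hw' : ∀ y, (G.outsplit w c).adj (outV c (lift w)) (outV c y) =
      classAdj c 0 (outProj w 2 y) := by
    intro y
    rw [hliftw, adj_outV_inr]
  refine ⟨_, Equiv.ofBijective f hf,
    (moveO_outsplit hc).moveEquivalent.trans (moveRPlus_reduce hloop hreg).moveEquivalent,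
    fun u v hv => ?_, fun u hu => ?_, ?_, fun v hv => ?_, ?_, fun x => ?_⟩
  · rw [Equiv.ofBijective_apply, Equiv.ofBijective_apply, hadj, hc1' v hv, mul_zero, add_zero]
    by_cases hu : u = w
    · rw [hu, hw', hproj, hc0' v hv]
    · rw [hn u hu, hproj]
  · rw [Equiv.ofBijective_apply, Equiv.ofBijective_apply, hadj, hc1, mul_one, hn u hu, hn u hu,
      hproj]
    rfl
  -- Copy 0 keeps all edges to `t` but one, and each loop at `w` has a copy running from copy 0 to
  -- copy 1, which turns into an edge to `t`.
  · rw [Equiv.ofBijective_apply, Equiv.ofBijective_apply, hadj, hc1, mul_one, hw', hw', hproj,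
      ← hc0]
    have : classAdj c 0 (outProj w 2 (.inr 1)) = G.adj w w := hc0' w hwt
    rw [this, add_right_comm, enat_add_one_sub_one]
  · exact (hadjr v).trans (hc1' v hv)
  · exact (hadjr t).trans hc1
  · exact adj_redV_inr ((redV hloop).symm x) ()

theorem isSource_congr_of_split {G H : DirGraph.{u}} {w t : G.V} {e : G.V ⊕ Unit ≃ H.V}
    (ht : G.adj w t ≠ 0)
    (h1 : ∀ u v, v ≠ t → H.adj (e (.inl u)) (e (.inl v)) = G.adj u v)
    (h4 : ∀ v, v ≠ t → H.adj (e (.inr ())) (e (.inl v)) = 0)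
    (h5 : H.adj (e (.inr ())) (e (.inl t)) = 1) (v : G.V) :
    H.IsSource (e (.inl v)) ↔ G.IsSource v := by
  simp only [isSource_iff, ← e.forall_congr_right]
  by_cases hv : v = t
  · subst hv
    refine iff_of_false (fun h => ?_) fun h => ht (h w)
    exact one_ne_zero (h5.symm.trans (h (.inr ())))
  · constructor
    · exact fun h u => (h1 u v hv).symm.trans (h _)
    · rintro h (u | u)
      · exact (h1 u v hv).trans (h u)
      · exact h4 v hv

/-- A basic row addition, before collecting regular sources. -/
theorem exists_moveEquivalent_rowA {G : DirGraph.{u}} {i j : G.Vt} (hij : i ≠ j)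
    (ht : G.vadj i j ≠ 0) (hl : G.vadj i i ≠ 0 ∨ G.vadj i j = ⊤) :
    ∃ (H : DirGraph.{u}) (φ : G.Vt ≃ H.Vt), MoveEquivalent G H ∧
      (∀ a b, H.vadj (φ a) (φ b) = rowA G.vadj i j a b) ∧ ∀ a, H.D (φ a) = rowD G.D i j a := by
  classical
  have hij' : i.1 ≠ j.1 := fun h => hij (Subtype.ext h)
  obtain ⟨H, e, hGH, h1, h2, h3, h4, h5, h6⟩ := exists_split_reduce hij' ht hl
  have hsrc := isSource_congr_of_split ht h1 h4 h5
  have hr : H.IsRegularSource (e (.inr ())) := by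
    refine ⟨isRegular_iff.2 ⟨fun x => ?_, e (.inl j.1), by rw [h5]; exact one_ne_zero⟩,
      isSource_iff.2 h6⟩
    obtain ⟨v | v, rfl⟩ := e.surjective x
    · by_cases hv : v = j.1
      · rw [hv, h5]
        exact ENat.one_ne_top
      · rw [h4 v hv]
        exact ENat.zero_ne_top
    · rw [h6]
      exact ENat.zero_ne_top
  have hs : ∀ v, H.IsRegularSource (e (.inl v)) ↔ G.IsRegularSource v := by
    intro v
    by_cases hv : v = i.1
    · subst hv
      refine iff_of_false (fun h => ?_) i.2
      -- If `i` receives nothing, it is an infinite emitter, not being a regular source; it stays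
      -- one after the row addition.
      have hsi : G.IsSource i.1 := (hsrc _).1 h.2
      obtain ⟨x, hx⟩ := isInfiniteEmitter_iff.1
        ((HasEdge.isRegular_or (hasEdge_iff.2 ht)).resolve_left fun hr => i.2 ⟨hr, hsi⟩)
      refine (isRegular_iff.1 h.1).1 (e (.inl x)) ?_
      by_cases hxj : x = j.1
      · rw [hxj, h3, ← hxj, hx]
        simp
      · rw [h1 _ _ hxj, hx]
    · rw [IsRegularSource, IsRegularSource, hsrc]
      refine and_congr_left fun hsv => ?_
      have hle : ∀ x, G.adj v x ≤ H.adj (e (.inl v)) (e (.inl x)) := by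
        intro x
        by_cases hx : x = j.1
        · rw [hx, h2 v hv]
          exact le_self_add
        · rw [h1 _ _ hx]
      rw [isRegular_iff, isRegular_iff]
      constructor
      · rintro ⟨hf, x, hx⟩
        refine ⟨fun x hx => hf _ (top_le_iff.1 (hx ▸ hle x)), ?_⟩
        obtain ⟨x | x, rfl⟩ := e.surjective x
        · by_cases hxj : x = j.1
          · rw [hxj, h2 v hv] at hx
            by_contra! hne
            exact hx (by rw [hne, hne, add_zero])
          · rw [h1 _ _ hxj] at hx
            exact ⟨x, hx⟩
        · exact absurd (h6 _) hx
      · rintro ⟨hf, x, hx⟩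
        refine ⟨fun y => ?_, e (.inl x), fun h0 => hx (le_antisymm (h0 ▸ hle x) bot_le)⟩
        obtain ⟨y | y, rfl⟩ := e.surjective y
        · by_cases hyj : y = j.1
          · rw [hyj, h2 v hv, Ne, ENat.add_eq_top, not_or]
            exact ⟨hf _, hf _⟩
          · rw [h1 _ _ hyj]
            exact hf y
        · rw [h6]
          exact ENat.zero_ne_top
  let φ : G.Vt ≃ H.Vt := Equiv.ofBijective
    (fun a => ⟨e (.inl a.1), fun h => a.2 ((hs _).1 h)⟩) ⟨fun a b h => by
      simpa [Subtype.ext_iff] using h, by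
      rintro ⟨v, hv⟩
      obtain ⟨v | v, rfl⟩ := e.surjective v
      · exact ⟨⟨v, fun h => hv ((hs v).2 h)⟩, rfl⟩
      · exact absurd hr hv⟩
  refine ⟨H, φ, hGH, fun a b => ?_, fun a => ?_⟩
  · by_cases hb : b = j
    · subst hb
      by_cases ha : a = i
      · subst ha
        rw [rowA_self]
        exact h3
      · rw [rowA_target ha]
        exact h2 a.1 fun h => ha (Subtype.ext h)
    · rw [rowA_of_ne _ hb]
      exact h1 a.1 b.1 fun h => hb (Subtype.ext h)
  · have := Fintype.ofFinite G.V
    have := Fintype.ofFinite H.V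
    have hD : H.D (φ a) = ∑ v, (if G.IsRegularSource v then
        H.adj (e (.inl v)) (e (.inl a.1)) else 0) + H.adj (e (.inr ())) (e (.inl a.1)) + 1 := by
      rw [D_eq_sum, ← e.sum_comp, Fintype.sum_sum_type]
      simp only [hs, Finset.univ_unique, Finset.sum_singleton]
      rw [if_pos hr]
      rfl
    rw [hD]
    by_cases ha : a = j
    · subst ha
      -- The edge from the new source provides the second of the two ones in `D j + D i`; this is
      -- why `D` counts one more than the edges from regular sources.
      rw [rowD_self, h5, D_eq_sum, D_eq_sum, add_assoc, add_add_add_comm,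
        ← Finset.sum_add_distrib]
      congr 1
      refine Finset.sum_congr rfl fun v _ => ?_
      split_ifs with hv
      · exact h2 v fun h => i.2 (h ▸ hv)
      · rw [add_zero]
    · have ha' : a.1 ≠ j.1 := fun h => ha (Subtype.ext h)
      rw [rowD_of_ne ha, h4 _ ha', add_zero, D_eq_sum]
      congr 1
      refine Finset.sum_congr rfl fun v _ => ?_
      rw [h1 _ _ ha']

/-- All graphs described by the two given pairs are move equivalent. -/
def DataEquivalent {ι : Type u} (A : ι → ι → ℕ∞) (d : ι → ℕ∞) (A' : ι → ι → ℕ∞)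
    (d' : ι → ℕ∞) : Prop :=
  ∀ G H : DirGraph.{u}, Represents A d G → Represents A' d' H → MoveEquivalent G H

/-- Splitting and reducing may leave several regular sources. Collecting them does not change the
data, and the graph obtained is isomorphic to any other one with the same data. -/
theorem dataEquivalent_basic {ι : Type u} {A : ι → ι → ℕ∞} {d : ι → ℕ∞} {i j : ι}
    (hij : i ≠ j) (ht : A i j ≠ 0) (hl : A i i ≠ 0 ∨ A i j = ⊤) :
    DataEquivalent A d (rowA A i j) (rowD d i j) := by
  rintro G H ⟨hG, φ, hA, hd⟩ hH
  obtain ⟨K, ψ, hGK, hK, hK'⟩ := exists_moveEquivalent_rowA (i := φ i) (j := φ j)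
    (φ.injective.ne hij) (by rwa [hA]) (by rwa [hA, hA])
  obtain ⟨K', hKK', hone⟩ := exists_collectSources K
  obtain ⟨χ, hχ⟩ := exists_sameData_of_collectSources hKK'
  have hrep : Represents (rowA A i j) (rowD d i j) K' := by
    refine ⟨hone, φ.trans (ψ.trans χ), fun a b => ?_, fun a => ?_⟩
    · rw [Equiv.trans_apply, Equiv.trans_apply, Equiv.trans_apply, Equiv.trans_apply, hχ.1, hK,
        ← rowA_comp]
      simp only [hA]
    · simp only [Equiv.trans_apply, hχ.2, hK']
      by_cases ha : a = j
      · rw [ha, rowD_self, rowD_self, hd, hd]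
      · rw [rowD_of_ne ha, rowD_of_ne (φ.injective.ne ha), hd]
  obtain ⟨f⟩ := hrep.nonempty_iso hH
  obtain ⟨x, y, hne⟩ : ∃ x y : K'.Vt, K'.vadj x y ≠ 0 := by
    obtain ⟨-, θ, hθ, -⟩ := hrep
    exact ⟨θ i, θ j, by rw [hθ]; exact rowA_ne_zero_of_ne_zero hl ht⟩
  exact (hGK.trans (moveEquivalent_of_reflTransGen (fun _ _ h => h.moveO.moveEquivalent.symm)
    hKK')).trans (f.moveEquivalent hne)

/-- The pair is the one of a graph in which infinite emitters emit infinitely many or no edges to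
any vertex, and in which regular vertices not supporting a loop are sources. -/
structure IsGood {ι : Type*} (A : ι → ι → ℕ∞) (d : ι → ℕ∞) : Prop where
  topOrZero : TopOrZero A
  loop : LoopAtRegular A
  one_le : ∀ a, 1 ≤ d a
  ne_top : ∀ a, d a ≠ ⊤

theorem IsGood.row {ι : Type*} {A : ι → ι → ℕ∞} {d : ι → ℕ∞} (h : IsGood A d) {i j : ι}
    (hl : A i i ≠ 0 ∨ A i j = ⊤) : IsGood (rowA A i j) (rowD d i j) := by
  refine ⟨h.topOrZero.rowA, h.loop.rowA hl, fun a => ?_, fun a => ?_⟩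
  · by_cases ha : a = j
    · rw [ha, rowD_self]
      exact (h.one_le j).trans le_self_add
    · rw [rowD_of_ne ha]
      exact h.one_le a
  · by_cases ha : a = j
    · rw [ha, rowD_self, Ne, ENat.add_eq_top, not_or]
      exact ⟨h.ne_top j, h.ne_top i⟩
    · rw [rowD_of_ne ha]
      exact h.ne_top a

/-- For a path from `i` to `k` followed by an edge `k → j`, the sequences (`i` to `k`, `k` to `j`)
and (`i` to `j`, `k` to `j`, `i` to `k`) have the same result. All their members except `i` to `j`
are known to be move equivalences, hence so is that one. The known ones are applied to several
matrices, so the path is fixed in `A₀` and `A` ranges over matrices with at least the same nonzero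
entries. -/
theorem dataEquivalent_improved {ι : Type u} [Finite ι] {A₀ : ι → ι → ℕ∞} {i j : ι}
    (hp : MatPath A₀ i j) : ∀ (A : ι → ι → ℕ∞) (d : ι → ℕ∞), (∀ a b, A₀ a b ≠ 0 → A a b ≠ 0) →
    IsGood A d → i ≠ j → A i i ≠ 0 → DataEquivalent A d (rowA A i j) (rowD d i j) := by
  induction hp with
  | single h =>
    exact fun A d hA _ hij hi => dataEquivalent_basic hij (hA _ _ h) (.inl hi)
  | @tail k j hik hkj ih =>
    intro A d hA hgood hij hi
    -- The path may run through `i` or `j` just before its end; then a single edge or the shorter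
    -- path already suffices.
    by_cases hki : k = i
    · subst hki
      exact dataEquivalent_basic hij (hA _ _ hkj) (.inl hi)
    by_cases hkj' : k = j
    · subst hkj'
      exact ih A d hA hgood hij hi
    have hik' : i ≠ k := Ne.symm hki
    have hgood1 : IsGood (rowA A i k) (rowD d i k) := hgood.row (.inl hi)
    have hgood' : IsGood (rowA A i j) (rowD d i j) := hgood.row (.inl hi)
    have hkj1 : rowA A i k k j ≠ 0 := rowA_ne_zero_of_ne_zero (.inl hi) (hA _ _ hkj)
    have hkj2 : rowA A i j k j ≠ 0 := rowA_ne_zero_of_ne_zero (.inl hi) (hA _ _ hkj)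
    have hl1 := hasLoop_or_top hgood1.topOrZero hgood1.loop hkj1
    have hl2 := hasLoop_or_top hgood'.topOrZero hgood'.loop hkj2
    have hgood'' := hgood'.row hl2
    have hgood2 := hgood1.row hl1
    have e1 := ih A d hA hgood hik' hi
    have e2 : DataEquivalent _ _ (rowA (rowA A i k) k j) (rowD (rowD d i k) k j) :=
      dataEquivalent_basic hkj' hkj1 hl1
    have e3 : DataEquivalent _ _ (rowA (rowA A i j) k j) (rowD (rowD d i j) k j) :=
      dataEquivalent_basic hkj' hkj2 hl2
    have e4 := ih _ _ (fun a b h => rowA_ne_zero_of_ne_zero hl2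
      (rowA_ne_zero_of_ne_zero (.inl hi) (hA a b h))) hgood'' hik'
      (rowA_ne_zero_of_ne_zero hl2 (rowA_ne_zero_of_ne_zero (.inl hi) hi))
    -- Now `e4` ends at the pair where `e1` followed by `e2` ends, and it starts where `e3` ends;
    -- the chain is closed by going back along `e4` and `e3`.
    rw [← rowA_comm hij hik' hkj' hi, ← rowD_comm hij hik' hkj'] at e4
    intro G H hG hH
    obtain ⟨G1, hG1⟩ := exists_represents hgood1.loop hgood1.one_le hgood1.ne_top
    obtain ⟨G2, hG2⟩ := exists_represents hgood2.loop hgood2.one_le hgood2.ne_top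
    obtain ⟨G3, hG3⟩ := exists_represents hgood''.loop hgood''.one_le hgood''.ne_top
    exact (((e1 G G1 hG hG1).trans (e2 G1 G2 hG1 hG2)).trans (e4 G3 G2 hG3 hG2).symm).trans
      (e3 H G3 hH hG3).symm

theorem isGood_vadj {G : DirGraph.{u}} (h1 : G.Prop1) (h2 : G.Prop2) : IsGood G.vadj G.D :=
  ⟨prop1_iff.1 h1, prop2_iff.1 h2, G.one_le_D, G.D_ne_top⟩

/-! ### Invariance of the cokernels -/

/-- It is enough that the maps are inverse modulo the subgroups. This is needed for outsplitting,
where the two free groups have different ranks. -/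
theorem nonempty_quotient_addEquiv {M N : Type*} [AddCommGroup M] [AddCommGroup N]
    {S : Submodule ℤ M} {T : Submodule ℤ N} (f : M →ₗ[ℤ] N) (g : N →ₗ[ℤ] M)
    (hf : ∀ x ∈ S, f x ∈ T) (hg : ∀ y ∈ T, g y ∈ S) (hgf : ∀ x, g (f x) - x ∈ S)
    (hfg : ∀ y, f (g y) - y ∈ T) : Nonempty (M ⧸ S ≃+ N ⧸ T) := by
  refine ⟨(LinearEquiv.ofLinearMap (S.mapQ T f hf) (T.mapQ S g hg) ?_ ?_).toAddEquiv⟩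
  · refine LinearMap.ext fun y => ?_
    obtain ⟨y, rfl⟩ := T.mkQ_surjective y
    exact (Submodule.Quotient.eq T).2 (hfg y)
  · refine LinearMap.ext fun x => ?_
    obtain ⟨x, rfl⟩ := S.mkQ_surjective x
    exact (Submodule.Quotient.eq S).2 (hgf x)

/-- The set whose infimum is `mr` is defined by the existence of isomorphisms, so it can be
transported without the structure theorem. -/
theorem mr_congr {G H : DirGraph.{u}} {i : G.Vt} {j : H.Vt}
    (h : Nonempty (G.cokB i ≃+ H.cokB j)) : G.mr i = H.mr j := by
  obtain ⟨e⟩ := h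
  rw [mr, mr]
  congr 1
  ext m
  simp only [Set.mem_ofPred_eq]
  refine exists_congr fun k => exists_congr fun l => exists_congr fun d => ?_
  refine and_congr_right fun _ => and_congr_right fun _ => and_congr_right fun _ => ?_
  exact ⟨fun ⟨f⟩ => ⟨e.symm.trans f⟩, fun ⟨f⟩ => ⟨e.trans f⟩⟩

/-- The columns of the block of `B` at the component of `i`. -/
noncomputable def blockCol (G : DirGraph.{u}) (i : G.Vt) (l k : G.comp i) : ℤ :=
  (G.B k.1 l.1).untopD 0

/-- The subgroup generated by the columns at regular vertices. -/
def colSpan (G : DirGraph.{u}) (i : G.Vt) : Submodule ℤ (G.comp i → ℤ) :=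
  Submodule.span ℤ (Set.range fun (l : {l : G.comp i // G.IsRegular l.1.1}) => G.blockCol i l.1)

theorem blockCol_mem_colSpan {G : DirGraph.{u}} {i : G.Vt} {l : G.comp i}
    (h : G.IsRegular l.1.1) : G.blockCol i l ∈ G.colSpan i :=
  Submodule.subset_span ⟨⟨l, h⟩, rfl⟩

theorem map_colSpan {G : DirGraph.{u}} {i : G.Vt} {N : Type*} [AddCommGroup N]
    {T : Submodule ℤ N} (f : (G.comp i → ℤ) →ₗ[ℤ] N)
    (h : ∀ l : G.comp i, G.IsRegular l.1.1 → f (G.blockCol i l) ∈ T) :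
    ∀ x ∈ G.colSpan i, f x ∈ T := by
  suffices G.colSpan i ≤ T.comap f from this
  rw [colSpan, Submodule.span_le]
  rintro _ ⟨l, rfl⟩
  exact h l.1 l.2

open Classical in
theorem untopD_B {G : DirGraph.{u}} {k l : G.Vt} (h : G.vadj l k ≠ ⊤) :
    (G.B k l).untopD 0 = (G.vadj l k).toNat - if k = l then 1 else 0 := by
  rw [B_eq]
  generalize G.vadj l k = n at h
  cases n with
  | top => exact absurd rfl h
  | coe n =>
    simp only [ENat.map_natCast, ENat.toNat_natCast]
    rw [← WithTop.coe_add, WithTop.untopD_coe]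
    split_ifs <;> ring

theorem B_ne_top {G : DirGraph.{u}} {k l : G.Vt} (h : G.vadj l k ≠ ⊤) : G.B k l ≠ ⊤ := by
  classical
  rw [B_eq]
  generalize G.vadj l k = n at h
  cases n with
  | top => exact absurd rfl h
  | coe n =>
    simp only [ENat.map_natCast]
    rw [← WithTop.coe_add]
    exact WithTop.coe_ne_top

/-- Since N² = 0, the map 1 + N is invertible with inverse 1 - N; it carries the generating columns
of one cokernel to those of the other. The case `N = 0` covers mere relabelling. -/
theorem mr_eq_of_equiv {G H : DirGraph.{u}} {i : G.Vt} {j : H.Vt} (ρ : G.comp i ≃ H.comp j)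
    (N : (G.comp i → ℤ) →ₗ[ℤ] (G.comp i → ℤ)) (hN : ∀ y, N (N y) = 0)
    (hreg : ∀ l, H.IsRegular (ρ l).1.1 ↔ G.IsRegular l.1.1)
    (hcol : ∀ l k, G.IsRegular l.1.1 →
      H.blockCol j (ρ l) (ρ k) = G.blockCol i l k + N (G.blockCol i l) k) :
    H.mr j = G.mr i := by
  let r : (G.comp i → ℤ) ≃ₗ[ℤ] (H.comp j → ℤ) := LinearEquiv.funCongrLeft ℤ ℤ ρ.symm
  have hr : ∀ y k, r y (ρ k) = y k := fun y k => by
    simp [r, LinearEquiv.funCongrLeft, LinearMap.funLeft]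
  have hcol' : ∀ l, G.IsRegular l.1.1 →
      r (G.blockCol i l + N (G.blockCol i l)) = H.blockCol j (ρ l) := by
    intro l hl
    funext k
    obtain ⟨k, rfl⟩ := ρ.surjective k
    rw [hr, hcol l k hl]
    rfl
  refine (mr_congr (nonempty_quotient_addEquiv (S := G.colSpan i) (T := H.colSpan j)
    (r.toLinearMap ∘ₗ (LinearMap.id + N)) ((LinearMap.id - N) ∘ₗ r.symm.toLinearMap)
    (map_colSpan _ fun l hl => ?_) (map_colSpan _ fun l hl => ?_) (fun x => ?_)
    fun y => ?_)).symm
  · have := blockCol_mem_colSpan (l := ρ l) ((hreg l).2 hl)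
    rwa [← hcol' l hl] at this
  · obtain ⟨l, rfl⟩ := ρ.surjective l
    have hl' := (hreg l).1 hl
    rw [← hcol' l hl']
    simpa [hN] using blockCol_mem_colSpan hl'
  · simp [hN]
  · simp [hN]

/-! ### Growing graphs without changing components -/

/-- A bijection under which numbers of edges do not decrease, and paths, regular vertices, and
the invariants of components are preserved. -/
structure Grow {G H : DirGraph.{u}} (φ : G.Vt ≃ H.Vt) : Prop where
  le : ∀ a b, G.vadj a b ≤ H.vadj (φ a) (φ b)
  path : ∀ a b, MatPath H.vadj (φ a) (φ b) ↔ MatPath G.vadj a b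
  regular : ∀ a, H.IsRegular (φ a).1 ↔ G.IsRegular a.1
  loops : ∀ a, (∀ b ∈ G.comp a, b = a) → H.vadj (φ a) (φ a) = G.vadj a a
  mr : ∀ a, H.mr (φ a) = G.mr a
  prop1 : G.Prop1 → H.Prop1
  prop2 : G.Prop2 → H.Prop2

theorem matPath_comp {ι κ : Type*} (φ : ι ≃ κ) (A : κ → κ → ℕ∞) (a b : ι) :
    MatPath A (φ a) (φ b) ↔ MatPath (fun a b => A (φ a) (φ b)) a b := by
  constructor
  · intro h
    have := TransGen.lift (r := fun a b => A a b ≠ 0)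
      (p := fun a b => A (φ a) (φ b) ≠ 0) φ.symm
      (fun x y hxy => by simpa [Function.onFun] using hxy) _ _ h
    rwa [Function.onFun, φ.symm_apply_apply, φ.symm_apply_apply] at this
  · intro h
    exact TransGen.lift φ (fun _ _ hxy => hxy) _ _ h

theorem mem_comp_of_path {G H : DirGraph.{u}} {φ : G.Vt ≃ H.Vt}
    (h : ∀ a b, MatPath H.vadj (φ a) (φ b) ↔ MatPath G.vadj a b) {a b : G.Vt} :
    φ b ∈ H.comp (φ a) ↔ b ∈ G.comp a := by
  rw [mem_comp_iff, mem_comp_iff, h, h, φ.injective.eq_iff]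

theorem Grow.mem_comp {G H : DirGraph.{u}} {φ : G.Vt ≃ H.Vt} (h : Grow φ) {a b : G.Vt} :
    φ b ∈ H.comp (φ a) ↔ b ∈ G.comp a := mem_comp_of_path h.path

theorem comp_image_of_path {G H : DirGraph.{u}} {φ : G.Vt ≃ H.Vt}
    (h : ∀ a b, MatPath H.vadj (φ a) (φ b) ↔ MatPath G.vadj a b) (a : G.Vt) :
    H.comp (φ a) = φ '' G.comp a := by
  ext x
  obtain ⟨x, rfl⟩ := φ.surjective x
  rw [mem_comp_of_path h, φ.injective.mem_set_image]

theorem Grow.comp_image {G H : DirGraph.{u}} {φ : G.Vt ≃ H.Vt} (h : Grow φ) (a : G.Vt) :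
    H.comp (φ a) = φ '' G.comp a := comp_image_of_path h.path a

theorem Grow.ncard_comp {G H : DirGraph.{u}} {φ : G.Vt ≃ H.Vt} (h : Grow φ) (a : G.Vt) :
    (H.comp (φ a)).ncard = (G.comp a).ncard := by
  rw [h.comp_image, Set.ncard_image_of_injective _ φ.injective]

theorem SameData.grow {G H : DirGraph.{u}} {φ : G.Vt ≃ H.Vt} (h : SameData φ) : Grow φ := by
  have hvadj : (fun a b => H.vadj (φ a) (φ b)) = G.vadj := funext fun a => funext fun b => h.1 a b
  have hpath : ∀ a b, MatPath H.vadj (φ a) (φ b) ↔ MatPath G.vadj a b := fun a b => by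
    rw [matPath_comp, hvadj]
  have hreg : ∀ a, H.IsRegular (φ a).1 ↔ G.IsRegular a.1 := fun a => by
    rw [isRegular_iff_vadj, isRegular_iff_vadj, RegularRow, RegularRow, ← φ.forall_congr_right,
      ← φ.exists_congr_right]
    simp only [h.1]
  have hB : ∀ k l, H.B (φ k) (φ l) = G.B k l := fun k l => by
    classical
    rw [B_eq, B_eq, h.1]
    simp only [φ.injective.eq_iff]
  refine ⟨fun a b => (h.1 a b).ge, hpath, hreg, fun a _ => h.1 a a, fun a => ?_, h.prop1, h.prop2⟩
  refine mr_eq_of_equiv (φ.subtypeEquiv fun b => (mem_comp_of_path hpath).symm) 0 (fun _ => rfl)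
    (fun l => hreg l.1) fun l k _ => ?_
  simp [blockCol, hB]

/-- `φ` describes the addition of row `i` to row `j`. -/
def IsRowOp {G H : DirGraph.{u}} (φ : G.Vt ≃ H.Vt) (i j : G.Vt) : Prop :=
  ∀ a b, H.vadj (φ a) (φ b) = rowA G.vadj i j a b

theorem IsRowOp.B_eq {G H : DirGraph.{u}} {φ : G.Vt ≃ H.Vt} {i j : G.Vt} (h : IsRowOp φ i j)
    (hij : i ≠ j) (hl : G.vadj i j ≠ 0 ∨ G.vadj i i ≠ 0) (l : G.Vt) :
    H.B (φ j) (φ l) = G.B j l + G.B i l := by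
  classical
  rw [B_add_B hij hl, DirGraph.B_eq, h]
  simp only [φ.injective.eq_iff]

theorem IsRowOp.B_eq_of_ne {G H : DirGraph.{u}} {φ : G.Vt ≃ H.Vt} {i j : G.Vt}
    (h : IsRowOp φ i j) {k : G.Vt} (hk : k ≠ j) (l : G.Vt) :
    H.B (φ k) (φ l) = G.B k l := by
  classical
  rw [DirGraph.B_eq, DirGraph.B_eq, h, rowA_of_ne _ hk]
  simp only [φ.injective.eq_iff]

/-- Within one block a row addition is multiplication from the left by 1 + N, where N moves the
coordinate `i` to `j`. If `i` or `j` lies outside the component, N vanishes, and the block has not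
changed. -/
theorem IsRowOp.mr_eq {G H : DirGraph.{u}} {φ : G.Vt ≃ H.Vt} {i j : G.Vt} (h : IsRowOp φ i j)
    (hij : i ≠ j) (hl : G.vadj i j ≠ 0 ∨ G.vadj i i ≠ 0) (hp : MatPath G.vadj i j)
    (hpath : ∀ a b, MatPath H.vadj (φ a) (φ b) ↔ MatPath G.vadj a b)
    (hreg : ∀ a, H.IsRegular (φ a).1 ↔ G.IsRegular a.1) (a : G.Vt) :
    H.mr (φ a) = G.mr a := by
  classical
  let N : (G.comp a → ℤ) →ₗ[ℤ] (G.comp a → ℤ) :=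
    { toFun := fun y k => if k.1 = j then (if hi : i ∈ G.comp a then y ⟨i, hi⟩ else 0) else 0
      map_add' := fun y z => by
        funext k
        simp only [Pi.add_apply]
        split_ifs <;> simp
      map_smul' := fun r y => by
        funext k
        simp only [Pi.smul_apply]
        split_ifs <;> simp }
  have hNdef : ∀ y k, N y k = if k.1 = j then (if hi : i ∈ G.comp a then y ⟨i, hi⟩ else 0)
    else 0 := fun _ _ => rfl
  refine mr_eq_of_equiv (φ.subtypeEquiv fun b => (mem_comp_of_path hpath).symm) N (fun y => ?_)
    (fun l => hreg l.1) fun l k hreg => ?_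
  · funext k
    rw [hNdef]
    split_ifs with hk hi
    · rw [hNdef, if_neg hij]
      rfl
    · rfl
    · rfl
  · have hfin := (isRegular_iff_vadj.1 hreg).1
    rw [hNdef]
    change (H.B (φ k.1) (φ l.1)).untopD 0 = (G.B k.1 l.1).untopD 0 + _
    split_ifs with hk hi
    · rw [hk, h.B_eq hij hl]
      exact WithTop.untopD_add (B_ne_top (hfin j)) (B_ne_top (hfin i))
    · have hzero : G.B i l.1 = 0 := by
        have hli : i ≠ l.1 := fun h => hi (h ▸ l.2)
        by_contra hne
        have hne : G.vadj l.1 i ≠ 0 := fun h0 => hne (by rw [DirGraph.B_eq_of_ne hli, h0]; simp)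
        refine hi (mem_comp_trans l.2 (mem_comp_iff.2 (.inr ⟨.single hne, ?_⟩)))
        have hjl : l.1 ∈ G.comp j := mem_comp_trans (mem_comp_symm (hk ▸ k.2)) l.2
        rcases mem_comp_iff.1 hjl with hjl | hjl
        · rwa [hjl]
        · exact hp.trans hjl.1
      rw [hk, h.B_eq hij hl, hzero, add_zero, add_zero]
    · rw [h.B_eq_of_ne hk, add_zero]

/-- The loop or infinite entry gives monotonicity, and the path from `i` to `j` gives invariance of
reachability. The remaining parts rest on these two. -/
theorem IsRowOp.grow {G H : DirGraph.{u}} {φ : G.Vt ≃ H.Vt} {i j : G.Vt} (h : IsRowOp φ i j)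
    (hij : i ≠ j) (hl : G.vadj i i ≠ 0 ∨ G.vadj i j = ⊤) (hp : MatPath G.vadj i j) : Grow φ := by
  have hvadj : (fun a b => H.vadj (φ a) (φ b)) = rowA G.vadj i j :=
    funext fun a => funext fun b => h a b
  have hpath : ∀ a b, MatPath H.vadj (φ a) (φ b) ↔ MatPath G.vadj a b := fun a b => by
    rw [matPath_comp, hvadj, matPath_rowA_iff hl hp]
  have hreg' : ∀ a, RegularRow H.vadj (φ a) ↔ RegularRow (rowA G.vadj i j) a := fun a => by
    rw [RegularRow, RegularRow, ← φ.forall_congr_right, ← φ.exists_congr_right]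
    simp only [h a _]
  have hreg : ∀ a, H.IsRegular (φ a).1 ↔ G.IsRegular a.1 := fun a => by
    rw [isRegular_iff_vadj, isRegular_iff_vadj, hreg']
    exact ⟨regularRow_of_rowA hl, RegularRow.rowA hl⟩
  refine ⟨fun a b => (le_rowA hl a b).trans (h a b).ge, hpath, hreg, fun a ha => ?_,
    h.mr_eq hij (hl.symm.imp_left fun h => by simp [h]) hp hpath hreg, fun h1 => ?_, fun h2 => ?_⟩
  · rw [h]
    by_cases haj : a = j
    · subst haj
      rw [rowA_target hij.symm]
      -- An edge from `j` to `i` would close the path from `i` to `j`, and the component of `j`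
      -- would not be a single vertex.
      have : G.vadj a i = 0 := by
        by_contra hne
        exact hij (ha i (mem_comp_iff.2 (.inr ⟨.single hne, hp⟩)))
      rw [this, add_zero]
    · rw [rowA_of_ne _ haj]
  · rw [prop1_iff] at *
    have h1' := h1.rowA (i := i) (j := j)
    intro a b c
    obtain ⟨a, rfl⟩ := φ.surjective a
    obtain ⟨b, rfl⟩ := φ.surjective b
    obtain ⟨c, rfl⟩ := φ.surjective c
    rw [h, h]
    exact h1' a b c
  · rw [prop2_iff] at *
    have h2' := h2.rowA hl
    intro a ha
    obtain ⟨a, rfl⟩ := φ.surjective a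
    rw [h]
    exact h2' a ((hreg' a).1 ha)

theorem Grow.refl (G : DirGraph.{u}) : Grow (Equiv.refl G.Vt) :=
  SameData.grow ⟨fun _ _ => rfl, fun _ => rfl⟩

theorem Grow.trans {G H K : DirGraph.{u}} {φ : G.Vt ≃ H.Vt} {ψ : H.Vt ≃ K.Vt} (h : Grow φ)
    (h' : Grow ψ) : Grow (φ.trans ψ) where
  le a b := (h.le a b).trans (h'.le _ _)
  path a b := (h'.path _ _).trans (h.path a b)
  regular a := (h'.regular _).trans (h.regular a)
  loops a ha := by
    refine (h'.loops (φ a) fun b hb => ?_).trans (h.loops a ha)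
    obtain ⟨b, rfl⟩ := φ.surjective b
    rw [ha b (h.mem_comp.1 hb)]
  mr a := (h'.mr _).trans (h.mr a)
  prop1 hG := h'.prop1 (h.prop1 hG)
  prop2 hG := h'.prop2 (h.prop2 hG)

/-! ### Effects of row additions -/

/-- The properties ensured by the first two steps of the algorithm. -/
structure IsReduced (G : DirGraph.{u}) : Prop where
  prop1 : G.Prop1
  prop2 : G.Prop2
  atMostOne : G.AtMostOneRegularSource

theorem IsReduced.isGood {G : DirGraph.{u}} (h : G.IsReduced) : IsGood G.vadj G.D :=
  isGood_vadj h.prop1 h.prop2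

theorem IsReduced.hasLoop_or_top {G : DirGraph.{u}} (h : G.IsReduced) {a b : G.Vt}
    (hab : G.vadj a b ≠ 0) : G.vadj a a ≠ 0 ∨ G.vadj a b = ⊤ :=
  DirGraph.hasLoop_or_top h.isGood.topOrZero h.isGood.loop hab

/-- The properties of a good pair survive the addition, and every good pair belongs to a graph. -/
theorem exists_rowAdd {G : DirGraph.{u}} (hG : G.IsReduced) {i j : G.Vt} (hij : i ≠ j)
    (hl : G.vadj i i ≠ 0 ∨ G.vadj i j = ⊤) : ∃ H, RowAdd G H i j := by
  have hgood := hG.isGood.row hl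
  obtain ⟨H, hH⟩ := exists_represents hgood.loop hgood.one_le hgood.ne_top
  exact ⟨H, (rowAdd_iff hij (hl.symm.imp_left fun h => by simp [h]) hG.atMostOne).2 hH⟩

/-- A permitted row addition: it is basic or improved. -/
def PermittedRowAdd (G H : DirGraph.{u}) (i j : G.Vt) : Prop :=
  BasicRowAdd G H i j ∨ ImprovedRowAdd G H i j

theorem PermittedRowAdd.rowAdd {G H : DirGraph.{u}} {i j : G.Vt} (h : PermittedRowAdd G H i j) :
    RowAdd G H i j := h.elim (fun h => h.2.2.2) fun h => h.2.2.2

theorem PermittedRowAdd.ne {G H : DirGraph.{u}} {i j : G.Vt} (h : PermittedRowAdd G H i j) :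
    i ≠ j := h.elim (fun h => h.1) fun h => h.1

theorem PermittedRowAdd.hasLoop_or_top {G H : DirGraph.{u}} (hG : G.IsReduced) {i j : G.Vt}
    (h : PermittedRowAdd G H i j) : G.vadj i i ≠ 0 ∨ G.vadj i j = ⊤ :=
  h.elim (fun h => hG.hasLoop_or_top ((B_pos_of_ne h.1.symm).1 h.2.1))
    fun h => .inl (hasEdge_iff_vadj.1 h.2.1)

theorem PermittedRowAdd.matPath {G H : DirGraph.{u}} {i j : G.Vt}
    (h : PermittedRowAdd G H i j) : MatPath G.vadj i j :=
  h.elim (fun h => .single ((B_pos_of_ne h.1.symm).1 h.2.1)) fun h => hasPath_iff.1 h.2.2.1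

theorem PermittedRowAdd.moveEquivalent {G H : DirGraph.{u}} (hG : G.IsReduced) {i j : G.Vt}
    (h : PermittedRowAdd G H i j) : MoveEquivalent G H := by
  have hl := h.hasLoop_or_top hG
  have hH : Represents _ _ H :=
    (rowAdd_iff h.ne (hl.symm.imp_left fun h => by simp [h]) hG.atMostOne).1 h.rowAdd
  have hrep := represents_vadj hG.atMostOne
  rcases h with h | h
  · exact dataEquivalent_basic h.1 ((B_pos_of_ne h.1.symm).1 h.2.1) hl _ _ hrep hH
  · exact dataEquivalent_improved (hasPath_iff.1 h.2.2.1) _ _ (fun _ _ h => h) hG.isGood h.1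
      (hasEdge_iff_vadj.1 h.2.1) _ _ hrep hH

theorem PermittedRowAdd.exists_grow {G H : DirGraph.{u}} (hG : G.IsReduced) {i j : G.Vt}
    (h : PermittedRowAdd G H i j) : H.IsReduced ∧ ∃ φ : G.Vt ≃ H.Vt, Grow φ ∧ IsRowOp φ i j := by
  have hl := h.hasLoop_or_top hG
  obtain ⟨hH, φ, hφ, -⟩ :=
    (rowAdd_iff h.ne (hl.symm.imp_left fun h => by simp [h]) hG.atMostOne).1 h.rowAdd
  have hg : Grow φ := IsRowOp.grow hφ h.ne hl h.matPath
  exact ⟨⟨hg.prop1 hG.prop1, hg.prop2 hG.prop2, hH⟩, φ, hg, hφ⟩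

theorem reflTransGen_rowAdd {r : DirGraph.{u} → DirGraph.{u} → Prop}
    (hr : ∀ G H, r G H → ∃ i j, PermittedRowAdd G H i j) {G H : DirGraph.{u}}
    (hG : G.IsReduced) (h : ReflTransGen r G H) :
    H.IsReduced ∧ MoveEquivalent G H ∧ ∃ φ : G.Vt ≃ H.Vt, Grow φ := by
  induction h with
  | refl => exact ⟨hG, .refl, _, Grow.refl G⟩
  | tail _ h ih =>
    obtain ⟨hK, hm, φ, hφ⟩ := ih
    obtain ⟨i, j, hij⟩ := hr _ _ h
    obtain ⟨hL, ψ, hψ, -⟩ := hij.exists_grow hK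
    exact ⟨hL, hm.trans (hij.moveEquivalent hK), _, hφ.trans hψ⟩

/-! ### Preserved properties -/

theorem ncard_comp_eq_one {G : DirGraph.{u}} {i : G.Vt} :
    (G.comp i).ncard = 1 ↔ ∀ b ∈ G.comp i, b = i := by
  constructor
  · intro h b hb
    by_contra hbi
    exact absurd h (one_lt_ncard_comp hb hbi).ne'
  · intro h
    rw [Set.ncard_eq_one]
    exact ⟨i, Set.eq_singleton_iff_unique_mem.2 ⟨self_mem_comp G i, h⟩⟩

theorem prop3_iff {G : DirGraph.{u}} :
    G.Prop3 ↔ ∀ i, (∀ b ∈ G.comp i, b = i) → G.vadj i i < 2 := by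
  refine forall_congr' fun i => ?_
  rw [ncard_comp_eq_one]
  refine forall_congr' fun h => ?_
  have hc : ∀ v, (∃ j ∈ G.comp i, v = j.1) ↔ v = i.1 := fun v =>
    ⟨fun ⟨j, hj, hv⟩ => by rw [hv, h j hj], fun hv => ⟨i, self_mem_comp G i, hv⟩⟩
  simp only [hc]
  rfl

theorem Grow.prop3 {G H : DirGraph.{u}} {φ : G.Vt ≃ H.Vt} (h : Grow φ) (hG : G.Prop3) :
    H.Prop3 := by
  rw [prop3_iff] at *
  intro i hi
  obtain ⟨i, rfl⟩ := φ.surjective i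
  have hi' : ∀ b ∈ G.comp i, b = i := fun b hb => φ.injective (hi _ (h.mem_comp.2 hb))
  rw [h.loops i hi']
  exact hG i hi'

theorem Grow.B_pos {G H : DirGraph.{u}} {φ : G.Vt ≃ H.Vt} (h : Grow φ) {i j : G.Vt}
    (hij : 0 < G.B i j) : 0 < H.B (φ i) (φ j) := B_le_of_vadj_le hij (h.le j i)

theorem Grow.prop4 {G H : DirGraph.{u}} {φ : G.Vt ≃ H.Vt} (h : Grow φ) (hG : G.Prop4) :
    H.Prop4 := by
  intro i hi k hk l hl
  obtain ⟨i, rfl⟩ := φ.surjective i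
  obtain ⟨k, rfl⟩ := φ.surjective k
  obtain ⟨l, rfl⟩ := φ.surjective l
  rw [h.ncard_comp] at hi
  exact h.B_pos (hG i hi k (h.mem_comp.1 hk) l (h.mem_comp.1 hl))

theorem compLE_iff {G : DirGraph.{u}} {i j : G.Vt} :
    G.CompLE i j ↔ MatPath G.vadj j i ∨ G.comp i = G.comp j := or_congr hasPath_iff Iff.rfl

theorem Grow.comp_eq_iff {G H : DirGraph.{u}} {φ : G.Vt ≃ H.Vt} (h : Grow φ) {i j : G.Vt} :
    H.comp (φ i) = H.comp (φ j) ↔ G.comp i = G.comp j := by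
  rw [DirGraph.comp_eq_iff, DirGraph.comp_eq_iff, h.mem_comp]

theorem Grow.prop6 {G H : DirGraph.{u}} {φ : G.Vt ≃ H.Vt} (h : Grow φ) (hG : G.Prop6) :
    H.Prop6 := by
  intro i j
  obtain ⟨i, rfl⟩ := φ.surjective i
  obtain ⟨j, rfl⟩ := φ.surjective j
  rw [compLE_iff, h.path, Ne, h.comp_eq_iff, h.ncard_comp]
  exact fun h1 h2 h3 => h.B_pos (hG i j h1 (compLE_iff.2 h2) h3)

/-- Components with more than one vertex have sufficiently many regular vertices. -/
def IsLarge (G : DirGraph.{u}) : Prop := ∀ i : G.Vt, 1 < (G.comp i).ncard →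
  max 3 (G.mr i + 2) ≤ {j ∈ G.comp i | G.IsRegular j.1}.ncard

theorem Grow.ncard_regular {G H : DirGraph.{u}} {φ : G.Vt ≃ H.Vt} (h : Grow φ) (i : G.Vt) :
    {j ∈ H.comp (φ i) | H.IsRegular j.1}.ncard = {j ∈ G.comp i | G.IsRegular j.1}.ncard := by
  rw [← Set.ncard_image_of_injective _ φ.injective]
  congr 1
  ext x
  obtain ⟨x, rfl⟩ := φ.surjective x
  rw [φ.injective.mem_set_image, Set.mem_ofPred_eq, Set.mem_ofPred_eq, h.mem_comp, h.regular]

theorem Grow.isLarge {G H : DirGraph.{u}} {φ : G.Vt ≃ H.Vt} (h : Grow φ) (hG : G.IsLarge) :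
    H.IsLarge := by
  intro i
  obtain ⟨i, rfl⟩ := φ.surjective i
  rw [h.ncard_comp, h.mr, h.ncard_regular]
  exact hG i

/-! ### Condition (IV) -/

theorem hasPath_getLast {G : DirGraph.{u}} : ∀ (e : G.E) (t : List G.E) (v : G.V),
    (e :: t).IsChain (fun e f => G.r e = G.s f) → (e :: t).getLast?.map G.r = some v →
    G.HasPath (G.s e) v := by
  intro e t
  induction t generalizing e with
  | nil =>
    intro v _ h
    exact .single ⟨e, rfl, by simpa using h⟩
  | cons f t ih =>
    intro v hc h
    rw [List.isChain_cons_cons] at hc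
    rw [List.getLast?_cons_cons] at h
    exact .head ⟨e, rfl, hc.1⟩ (ih f v hc.2 h)

/-- The second vertex of a return path lies in the component of `i`, so here it is `i` itself, where
the path has to stop. -/
theorem IsReturnPath.eq_singleton {G : DirGraph.{u}} {i : G.Vt} (hi : ∀ b ∈ G.comp i, b = i)
    {p : List G.E} (hp : G.IsReturnPath i.1 p) : ∃ e, p = [e] ∧ G.s e = i.1 ∧ G.r e = i.1 := by
  obtain ⟨hc, hh, hg, hv⟩ := hp
  rcases p with _ | ⟨e, _ | ⟨f, t⟩⟩
  · simp at hh
  · exact ⟨e, rfl, by simpa using hh, by simpa using hg⟩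
  · exfalso
    have hse : G.s e = i.1 := by simpa using hh
    rw [List.isChain_cons_cons] at hc
    rw [List.getLast?_cons_cons] at hg
    have h1 : G.HasEdge i.1 (G.r e) := ⟨e, hse, rfl⟩
    have h2 : G.HasPath (G.r e) i.1 := hc.1 ▸ hasPath_getLast f t i.1 hc.2 hg
    have h3 := hi ⟨G.r e, not_isRegularSource_of_hasEdge h1⟩ (.inr ⟨.single h1, h2⟩)
    exact hv e (by simp) (Subtype.ext_iff.1 h3)

/-- For a single-vertex component the only return paths are loops, of which there is at most one by
`Prop3`. For a larger component `Prop4` gives two loops at `i`, which are two different return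
paths. So only the count of regular vertices is left of (IV). -/
theorem condIV_iff {G : DirGraph.{u}} (h3 : G.Prop3) (h4 : G.Prop4) (i : G.Vt) :
    G.CondIV i ↔ (1 < (G.comp i).ncard →
      max 3 (G.mr i + 2) ≤ {j ∈ G.comp i | G.IsRegular j.1}.ncard) := by
  constructor
  · intro h hi
    refine (h ?_).2
    have h2 : 1 < G.vadj i i := lt_of_lt_of_le (by norm_num)
      (B_self_pos.1 (h4 i hi i (self_mem_comp G i) i (self_mem_comp G i)))
    obtain ⟨e, f, he, hf, hef⟩ := Set.one_lt_encard_iff.1 h2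
    refine ⟨[e], [f], by simpa using hef, ⟨by simp, by simpa using he.1, by simpa using he.2,
      by simp⟩, ⟨by simp, by simpa using hf.1, by simpa using hf.2, by simp⟩⟩
  · rintro h ⟨p, q, hpq, hp, hq⟩
    have hi : 1 < (G.comp i).ncard := by
      by_contra hi
      have hi1 : (G.comp i).ncard = 1 := le_antisymm (not_lt.1 hi) (ncard_comp_pos G i)
      have hi' := ncard_comp_eq_one.1 hi1
      obtain ⟨e, rfl, he⟩ := hp.eq_singleton hi'
      obtain ⟨f, rfl, hf⟩ := hq.eq_singleton hi'
      have hef : e ≠ f := fun h => hpq (by rw [h])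
      have h2 : 1 < G.vadj i i := Set.one_lt_encard_iff.2 ⟨e, f, he, hf, hef⟩
      exact absurd (prop3_iff.1 h3 i hi') (not_lt.2 (Order.add_one_le_of_lt h2))
    exact ⟨B_self_pos.1 (h4 i hi i (self_mem_comp G i) i (self_mem_comp G i)), h hi⟩

theorem forall_condIV_iff {G : DirGraph.{u}} (h3 : G.Prop3) (h4 : G.Prop4) :
    (∀ i, G.CondIV i) ↔ G.IsLarge := forall_congr' fun i => condIV_iff h3 h4 i

/-! ### The number of entries of `B` that are not positive -/

/-- The positions of the entries of `B` that are not positive. -/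
def nonposEntries (G : DirGraph.{u}) : Set (G.Vt × G.Vt) := {p | ¬ 0 < G.B p.1 p.2}

theorem Grow.nonposEntries_le {G H : DirGraph.{u}} {φ : G.Vt ≃ H.Vt} (h : Grow φ) :
    H.nonposEntries.ncard ≤ G.nonposEntries.ncard := by
  refine Set.ncard_le_ncard_of_injOn (fun p => (φ.symm p.1, φ.symm p.2)) (fun p hp hpos => ?_)
    (fun p _ q _ hpq => ?_)
  · have := h.B_pos hpos
    rw [φ.apply_symm_apply, φ.apply_symm_apply] at this
    exact hp this
  · simpa [Prod.ext_iff] using hpq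

theorem Grow.nonposEntries_lt {G H : DirGraph.{u}} {φ : G.Vt ≃ H.Vt} (h : Grow φ) {a b : G.Vt}
    (hG : ¬ 0 < G.B a b) (hH : 0 < H.B (φ a) (φ b)) :
    H.nonposEntries.ncard < G.nonposEntries.ncard := by
  refine ncard_lt_of_injOn (b := (a, b)) (fun p => (φ.symm p.1, φ.symm p.2))
    (fun p hp => ⟨fun hpos => ?_, fun hpab => ?_⟩) (fun p _ q _ hpq => ?_) hG
  · have := h.B_pos hpos
    rw [φ.apply_symm_apply, φ.apply_symm_apply] at this
    exact hp this
  · rw [Prod.mk.injEq, φ.symm_apply_eq, φ.symm_apply_eq] at hpab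
    rw [← hpab.1, ← hpab.2] at hH
    exact hp hH
  · simpa [Prod.ext_iff] using hpq

theorem IsRowOp.vadj_target {G H : DirGraph.{u}} {φ : G.Vt ≃ H.Vt} {i j : G.Vt}
    (h : IsRowOp φ i j) {a : G.Vt} (ha : a ≠ i) :
    H.vadj (φ a) (φ j) = G.vadj a j + G.vadj a i := (h a j).trans (rowA_target ha)

/-- This is the progress made by repairing a failure of transitivity `l → m → x`: the edges from `l`
to `m` are added to those from `l` to `x`. -/
theorem IsRowOp.B_pos_of_not_edge {G H : DirGraph.{u}} (hG : G.IsReduced) {φ : G.Vt ≃ H.Vt}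
    {l m x : G.Vt} (h : IsRowOp φ m x) (hlm : G.vadj l m ≠ 0) (hmx : G.vadj m x ≠ 0)
    (hlx : G.vadj l x = 0) : 0 < H.B (φ x) (φ l) := by
  have hne : l ≠ m := fun h => hmx (h ▸ hlx)
  have hv := h.vadj_target hne
  rw [hlx, zero_add] at hv
  by_cases hxl : x = l
  · subst hxl
    -- On the diagonal two loops are required. As `l` has none yet, it emits infinitely many edges
    -- to `m`.
    rw [B_self_pos, hv, (hG.hasLoop_or_top hlm).resolve_left (not_not.2 hlx)]
    exact le_top
  · rw [B_pos_of_ne (φ.injective.ne hxl), hv]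
    exact hlm

theorem not_B_pos_of_vadj_eq_zero {G : DirGraph.{u}} {i j : G.Vt} (h : G.vadj j i = 0) :
    ¬ 0 < G.B i j := fun hp => hasEdge_of_B_pos hp h

/-! ### Carrying out row additions -/

/-- The column condition of a basic row addition is automatic here: with a loop at `i` no entry of
the column is negative, and without one the entry at `j` is infinite and absorbs the `-1`. -/
theorem finsum_B_pos {G : DirGraph.{u}} (hG : G.IsReduced) {i j : G.Vt} (hij : i ≠ j)
    (h : G.vadj i j ≠ 0) : 0 < ∑ᶠ k, G.B k i := by
  classical
  have := Fintype.ofFinite G.Vt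
  rw [finsum_eq_sum_of_fintype]
  rcases hG.hasLoop_or_top h with hl | hl
  · have hnn : ∀ k, 0 ≤ G.B k i := by
      intro k
      by_cases hk : k = i
      · subst hk
        have := enatMap_natCast_nonneg (G.vadj k k - 1)
        rwa [enatMap_sub_one hl, ← B_self] at this
      · rw [B_eq_of_ne hk]
        exact enatMap_natCast_nonneg _
    exact lt_of_lt_of_le ((B_pos_of_ne hij.symm).2 h)
      (Finset.single_le_sum (f := fun k => G.B k i) (fun k _ => hnn k) (Finset.mem_univ j))
  · have : ∑ k, G.B k i = ⊤ := by
      refine WithTop.sum_eq_top.2 ⟨j, Finset.mem_univ j, ?_⟩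
      rw [B_eq_of_ne hij.symm, hl]
      rfl
    rw [this]
    exact WithTop.coe_lt_top 0

theorem exists_basicRowAdd {G : DirGraph.{u}} (hG : G.IsReduced) {i j : G.Vt} (hij : i ≠ j)
    (h : G.vadj i j ≠ 0) : ∃ H, BasicRowAdd G H i j := by
  obtain ⟨H, hH⟩ := exists_rowAdd hG hij (hG.hasLoop_or_top h)
  exact ⟨H, hij, (B_pos_of_ne hij.symm).2 h, finsum_B_pos hG hij h, hH⟩

theorem exists_improvedRowAdd {G : DirGraph.{u}} (hG : G.IsReduced) {i j : G.Vt} (hij : i ≠ j)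
    (h : G.vadj i i ≠ 0) (hp : MatPath G.vadj i j) : ∃ H, ImprovedRowAdd G H i j := by
  obtain ⟨H, hH⟩ := exists_rowAdd hG hij (.inl h)
  exact ⟨H, hij, hasEdge_iff_vadj.2 h, hasPath_iff.2 hp, hH⟩

theorem BasicRowAdd.exists_grow {G H : DirGraph.{u}} (hG : G.IsReduced) {l m x : G.Vt}
    (h : BasicRowAdd G H m x) (hlm : G.vadj l m ≠ 0) (hlx : G.vadj l x = 0) :
    H.IsReduced ∧ (∃ φ : G.Vt ≃ H.Vt, Grow φ) ∧
      H.nonposEntries.ncard < G.nonposEntries.ncard := by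
  obtain ⟨hH, φ, hφ, hφ'⟩ := PermittedRowAdd.exists_grow hG (.inl h)
  have hmx : G.vadj m x ≠ 0 := (B_pos_of_ne h.1.symm).1 h.2.1
  exact ⟨hH, ⟨φ, hφ⟩, hφ.nonposEntries_lt (not_B_pos_of_vadj_eq_zero hlx)
    (hφ'.B_pos_of_not_edge hG hlm hmx hlx)⟩

/-- The first vertex after `l` on the path receives an edge from `l`, the last does not, so
somewhere a vertex that does is followed by one that does not. -/
theorem MatPath.exists_not_trans {ι : Type*} {A : ι → ι → ℕ∞} {l k : ι} (h : MatPath A l k)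
    (hlk : A l k = 0) : ∃ m x, A l m ≠ 0 ∧ A m x ≠ 0 ∧ A l x = 0 := by
  induction h with
  | single h => exact absurd hlk h
  | @tail m x _ hmx ih =>
    by_cases hm : A l m = 0
    · exact ih hm
    · exact ⟨m, x, hm, hmx, hlk⟩

theorem exists_rowAdd_of_matPath {G : DirGraph.{u}} (hG : G.IsReduced) {l k : G.Vt}
    (h : MatPath G.vadj l k) (hlk : G.vadj l k = 0) :
    ∃ H, (∃ i j, PermittedRowAdd G H i j) ∧ H.IsReduced ∧
      H.nonposEntries.ncard < G.nonposEntries.ncard := by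
  obtain ⟨m, x, hlm, hmx, hlx⟩ := h.exists_not_trans hlk
  have hmx' : m ≠ x := fun h => hlm (h ▸ hlx)
  obtain ⟨H, hH⟩ := exists_basicRowAdd hG hmx' hmx
  obtain ⟨h1, -, h3⟩ := hH.exists_grow hG hlm hlx
  exact ⟨H, ⟨m, x, .inl hH⟩, h1, h3⟩

/-- A missing edge inside a component is a failure of transitivity along some path, and repairing it
is progress. When no edge is missing, a nonpositive entry can only be diagonal, at a vertex with one
loop. -/
theorem exists_rowAdd_of_not_prop4 {G : DirGraph.{u}} (hG : G.IsReduced) (h4 : ¬ G.Prop4) :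
    ∃ H, (∃ i j, PermittedRowAdd G H i j) ∧ H.IsReduced ∧
      H.nonposEntries.ncard < G.nonposEntries.ncard := by
  rw [Prop4] at h4
  push Not at h4
  obtain ⟨i, hi, k, hk, l, hl, hkl⟩ := h4
  have hli : G.comp i = G.comp l := comp_eq_iff.2 hl
  rw [hli] at hi hk
  by_cases hlk : G.vadj l k = 0
  · exact exists_rowAdd_of_matPath hG (matPath_of_mem_comp hi hk) hlk
  have hkl' : k = l := by
    by_contra hne
    exact hkl.not_gt ((B_pos_of_ne hne).2 hlk)
  subst hkl'
  obtain ⟨m, hm, hmk⟩ := exists_ne_mem_comp hi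
  have hpath := (mem_comp_iff.1 hm).resolve_left hmk
  by_cases hkm : G.vadj k m = 0
  · exact exists_rowAdd_of_matPath hG hpath.1 hkm
  by_cases hmk0 : G.vadj m k = 0
  · exact exists_rowAdd_of_matPath hG hpath.2 hmk0
  -- There are edges from `k` to `k` and from `k` to `m`, so after adding row `m` to row `k` there
  -- are at least two loops at `k`.
  obtain ⟨H, hH⟩ := exists_basicRowAdd hG hmk hmk0
  obtain ⟨hH', φ, hφ, hφ'⟩ := PermittedRowAdd.exists_grow hG (.inl hH)
  refine ⟨H, ⟨m, k, .inl hH⟩, hH', hφ.nonposEntries_lt hkl.not_gt ?_⟩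
  rw [B_self_pos, hφ'.vadj_target hmk.symm, ← one_add_one_eq_two]
  exact add_le_add (Order.one_le_iff_ne_zero.2 hlk) (Order.one_le_iff_ne_zero.2 hkm)

theorem exists_prop4 {G : DirGraph.{u}} (hG : G.IsReduced) :
    ∃ H, ReflTransGen (fun G H => ∃ i j, BasicRowAdd G H i j ∨ ImprovedRowAdd G H i j) G H ∧
      H.Prop4 := by
  obtain ⟨H, h, -, h'⟩ := exists_reflTransGen_of_decreasing
    (r := fun G H => ∃ i j, PermittedRowAdd G H i j) (fun G => G.nonposEntries.ncard)
    (fun G hG => exists_rowAdd_of_not_prop4 hG) G hG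
  exact ⟨H, h, h'⟩

/-- Two loops at `j` outweigh the subtracted one: adding row `j` to row `i` leaves `vadj j i + vadj
j j - 1 ≥ 1` edges from `j` to `i`. -/
theorem exists_prop6 {G : DirGraph.{u}} (hG : G.IsReduced) (h4 : G.Prop4) :
    ∃ H, ReflTransGen (fun G H => ∃ i j, ImprovedRowAdd G H i j) G H ∧ H.Prop6 := by
  obtain ⟨H, h, -, h'⟩ := exists_reflTransGen_of_decreasing
    (r := fun G H => ∃ i j, ImprovedRowAdd G H i j) (fun G => G.nonposEntries.ncard)
    (I := fun G => G.IsReduced ∧ G.Prop4) (T := Prop6) (fun G ⟨hG, h4⟩ h6 => by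
      rw [Prop6] at h6
      push Not at h6
      obtain ⟨i, j, hne, hle, hj, hB⟩ := h6
      have hp : MatPath G.vadj j i := (compLE_iff.1 hle).resolve_right hne
      have hij : i ≠ j := fun h => hne (h ▸ rfl)
      have hloop := B_self_pos.1 (h4 j hj j (self_mem_comp G j) j (self_mem_comp G j))
      have hloop' : G.vadj j j ≠ 0 := fun h0 => by simp [h0] at hloop
      obtain ⟨H, hH⟩ := exists_improvedRowAdd hG hij.symm hloop' hp
      obtain ⟨hH', φ, hφ, hφ'⟩ := PermittedRowAdd.exists_grow hG (.inr hH)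
      refine ⟨H, ⟨j, i, hH⟩, ⟨hH', hφ.prop4 h4⟩, hφ.nonposEntries_lt hB.not_gt ?_⟩
      rw [B_pos_of_ne (φ.injective.ne hij), hφ' j i, rowA_self, enat_add_sub_one _ hloop']
      intro h0
      have h1 : G.vadj j j ≤ 1 := tsub_eq_zero_iff_le.1 (add_eq_zero.1 h0).2
      exact absurd (hloop.trans h1) (by norm_num)) G ⟨hG, h4⟩
  exact ⟨H, h, h'⟩

/-- A remaining zero at `(i, j)` means, by `Prop6`, that the component of `j` is a single vertex. It
emits an edge to some `k ≠ i` in the component of `i`; there `k` has loops and a path to `i`, and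
adding row `k` to row `i` yields an edge from `j` to `i`. -/
theorem exists_prop7 {G : DirGraph.{u}} (hG : G.IsReduced) (h4 : G.Prop4) (h6 : G.Prop6) :
    ∃ H, ReflTransGen (fun G H => ∃ i j, ImprovedRowAdd G H i j) G H ∧ H.Prop7 := by
  obtain ⟨H, h, -, h'⟩ := exists_reflTransGen_of_decreasing
    (r := fun G H => ∃ i j, ImprovedRowAdd G H i j) (fun G => G.nonposEntries.ncard)
    (I := fun G => G.IsReduced ∧ G.Prop4 ∧ G.Prop6) (T := Prop7) (fun G ⟨hG, h4, h6⟩ h7 => by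
      rw [Prop7] at h7
      push Not at h7
      obtain ⟨i, j, hne, hle, ⟨k, hk, l, hl, hkl⟩, hB⟩ := h7
      have hj : ∀ b ∈ G.comp j, b = j := fun b hb => by
        by_contra hbj
        exact hB.not_gt (h6 i j hne hle (one_lt_ncard_comp hb hbj))
      rw [hj l hl] at hkl
      have hik : G.comp i = G.comp k := comp_eq_iff.2 hk
      have hkj : k ≠ j := fun h => hne (hik.trans (h ▸ rfl))
      have hij : i ≠ j := fun h => hne (h ▸ rfl)
      have hjk : G.vadj j k ≠ 0 := fun h0 => hkl (by rw [B_eq_of_ne hkj, h0]; simp)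
      have hki : k ≠ i := by
        rintro rfl
        exact hB.not_gt ((B_pos_of_ne hkj).2 hjk)
      have hi : 1 < (G.comp i).ncard := one_lt_ncard_comp hk hki
      have hloop : G.vadj k k ≠ 0 := hasEdge_of_B_pos (h4 i hi k hk k hk)
      have hp : MatPath G.vadj k i := ((mem_comp_iff.1 hk).resolve_left hki).2
      obtain ⟨H, hH⟩ := exists_improvedRowAdd hG hki hloop hp
      obtain ⟨hH', φ, hφ, hφ'⟩ := PermittedRowAdd.exists_grow hG (.inr hH)
      refine ⟨H, ⟨k, i, hH⟩, ⟨hH', hφ.prop4 h4, hφ.prop6 h6⟩, hφ.nonposEntries_lt hB.not_gt ?_⟩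
      rw [B_pos_of_ne (φ.injective.ne hij), hφ'.vadj_target hkj.symm]
      exact fun h0 => hjk (add_eq_zero.1 h0).2) G ⟨hG, h4, h6⟩
  exact ⟨H, h, h'⟩

/-! ### Outsplitting into classes that contain loops -/

/-- The vertex of which a vertex of an outsplit graph is a copy. -/
def copyOf {ι : Type*} (w : ι) (n : ℕ) : {a // a ≠ w} ⊕ Fin n → ι := Sum.elim Subtype.val fun _ => w

/-- `H` arises from `G` by outsplitting at `w` into classes of which the `j`th contains `α j b`
edges to `b`, and at least one loop. -/
structure LoopSplit {G H : DirGraph.{u}} (w : G.Vt) {n : ℕ} (α : Fin n → G.Vt → ℕ∞)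
    (e : {a : G.Vt // a ≠ w} ⊕ Fin n ≃ H.Vt) : Prop where
  pos : 0 < n
  old : ∀ a y, H.vadj (e (.inl a)) (e y) = G.vadj a.1 (copyOf w n y)
  new : ∀ j y, H.vadj (e (.inr j)) (e y) = α j (copyOf w n y)
  sum : ∀ b, ∑ j, α j b = G.vadj w b
  loop : ∀ j, α j w ≠ 0

namespace LoopSplit

variable {G H : DirGraph.{u}} {w : G.Vt} {n : ℕ} {α : Fin n → G.Vt → ℕ∞}
  {e : {a : G.Vt // a ≠ w} ⊕ Fin n ≃ H.Vt}

theorem le (h : LoopSplit w α e) (j : Fin n) (b : G.Vt) : α j b ≤ G.vadj w b := by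
  rw [← h.sum b]
  exact Finset.single_le_sum (f := fun j => α j b) (fun _ _ => bot_le) (Finset.mem_univ j)

theorem vadj_self_ne_zero (h : LoopSplit w α e) : G.vadj w w ≠ 0 := fun h0 =>
  h.loop ⟨0, h.pos⟩ (le_antisymm (h0 ▸ h.le _ w) bot_le)

theorem copyOf_surjective (h : LoopSplit w α e) : Function.Surjective (copyOf w n) := fun v => by
  by_cases hv : v = w
  · exact ⟨.inr ⟨0, h.pos⟩, hv.symm⟩
  · exact ⟨.inl ⟨v, hv⟩, rfl⟩

theorem vadj_ne_zero (h : LoopSplit w α e) {x y : {a : G.Vt // a ≠ w} ⊕ Fin n}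
    (hxy : H.vadj (e x) (e y) ≠ 0) : G.vadj (copyOf w n x) (copyOf w n y) ≠ 0 := by
  rcases x with x | j
  · rwa [h.old] at hxy
  · rw [h.new] at hxy
    exact fun h0 => hxy (le_antisymm (h0 ▸ h.le _ _) bot_le)

/-- A given copy of `w` may not emit a copy of the edge wanted, but some copy does, and the loop in
each class provides edges between any two copies. -/
theorem matPath_of_vadj (h : LoopSplit w α e) {x y : {a : G.Vt // a ≠ w} ⊕ Fin n}
    (hxy : G.vadj (copyOf w n x) (copyOf w n y) ≠ 0) : MatPath H.vadj (e x) (e y) := by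
  rcases x with x | j
  · exact .single (by rwa [h.old])
  · have : ∃ j', α j' (copyOf w n y) ≠ 0 := by
      by_contra! hne
      exact hxy ((h.sum _).symm.trans (Finset.sum_eq_zero fun j _ => hne j))
    obtain ⟨j', hj'⟩ := this
    have h1 : H.vadj (e (.inr j)) (e (.inr j')) ≠ 0 := by
      rw [h.new]
      exact h.loop j
    have h2 : H.vadj (e (.inr j')) (e y) ≠ 0 := by rwa [h.new]
    exact .head h1 (.single h2)

theorem matPath_iff (h : LoopSplit w α e) {x y : {a : G.Vt // a ≠ w} ⊕ Fin n} :
    MatPath H.vadj (e x) (e y) ↔ MatPath G.vadj (copyOf w n x) (copyOf w n y) := by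
  constructor
  · intro hp
    have := TransGen.lift (r := fun a b => H.vadj a b ≠ 0) (p := fun a b => G.vadj a b ≠ 0)
      (fun v => copyOf w n (e.symm v)) (fun a b hab => by
        obtain ⟨a, rfl⟩ := e.surjective a
        obtain ⟨b, rfl⟩ := e.surjective b
        simpa [Function.onFun] using h.vadj_ne_zero hab) _ _ hp
    simpa [Function.onFun, MatPath] using this
  · suffices ∀ a b, MatPath G.vadj a b → ∀ x y, copyOf w n x = a → copyOf w n y = b →
        MatPath H.vadj (e x) (e y) from fun hp => this _ _ hp x y rfl rfl
    intro a b hp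
    induction hp with
    | single hab =>
      rintro x y rfl rfl
      exact h.matPath_of_vadj hab
    | @tail b c _ hbc ih =>
      rintro x y rfl rfl
      obtain ⟨z, rfl⟩ := h.copyOf_surjective b
      exact (ih x z rfl rfl).trans (h.matPath_of_vadj hbc)

theorem mem_comp (h : LoopSplit w α e) {x y : {a : G.Vt // a ≠ w} ⊕ Fin n} :
    e y ∈ H.comp (e x) ↔ copyOf w n y ∈ G.comp (copyOf w n x) := by
  rw [mem_comp_iff, mem_comp_iff, h.matPath_iff, h.matPath_iff, e.injective.eq_iff]
  refine ⟨Or.imp_left fun hxy => hxy ▸ rfl, ?_⟩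
  rintro (hxy | hxy)
  · rcases x with x | j <;> rcases y with y | k
    · exact .inl (congrArg Sum.inl (Subtype.ext hxy))
    · exact absurd hxy.symm x.2
    · exact absurd hxy y.2
    · exact .inr ⟨.single h.vadj_self_ne_zero, .single h.vadj_self_ne_zero⟩
  · exact .inr hxy

theorem comp_eq_iff (h : LoopSplit w α e) {x y : {a : G.Vt // a ≠ w} ⊕ Fin n} :
    H.comp (e x) = H.comp (e y) ↔ G.comp (copyOf w n x) = G.comp (copyOf w n y) := by
  rw [DirGraph.comp_eq_iff, DirGraph.comp_eq_iff, h.mem_comp]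

/-- The component loses `w` and gains all `n` copies, which are mutually connected. -/
theorem ncard_comp (h : LoopSplit w α e) {x : {a : G.Vt // a ≠ w} ⊕ Fin n}
    (hw : w ∈ G.comp (copyOf w n x)) :
    (H.comp (e x)).ncard + 1 = (G.comp (copyOf w n x)).ncard + n := by
  have h1 : H.comp (e x) = e '' (Sum.inl '' (Subtype.val ⁻¹' G.comp (copyOf w n x)) ∪
      Set.range Sum.inr) := by
    ext y
    obtain ⟨y, rfl⟩ := e.surjective y
    rw [h.mem_comp, e.injective.mem_set_image]
    rcases y with y | j
    · simp [copyOf]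
    · simpa [copyOf] using hw
  have h2 : Subtype.val '' (Subtype.val ⁻¹' G.comp (copyOf w n x) : Set {a : G.Vt // a ≠ w}) =
      G.comp (copyOf w n x) \ {w} := by
    ext a
    simp [and_comm]
  rw [h1, Set.ncard_image_of_injective _ e.injective, Set.ncard_union_eq,
    Set.ncard_image_of_injective _ Sum.inl_injective,
    ← Set.ncard_image_of_injective _ Subtype.val_injective, h2, ← Set.image_univ,
    Set.ncard_image_of_injective _ Sum.inr_injective, Set.ncard_univ, Nat.card_fin,
    add_right_comm, Set.ncard_sdiff_singleton_add_one hw]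
  rw [Set.disjoint_left]
  rintro _ ⟨a, _, rfl⟩ ⟨b, hb⟩
  exact absurd hb (by simp)

theorem isRegular_old (h : LoopSplit w α e) (a : {a : G.Vt // a ≠ w}) :
    H.IsRegular (e (.inl a)).1 ↔ G.IsRegular a.1.1 := by
  rw [isRegular_iff_vadj, isRegular_iff_vadj, RegularRow, RegularRow, ← e.forall_congr_right,
    ← e.exists_congr_right]
  simp only [h.old, ← h.copyOf_surjective.forall (p := fun v => G.vadj a.1 v ≠ ⊤),
    ← h.copyOf_surjective.exists (p := fun v => G.vadj a.1 v ≠ 0)]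

theorem isRegular_new (h : LoopSplit w α e) (j : Fin n) :
    H.IsRegular (e (.inr j)).1 ↔ ∀ b, α j b ≠ ⊤ := by
  rw [isRegular_iff_vadj, RegularRow, ← e.forall_congr_right, ← e.exists_congr_right]
  simp only [h.new, ← h.copyOf_surjective.forall (p := fun v => α j v ≠ ⊤),
    ← h.copyOf_surjective.exists (p := fun v => α j v ≠ 0)]
  exact and_iff_left ⟨w, h.loop j⟩

theorem isRegular_iff (h : LoopSplit w α e) : G.IsRegular w.1 ↔ ∀ j b, α j b ≠ ⊤ := by
  rw [isRegular_iff_vadj, RegularRow, and_iff_left ⟨w, h.vadj_self_ne_zero⟩]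
  simp only [← h.sum, ENat.sum_ne_top, Finset.mem_univ, true_imp_iff]
  exact forall_comm

open Classical in
/-- The inclusion of the vertices of the original graph, mapping `w` to the copy `j`. -/
noncomputable def lift (w : G.Vt) (j : Fin n) (b : G.Vt) : {a : G.Vt // a ≠ w} ⊕ Fin n :=
  if h : b = w then .inr j else .inl ⟨b, h⟩

theorem lift_self (j : Fin n) : lift w j w = .inr j := by simp [lift]

theorem lift_of_ne (j : Fin n) {b : G.Vt} (h : b ≠ w) : lift w j b = .inl ⟨b, h⟩ := by
  simp [lift, h]

theorem copyOf_lift (j : Fin n) (b : G.Vt) : copyOf w n (lift w j b) = b := by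
  by_cases h : b = w
  · rw [h, lift_self]
    rfl
  · rw [lift_of_ne j h]
    rfl

theorem lift_injective (j : Fin n) : Function.Injective (lift w j) := fun a b hab => by
  rw [← copyOf_lift j a, hab, copyOf_lift]

theorem injective_lift (e : {a : G.Vt // a ≠ w} ⊕ Fin n ≃ H.Vt) (j : Fin n) :
    Function.Injective fun a => e (lift w j a) := e.injective.comp (lift_injective j)

theorem lift_copyOf {j k : Fin n} (hall : ∀ i, i = j ∨ i = k) {y : {a : G.Vt // a ≠ w} ⊕ Fin n}
    (hy : y ≠ .inr k) : lift w j (copyOf w n y) = y := by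
  rcases y with y | i
  · exact lift_of_ne j y.2
  · rw [(hall i).resolve_right fun hi => hy (hi ▸ rfl)]
    exact lift_self j

/-- The regular vertices of the component containing `w` after splitting into two. -/
theorem ncard_regular (h : LoopSplit w α e) {j k : Fin n} (hjk : j ≠ k)
    (hall : ∀ i, i = j ∨ i = k) (hfin : ∀ b, α k b ≠ ⊤)
    {x : {a : G.Vt // a ≠ w} ⊕ Fin n} (hw : w ∈ G.comp (copyOf w n x)) :
    {v ∈ H.comp (e x) | H.IsRegular v.1}.ncard =
      {a ∈ G.comp (copyOf w n x) | G.IsRegular a.1}.ncard + 1 := by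
  -- Copy `k` is the additional regular vertex. Copy `j` replaces `w`: as class `k` is finite, `j`
  -- is regular exactly when `w` is.
  have hset : {v ∈ H.comp (e x) | H.IsRegular v.1} = insert (e (.inr k))
      ((fun a => e (lift w j a)) '' {a ∈ G.comp (copyOf w n x) | G.IsRegular a.1}) := by
    ext v
    obtain ⟨y, rfl⟩ := e.surjective v
    rw [Set.mem_ofPred_eq, h.mem_comp, Set.mem_insert_iff, e.injective.eq_iff]
    by_cases hy : y = .inr k
    · subst hy
      exact iff_of_true ⟨hw, (h.isRegular_new k).2 hfin⟩ (.inl rfl)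
    · rw [or_iff_right hy]
      have hreg : H.IsRegular (e y).1 ↔ G.IsRegular (copyOf w n y).1 := by
        rcases y with y | i
        · exact h.isRegular_old y
        · rw [(hall i).resolve_right fun hi => hy (hi ▸ rfl), h.isRegular_new]
          refine Iff.trans ?_ h.isRegular_iff.symm
          exact ⟨fun hj i => (hall i).elim (fun hi => hi ▸ hj) fun hi => hi ▸ hfin,
            fun hj => hj j⟩
      rw [hreg]
      constructor
      · exact fun hy' => ⟨_, hy', congrArg e (lift_copyOf hall hy)⟩
      · rintro ⟨a, ha, hay⟩
        rw [← e.injective hay, copyOf_lift]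
        exact ha
  rw [hset, Set.ncard_insert_of_notMem, Set.ncard_image_of_injective _
    (injective_lift e j)]
  rintro ⟨a, _, hay⟩
  have hay := e.injective hay
  by_cases haw : a = w
  · rw [haw, lift_self] at hay
    exact hjk (Sum.inr_injective hay)
  · rw [lift_of_ne j haw] at hay
    exact absurd hay (by simp)

theorem comp_image (h : LoopSplit w α e) {x : {a : G.Vt // a ≠ w} ⊕ Fin n}
    (hw : w ∉ G.comp (copyOf w n x)) (j : Fin n) (v : H.Vt) :
    v ∈ H.comp (e x) ↔ ∃ a ∈ G.comp (copyOf w n x), e (lift w j a) = v := by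
  obtain ⟨y, rfl⟩ := e.surjective v
  rw [h.mem_comp]
  constructor
  · intro hy
    refine ⟨_, hy, ?_⟩
    rcases y with y | i
    · exact congrArg e (lift_of_ne j y.2)
    · exact absurd hy hw
  · rintro ⟨a, ha, hay⟩
    rw [← e.injective hay, copyOf_lift]
    exact ha

/-- The component of a vertex is not affected if it does not contain `w`. -/
theorem ncard_regular_of_notMem (h : LoopSplit w α e) {x : {a : G.Vt // a ≠ w} ⊕ Fin n}
    (hw : w ∉ G.comp (copyOf w n x)) :
    {v ∈ H.comp (e x) | H.IsRegular v.1}.ncard =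
      {a ∈ G.comp (copyOf w n x) | G.IsRegular a.1}.ncard := by
  let j : Fin n := ⟨0, h.pos⟩
  have hset : {v ∈ H.comp (e x) | H.IsRegular v.1} =
      (fun a => e (lift w j a)) '' {a ∈ G.comp (copyOf w n x) | G.IsRegular a.1} := by
    ext v
    rw [Set.mem_ofPred_eq, h.comp_image hw j]
    constructor
    · rintro ⟨⟨a, ha, rfl⟩, hr⟩
      refine ⟨a, ⟨ha, ?_⟩, rfl⟩
      have haw : a ≠ w := fun h => hw (h ▸ ha)
      rw [lift_of_ne j haw] at hr
      exact (h.isRegular_old _).1 hr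
    · rintro ⟨a, ⟨ha, hr⟩, rfl⟩
      refine ⟨⟨a, ha, rfl⟩, ?_⟩
      have haw : a ≠ w := fun h => hw (h ▸ ha)
      simp only [lift_of_ne j haw]
      exact (h.isRegular_old _).2 hr
  rw [hset, Set.ncard_image_of_injective _ (injective_lift e j)]

theorem mr_eq_of_notMem (h : LoopSplit w α e) {x : {a : G.Vt // a ≠ w} ⊕ Fin n}
    (hw : w ∉ G.comp (copyOf w n x)) : H.mr (e x) = G.mr (copyOf w n x) := by
  classical
  let j : Fin n := ⟨0, h.pos⟩
  have hne : ∀ a ∈ G.comp (copyOf w n x), a ≠ w := fun a ha h => hw (h ▸ ha)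
  let ρ : G.comp (copyOf w n x) ≃ H.comp (e x) := Equiv.ofBijective
    (fun a => ⟨e (lift w j a.1), (h.comp_image hw j _).2 ⟨a.1, a.2, rfl⟩⟩) ⟨fun a b hab => by
      exact Subtype.ext (lift_injective j (e.injective (Subtype.ext_iff.1 hab))), fun v => by
      obtain ⟨a, ha, hv⟩ := (h.comp_image hw j _).1 v.2
      exact ⟨⟨a, ha⟩, Subtype.ext hv⟩⟩
  have hρ : ∀ a, (ρ a).1 = e (.inl ⟨a.1, hne a.1 a.2⟩) := fun a =>
    congrArg e (lift_of_ne j (hne a.1 a.2))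
  refine mr_eq_of_equiv ρ 0 (fun _ => rfl) (fun l => ?_) fun l k _ => ?_
  · rw [hρ]
    exact h.isRegular_old _
  · have hB : H.B (ρ k).1 (ρ l).1 = G.B k.1 l.1 := by
      rw [B_eq, B_eq, hρ, hρ, h.old]
      simp only [e.injective.eq_iff, Sum.inl.injEq, Subtype.mk.injEq]
      rfl
    simp [blockCol, hB]

/-- The column of the regular copy `k` is the pullback of `α k` minus the basis vector at `k`, so it
makes the new generator redundant. If `w` is regular, the columns of the two copies add up to the
pullback of the column of `w`, and otherwise neither `w` nor `j` contributes a column. Old columns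
are pulled back. -/
theorem mr_eq_of_mem (h : LoopSplit w α e) {j k : Fin n} (hjk : j ≠ k)
    (hall : ∀ i, i = j ∨ i = k) (hfin : ∀ b, α k b ≠ ⊤)
    {x : {a : G.Vt // a ≠ w} ⊕ Fin n} (hw : w ∈ G.comp (copyOf w n x)) :
    H.mr (e x) = G.mr (copyOf w n x) := by
  classical
  let p : H.comp (e x) → G.comp (copyOf w n x) := fun v => ⟨copyOf w n (e.symm v.1), by
    rw [← h.mem_comp, e.apply_symm_apply]
    exact v.2⟩
  let q : G.comp (copyOf w n x) → H.comp (e x) := fun a => ⟨e (lift w j a.1), by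
    rw [h.mem_comp, copyOf_lift]
    exact a.2⟩
  let vj : H.comp (e x) := ⟨e (.inr j), h.mem_comp.2 hw⟩
  let vk : H.comp (e x) := ⟨e (.inr k), h.mem_comp.2 hw⟩
  let w' : G.comp (copyOf w n x) := ⟨w, hw⟩
  have hpq : ∀ a, p (q a) = a := fun a => Subtype.ext (by simp [p, q, copyOf_lift])
  have hqp : ∀ v, v ≠ vk → q (p v) = v := fun v hv => by
    refine Subtype.ext ?_
    have : e.symm v.1 ≠ .inr k := fun h => hv (Subtype.ext (e.symm_apply_eq.1 h))
    simp [p, q, lift_copyOf hall this]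
  have hpj : p vj = w' := Subtype.ext (by simp [p, vj, w', copyOf])
  have hpk : p vk = w' := Subtype.ext (by simp [p, vk, w', copyOf])
  have hqw : q w' = vj := Subtype.ext (by simp [q, vj, w', lift_self])
  have hvjk : vj ≠ vk := fun h => hjk (by
    simpa [vj, vk] using h)
  have hqk : ∀ a, q a ≠ vk := fun a ha => hvjk (by rw [← hqw, ← hpk, ← ha, hpq])
  have hold : ∀ l : G.comp (copyOf w n x), l ≠ w' → G.IsRegular l.1.1 → ∀ v,
      H.blockCol (e x) (q l) v = G.blockCol (copyOf w n x) l (p v) := by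
    intro l hl _ v
    have hlw : l.1 ≠ w := fun h => hl (Subtype.ext h)
    have hql : (q l).1 = e (.inl ⟨l.1, hlw⟩) := congrArg e (lift_of_ne j hlw)
    have hv : v.1 = e (e.symm v.1) := (e.apply_symm_apply _).symm
    have hiff : v.1 = (q l).1 ↔ (p v).1 = l.1 := by
      constructor
      · intro hvl
        rw [Subtype.ext hvl, hpq]
      · intro hvl
        have hvk : v ≠ vk := by
          rintro rfl
          exact hl (by rw [← hpk, Subtype.ext hvl])
        rw [← hqp v hvk, Subtype.ext hvl]
    have hB : H.B v.1 (q l).1 = G.B (p v).1 l.1 := by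
      rw [B_eq, B_eq, if_congr hiff rfl rfl]
      congr 2
      rw [hql]
      conv_lhs => rw [hv]
      exact h.old _ _
    rw [blockCol, blockCol, hB]
  have hnew : ∀ i (hi : ∀ b, α i b ≠ ⊤) (hm : e (.inr i) ∈ H.comp (e x)) v,
      H.blockCol (e x) ⟨e (.inr i), hm⟩ v =
        (α i (p v).1).toNat - if v = ⟨e (.inr i), hm⟩ then 1 else 0 := by
    intro i hi hm v
    have hvadj : H.vadj (e (.inr i)) v.1 = α i (p v).1 := by
      conv_lhs => rw [← e.apply_symm_apply v.1]
      exact h.new _ _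
    rw [blockCol, untopD_B (by rw [hvadj]; exact hi _), hvadj]
    simp only [Subtype.ext_iff]
  have hvk : ∀ v, H.blockCol (e x) vk v = (α k (p v).1).toNat - if v = vk then 1 else 0 :=
    hnew k hfin _
  have hvkreg : H.IsRegular vk.1.1 := (h.isRegular_new k).2 hfin
  have hsplit : G.IsRegular w.1 → ∀ v, G.blockCol (copyOf w n x) w' (p v) =
      H.blockCol (e x) vj v + H.blockCol (e x) vk v := by
    intro hr v
    have hα := h.isRegular_iff.1 hr
    have hsum : G.vadj w (p v).1 = α j (p v).1 + α k (p v).1 := by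
      rw [← h.sum, ← Finset.sum_pair (f := fun i => α i (p v).1) hjk]
      exact Finset.sum_congr (Finset.ext fun i => by simpa using hall i).symm fun _ _ => rfl
    have hiff : (p v).1 = w ↔ v = vj ∨ v = vk := by
      constructor
      · intro hpv
        by_cases hv : v = vk
        · exact .inr hv
        · refine .inl ?_
          have : p v = w' := Subtype.ext hpv
          rw [← hqp v hv, this, hqw]
      · rintro (rfl | rfl)
        · rw [hpj]
        · rw [hpk]
    have hgw := untopD_B (k := (p v).1) (l := w) ((isRegular_iff_vadj.1 hr).1 _)
    rw [blockCol, hgw, hsum, ENat.toNat_add (hα _ _) (hα _ _), hvk, hnew j (hα j), if_congr hiff rfl rfl]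
    change _ = _ - (if v = vj then 1 else 0) + _
    by_cases h1 : v = vj
    · have h2 : v ≠ vk := h1 ▸ hvjk
      simp only [h1, true_or, if_true, hvjk, if_false]
      push_cast
      ring
    · by_cases h2 : v = vk
      · simp only [h2, or_true, if_true, hvjk.symm, if_false]
        push_cast
        ring
      · simp only [h1, h2, or_self, if_false]
        push_cast
        ring
  let f : (G.comp (copyOf w n x) → ℤ) →ₗ[ℤ] (H.comp (e x) → ℤ) := LinearMap.funLeft ℤ ℤ p
  -- The formula is forced by `g ∘ f = id` together with the requirement that `g` kill the column of
  -- `vk`, hence send the basis vector at `vk` to `α k`.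
  let g : (H.comp (e x) → ℤ) →ₗ[ℤ] (G.comp (copyOf w n x) → ℤ) :=
    { toFun := fun y a => y (q a) + (y vk - y vj) * (α k a.1).toNat
      map_add' := fun y z => by
        funext a
        simp only [Pi.add_apply]
        ring
      map_smul' := fun r y => by
        funext a
        simp only [Pi.smul_apply, smul_eq_mul, RingHom.id_apply]
        ring }
  have hf : ∀ y v, f y v = y (p v) := fun _ _ => rfl
  have hg : ∀ y a, g y a = y (q a) + (y vk - y vj) * (α k a.1).toNat := fun _ _ => rfl
  have hgf : ∀ y, g (f y) = y := by
    intro y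
    funext a
    rw [hg, hf, hf, hf, hpq, hpk, hpj, sub_self, zero_mul, add_zero]
  have hgk : g (H.blockCol (e x) vk) = 0 := by
    funext a
    rw [hg, hvk, hvk, hvk, hpq, hpk, hpj, if_neg (hqk a), if_pos rfl, if_neg hvjk, Pi.zero_apply]
    ring
  refine (mr_congr (nonempty_quotient_addEquiv (S := G.colSpan (copyOf w n x))
    (T := H.colSpan (e x)) f g (map_colSpan f fun l hl => ?_) (map_colSpan g fun l hl => ?_)
    (fun y => ?_) fun y => ?_)).symm
  · by_cases hlw : l = w'
    · subst hlw
      have : f (G.blockCol (copyOf w n x) w') =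
          H.blockCol (e x) vj + H.blockCol (e x) vk := funext fun v => hsplit hl v
      rw [this]
      exact add_mem (blockCol_mem_colSpan ((h.isRegular_new j).2 (h.isRegular_iff.1 hl j)))
        (blockCol_mem_colSpan hvkreg)
    · have : f (G.blockCol (copyOf w n x) l) = H.blockCol (e x) (q l) :=
        funext fun v => (hold l hlw hl v).symm
      rw [this]
      refine blockCol_mem_colSpan ?_
      have hlw' : l.1 ≠ w := fun h => hlw (Subtype.ext h)
      have hql : (q l).1 = e (.inl ⟨l.1, hlw'⟩) := congrArg e (lift_of_ne j hlw')
      rw [hql]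
      exact (h.isRegular_old _).2 hl
  · by_cases hlk : l = vk
    · rw [hlk, hgk]
      exact zero_mem _
    by_cases hlj : l = vj
    · subst hlj
      have hwr : G.IsRegular w.1 := h.isRegular_iff.2 fun i =>
        (hall i).elim (fun hi => hi ▸ (h.isRegular_new j).1 hl) fun hi => hi ▸ hfin
      have : H.blockCol (e x) vj =
          f (G.blockCol (copyOf w n x) w') - H.blockCol (e x) vk := by
        funext v
        rw [Pi.sub_apply, hf, hsplit hwr v]
        ring
      rw [this, map_sub, hgf, hgk, sub_zero]
      exact blockCol_mem_colSpan hwr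
    · have hpw : p l ≠ w' := fun hp => hlj (by rw [← hqp l hlk, hp, hqw])
      have hpw' : (p l).1 ≠ w := fun h => hpw (Subtype.ext h)
      have hql : l.1 = e (.inl ⟨(p l).1, hpw'⟩) := by
        conv_lhs => rw [← hqp l hlk]
        exact congrArg e (lift_of_ne j hpw')
      have hreg : G.IsRegular (p l).1.1 := by
        rw [hql] at hl
        exact (h.isRegular_old _).1 hl
      have : H.blockCol (e x) l = f (G.blockCol (copyOf w n x) (p l)) := by
        funext v
        rw [hf, ← hold _ hpw hreg, hqp l hlk]
      rw [this, hgf]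
      exact blockCol_mem_colSpan hreg
  · rw [hgf, sub_self]
    exact zero_mem _
  · have : f (g y) - y = (y vk - y vj) • H.blockCol (e x) vk := by
      funext v
      rw [Pi.sub_apply, Pi.smul_apply, hf, hg, hvk, smul_eq_mul]
      by_cases hv : v = vk
      · subst hv
        rw [hpk, hqw, if_pos rfl]
        ring
      · rw [hqp v hv, if_neg hv]
        ring
    rw [this]
    exact Submodule.smul_mem _ _ (blockCol_mem_colSpan hvkreg)

/-- Each copy of `w` shares its component with the other copies, so no new component with a single
vertex arises. -/
theorem prop3 (h : LoopSplit w α e) (hn : 1 < n) (hG : G.Prop3) : H.Prop3 := by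
  rw [prop3_iff] at *
  intro v hv
  obtain ⟨y, rfl⟩ := e.surjective v
  rcases y with y | i
  · rw [h.old]
    refine hG y.1 fun b hb => ?_
    have hb' := hv (e (lift w ⟨0, h.pos⟩ b)) (h.mem_comp.2 (by rwa [copyOf_lift]))
    rw [← copyOf_lift (w := w) ⟨0, h.pos⟩ b, e.injective hb']
    rfl
  · exfalso
    have h0 := hv (e (.inr ⟨0, h.pos⟩)) (h.mem_comp.2 (self_mem_comp G w))
    have h1 := hv (e (.inr ⟨1, hn⟩)) (h.mem_comp.2 (self_mem_comp G w))
    have := Sum.inr_injective (e.injective (h0.trans h1.symm))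
    simp at this

theorem trans_sameData {K : DirGraph.{u}} (h : LoopSplit w α e) {φ : H.Vt ≃ K.Vt}
    (hφ : SameData φ) : LoopSplit w α (e.trans φ) where
  pos := h.pos
  old a y := (hφ.1 _ _).trans (h.old a y)
  new j y := (hφ.1 _ _).trans (h.new j y)
  sum := h.sum
  loop := h.loop

end LoopSplit

/-- Since `w` supports a loop, its copies are not sources; the regular sources are thus the old
ones. -/
theorem exists_loopSplit {G : DirGraph.{u}} {w : G.Vt} {n : ℕ} {c : {e // G.s e = w.1} → Fin n}
    (hc : G.IsOutPartition w.1 c) (hl : ∀ j, classAdj c j w.1 ≠ 0) :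
    (G.AtMostOneRegularSource → (G.outsplit w.1 c).AtMostOneRegularSource) ∧
    ∃ e : {a : G.Vt // a ≠ w} ⊕ Fin n ≃ (G.outsplit w.1 c).Vt,
      LoopSplit w (fun j b => classAdj c j b.1) e ∧
      ∀ j, (e (.inr j)).1 = outV c (.inr j) := by
  have hloop : G.adj w.1 w.1 ≠ 0 := fun h0 =>
    hl ⟨0, hc.pos⟩ (le_antisymm (h0 ▸ classAdj_le c _ _) bot_le)
  have hold : ∀ u, (G.outsplit w.1 c).IsRegularSource (outV c (.inl u)) ↔
      G.IsRegularSource u.1 := fun u => and_congr (isRegular_outV_inl hc u) (isSource_outV _)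
  have hnew : ∀ j, ¬ (G.outsplit w.1 c).IsRegularSource (outV c (.inr j)) := fun j hs =>
    hloop (isSource_iff.1 ((isSource_outV (.inr j)).1 hs.2) w.1)
  constructor
  · intro hG x y
    obtain ⟨x, rfl⟩ := (outV c).surjective x
    obtain ⟨y, rfl⟩ := (outV c).surjective y
    rcases x with x | x
    · rcases y with y | y
      · intro hx hy
        rw [Subtype.ext (hG _ _ ((hold x).1 hx) ((hold y).1 hy))]
      · exact fun _ hy => absurd hy (hnew y)
    · exact fun hx => absurd hx (hnew x)
  · let f : {a : G.Vt // a ≠ w} ⊕ Fin n → (G.outsplit w.1 c).Vt := Sum.elim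
      (fun a => ⟨outV c (.inl ⟨a.1.1, fun h => a.2 (Subtype.ext h)⟩),
        fun h => a.1.2 ((hold _).1 h)⟩) fun j => ⟨outV c (.inr j), hnew j⟩
    have hf : Function.Bijective f := by
      constructor
      · rintro (a | a) (b | b) hab
        · have := Sum.inl_injective ((outV c).injective (Subtype.ext_iff.1 hab))
          have hv : a.1.1 = b.1.1 := Subtype.mk.inj this
          exact congrArg Sum.inl (Subtype.ext (Subtype.ext hv))
        · exact absurd ((outV c).injective (Subtype.ext_iff.1 hab)) Sum.inl_ne_inr
        · exact absurd ((outV c).injective (Subtype.ext_iff.1 hab)) Sum.inr_ne_inl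
        · have := (outV c).injective (Subtype.ext_iff.1 hab)
          exact congrArg Sum.inr (Sum.inr_injective this)
      · rintro ⟨v, hv⟩
        obtain ⟨v | j, rfl⟩ := (outV c).surjective v
        · exact ⟨.inl ⟨⟨v.1, fun h => hv ((hold v).2 h)⟩, fun h => v.2 (Subtype.ext_iff.1 h)⟩, rfl⟩
        · exact ⟨.inr j, rfl⟩
    have hproj : ∀ y, ∃ z, (f y).1 = outV c z ∧ outProj w.1 n z = (copyOf w n y).1 := by
      rintro (y | j)
      · exact ⟨_, rfl, rfl⟩
      · exact ⟨_, rfl, rfl⟩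
    refine ⟨Equiv.ofBijective f hf, ⟨hc.pos, fun a y => ?_, fun j y => ?_,
      fun b => sum_classAdj c b.1, hl⟩, fun j => rfl⟩
    · obtain ⟨z, hz, hz'⟩ := hproj y
      change (G.outsplit w.1 c).adj (outV c (.inl _)) (f y).1 = _
      rw [hz, adj_outV_inl, hz']
      rfl
    · obtain ⟨z, hz, hz'⟩ := hproj y
      change (G.outsplit w.1 c).adj (outV c (.inr j)) (f y).1 = _
      rw [hz, adj_outV_inr, hz']

/-! ### The number of regular vertices missing in the components -/

/-- The number of regular vertices that the component of `i` lacks. -/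
noncomputable def deficiency (G : DirGraph.{u}) (i : G.Vt) : ℕ :=
  max 3 (G.mr i + 2) - {j ∈ G.comp i | G.IsRegular j.1}.ncard

theorem mr_eq_of_comp_eq {G : DirGraph.{u}} {i j : G.Vt} (h : G.comp i = G.comp j) :
    G.mr i = G.mr j :=
  mr_eq_of_equiv (Equiv.setCongr h.symm) 0 (fun _ => rfl) (fun _ => Iff.rfl) fun _ _ _ =>
    (add_zero _).symm

theorem deficiency_eq_of_comp_eq {G : DirGraph.{u}} {i j : G.Vt} (h : G.comp i = G.comp j) :
    G.deficiency i = G.deficiency j := by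
  rw [deficiency, deficiency, mr_eq_of_comp_eq h, h]

/-- The number of regular vertices that all components lack together. -/
noncomputable def totalDeficiency (G : DirGraph.{u}) : ℕ :=
  ∑ᶠ C : Set.range G.comp, G.deficiency C.2.choose

/-- By `hc` and surjectivity, `π` induces a bijection between the sets of components, and the two
sums can be compared term by term; the representatives chosen do not matter. -/
theorem totalDeficiency_comparison {G H : DirGraph.{u}} {π : H.Vt → G.Vt}
    (hπ : Function.Surjective π)
    (hc : ∀ x y, H.comp x = H.comp y ↔ G.comp (π x) = G.comp (π y))
    (hle : ∀ x, H.deficiency x ≤ G.deficiency (π x)) :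
    H.totalDeficiency ≤ G.totalDeficiency ∧
      ((∃ x, H.deficiency x < G.deficiency (π x)) → H.totalDeficiency < G.totalDeficiency) := by
  classical
  have := Fintype.ofFinite (Set.range G.comp)
  have := Fintype.ofFinite (Set.range H.comp)
  let τ : Set.range H.comp → Set.range G.comp := fun C => ⟨G.comp (π C.2.choose), _, rfl⟩
  have hch : ∀ x (hx : H.comp x ∈ Set.range H.comp), H.comp hx.choose = H.comp x := fun x hx =>
    hx.choose_spec
  have hτ : Function.Bijective τ := by
    constructor
    · rintro ⟨_, x, rfl⟩ ⟨_, y, rfl⟩ hxy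
      refine Subtype.ext ?_
      have := (hc _ _).2 (Subtype.ext_iff.1 hxy)
      rwa [hch, hch] at this
    · rintro ⟨_, a, rfl⟩
      obtain ⟨x, rfl⟩ := hπ a
      exact ⟨⟨_, x, rfl⟩, Subtype.ext ((hc _ _).1 (hch x _))⟩
  have hG : G.totalDeficiency = ∑ C : Set.range H.comp, G.deficiency (π C.2.choose) := by
    rw [totalDeficiency, finsum_eq_sum_of_fintype, ← hτ.sum_comp]
    exact Finset.sum_congr rfl fun C _ => deficiency_eq_of_comp_eq (τ C).2.choose_spec
  have hH : H.totalDeficiency = ∑ C : Set.range H.comp, H.deficiency C.2.choose :=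
    finsum_eq_sum_of_fintype _
  rw [hG, hH]
  refine ⟨Finset.sum_le_sum fun C _ => hle _, ?_⟩
  rintro ⟨x, hx⟩
  refine Finset.sum_lt_sum (fun C _ => hle _) ⟨⟨_, x, rfl⟩, Finset.mem_univ _, ?_⟩
  rwa [deficiency_eq_of_comp_eq (hch x _), deficiency_eq_of_comp_eq ((hc _ _).1 (hch x _))]

theorem Grow.totalDeficiency_le {G H : DirGraph.{u}} {φ : G.Vt ≃ H.Vt} (h : Grow φ) :
    H.totalDeficiency ≤ G.totalDeficiency := by
  refine (totalDeficiency_comparison φ.symm.surjective (fun x y => ?_) fun x => ?_).1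
  · obtain ⟨x, rfl⟩ := φ.surjective x
    obtain ⟨y, rfl⟩ := φ.surjective y
    rw [φ.symm_apply_apply, φ.symm_apply_apply, h.comp_eq_iff]
  · obtain ⟨x, rfl⟩ := φ.surjective x
    rw [φ.symm_apply_apply, deficiency, deficiency, h.mr, h.ncard_regular]

theorem LoopSplit.totalDeficiency_lt {G H : DirGraph.{u}} {w : G.Vt} {n : ℕ}
    {α : Fin n → G.Vt → ℕ∞} {e : {a : G.Vt // a ≠ w} ⊕ Fin n ≃ H.Vt} (h : LoopSplit w α e)
    {j k : Fin n} (hjk : j ≠ k) (hall : ∀ i, i = j ∨ i = k) (hfin : ∀ b, α k b ≠ ⊤)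
    (hpos : 0 < G.deficiency w) : H.totalDeficiency < G.totalDeficiency := by
  classical
  have hdef : ∀ y, H.deficiency (e y) =
      G.deficiency (copyOf w n y) - if w ∈ G.comp (copyOf w n y) then 1 else 0 := by
    intro y
    split_ifs with hw
    · rw [deficiency, deficiency, h.mr_eq_of_mem hjk hall hfin hw,
        h.ncard_regular hjk hall hfin hw, Nat.sub_add_eq]
    · rw [deficiency, deficiency, h.mr_eq_of_notMem hw, h.ncard_regular_of_notMem hw, Nat.sub_zero]
  refine (totalDeficiency_comparison (π := fun x => copyOf w n (e.symm x))
    (h.copyOf_surjective.comp e.symm.surjective) (fun x y => ?_) fun x => ?_).2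
    ⟨e (.inr j), ?_⟩
  · obtain ⟨x, rfl⟩ := e.surjective x
    obtain ⟨y, rfl⟩ := e.surjective y
    simp only [e.symm_apply_apply, h.comp_eq_iff]
  · obtain ⟨x, rfl⟩ := e.surjective x
    rw [hdef, e.symm_apply_apply]
    exact Nat.sub_le _ _
  · rw [hdef, e.symm_apply_apply]
    have hw : w ∈ G.comp (copyOf w n (.inr j)) := self_mem_comp G w
    rw [if_pos hw]
    exact Nat.sub_lt hpos one_pos

/-! ### Separating a loop -/

/-- Outsplitting that separates one loop from the other edges emitted by a vertex. -/
theorem exists_split_loop {G : DirGraph.{u}} (hG : G.IsReduced) {w : G.Vt}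
    (hw : 2 ≤ G.vadj w w) :
    ∃ (c : {e // G.s e = w.1} → Fin 2)
      (e : {a : G.Vt // a ≠ w} ⊕ Fin 2 ≃ (G.outsplit w.1 c).Vt),
      G.IsOutPartition w.1 c ∧ (G.outsplit w.1 c).IsReduced ∧
      LoopSplit w (fun j b => classAdj c j b.1) e ∧
      ∀ j, (e (.inr j)).1 = outV c (.inr j) := by
  have hne0 : G.adj w.1 w.1 ≠ 0 := fun h0 => by
    rw [vadj, h0] at hw
    simp at hw
  have hne1 : G.adj w.1 w.1 ≠ 1 := fun h1 => by
    rw [vadj, h1] at hw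
    exact absurd hw (by norm_num)
  obtain ⟨c, hc, hc1, hc1', hc0, hc0'⟩ := exists_isOutPartition_single hne0 (.inl hne1)
  have hl : ∀ j, classAdj c j w.1 ≠ 0 := by
    intro j
    fin_cases j
    · intro h0
      have h0 : classAdj c 0 w.1 = 0 := h0
      rw [h0, zero_add] at hc0
      exact hne1 hc0.symm
    · exact fun h0 => one_ne_zero (hc1.symm.trans h0)
  obtain ⟨hone, e, he, he'⟩ := exists_loopSplit hc hl
  have hG1 := prop1_iff.1 hG.prop1
  have hG2 := prop2_iff.1 hG.prop2
  have htop1 : ∀ b, classAdj c 1 b ≠ ⊤ := fun b => by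
    by_cases hb : b = w.1
    · rw [hb, hc1]
      exact ENat.one_ne_top
    · rw [hc1' b hb]
      exact ENat.zero_ne_top
  refine ⟨c, e, hc, ⟨prop1_iff.2 ?_, prop2_iff.2 ?_, hone hG.atMostOne⟩, he, he'⟩
  · intro x y z hxy
    obtain ⟨x, rfl⟩ := e.surjective x
    obtain ⟨y, rfl⟩ := e.surjective y
    obtain ⟨z, rfl⟩ := e.surjective z
    rcases x with x | j
    · rw [he.old] at hxy ⊢
      exact hG1 _ _ _ hxy
    · rw [he.new] at hxy ⊢
      fin_cases j
      · have hinf : G.vadj w (copyOf w 2 y) = ⊤ := top_le_iff.1 (hxy ▸ he.le 0 _)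
        have hz := hG1 _ _ (copyOf w 2 z) hinf
        by_cases hzw : copyOf w 2 z = w
        · rw [hzw] at hz ⊢
          refine .inr ?_
          -- Class 0 contains all loops but one, hence still infinitely many.
          have := hc0.trans (hz.resolve_left hne0)
          simpa using this
        · refine hz.imp (fun h => ?_) fun h => ?_
          · exact (hc0' _ fun h => hzw (Subtype.ext h)).trans h
          · exact (hc0' _ fun h => hzw (Subtype.ext h)).trans h
      · exact absurd hxy (htop1 _)
  · intro x hx
    obtain ⟨x, rfl⟩ := e.surjective x
    rcases x with x | j
    · rw [he.old]
      exact hG2 _ (isRegular_iff_vadj.1 ((he.isRegular_old x).1 (isRegular_iff_vadj.2 hx)))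
    · rw [he.new]
      exact hl j

/-- The vertices supporting several loops that form a component on their own. -/
def isolatedLoops (G : DirGraph.{u}) : Set G.Vt :=
  {i | (∀ b ∈ G.comp i, b = i) ∧ ¬ G.vadj i i < 2}

/-- Separating one of the loops turns the isolated vertex into a component with two vertices and
leaves the other components alone. -/
theorem exists_moveO_isolatedLoops_lt {G : DirGraph.{u}} (hG : G.IsReduced) (h3 : ¬ G.Prop3) :
    ∃ H, MoveO G H ∧ H.IsReduced ∧ H.isolatedLoops.ncard < G.isolatedLoops.ncard := by
  rw [prop3_iff] at h3
  push Not at h3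
  obtain ⟨w, hw, hw2⟩ := h3
  obtain ⟨c, e, hc, hH, he, -⟩ := exists_split_loop hG hw2
  have hmem : ∀ y, e y ∈ (G.outsplit w.1 c).isolatedLoops →
      ∃ u, y = .inl u ∧ u.1 ∈ G.isolatedLoops := by
    rintro (u | j) ⟨h1, h2⟩
    · refine ⟨u, rfl, fun b hb => ?_, by rwa [he.old] at h2⟩
      have hb' := h1 (e (LoopSplit.lift w 0 b))
        (he.mem_comp.2 (by rwa [LoopSplit.copyOf_lift]))
      rw [← LoopSplit.copyOf_lift (w := w) (0 : Fin 2) b, e.injective hb']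
      rfl
    · have h0 := h1 (e (.inr 0)) (he.mem_comp.2 (self_mem_comp G w))
      have h1 := h1 (e (.inr 1)) (he.mem_comp.2 (self_mem_comp G w))
      exact absurd (Sum.inr_injective (e.injective (h0.trans h1.symm))) (by simp)
  refine ⟨_, moveO_outsplit hc, hH, ncard_lt_of_injOn (b := w)
    (fun x => copyOf w 2 (e.symm x)) (fun x hx => ?_) (fun x hx x' hx' h => ?_)
    ⟨hw, not_lt.2 hw2⟩⟩
  · obtain ⟨y, rfl⟩ := e.surjective x
    obtain ⟨u, rfl, hu⟩ := hmem y hx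
    rw [e.symm_apply_apply]
    exact ⟨hu, u.2⟩
  · obtain ⟨y, rfl⟩ := e.surjective x
    obtain ⟨u, rfl, hu⟩ := hmem y hx
    obtain ⟨y', rfl⟩ := e.surjective x'
    obtain ⟨u', rfl, hu'⟩ := hmem y' hx'
    simp only [e.symm_apply_apply] at h
    rw [Subtype.ext (a1 := u) (a2 := u') h]

theorem exists_moveO_prop3 {G : DirGraph.{u}} (hG : G.IsReduced) :
    ∃ H, ReflTransGen MoveO G H ∧ H.IsReduced ∧ H.Prop3 :=
  exists_reflTransGen_of_decreasing (fun G => G.isolatedLoops.ncard)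
    (fun _ hG h3 => exists_moveO_isolatedLoops_lt hG h3) G hG

/-! ### Enlarging components -/

/-- Positivity of the diagonal block gives two loops at `i`, so one of them can be separated. -/
theorem exists_enlargesComp {G : DirGraph.{u}} (hG : G.IsReduced) (h4 : G.Prop4) {i : G.Vt}
    (hi : 1 < (G.comp i).ncard) : ∃ H, EnlargesComp G H i ∧ H.IsReduced := by
  have h2 := B_self_pos.1 (h4 i hi i (self_mem_comp G i) i (self_mem_comp G i))
  obtain ⟨c, e, hc, hH, he, he'⟩ := exists_split_loop hG h2
  refine ⟨_, ⟨i, self_mem_comp G i, 2, c, hc, ⟨Iso.refl _⟩, 0, e (.inr 0), he' 0, ?_⟩, hH⟩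
  have := he.ncard_comp (x := .inr 0) (self_mem_comp G i)
  have h' : copyOf i 2 (.inr 0) = i := rfl
  rw [h'] at this
  omega

/-- The outsplitting is an arbitrary one that preserves `Prop1` and `Prop2`; its structure has to be
recovered from these. The split vertex has a loop, so no copy is a source and every regular copy
needs a loop. An irregular copy carries the only infinite class, which must contain infinitely many
loops. -/
theorem EnlargesComp.properties {G H : DirGraph.{u}} {i : G.Vt} (h : EnlargesComp G H i)
    (hG : G.IsReduced) (h3 : G.Prop3) (h4 : G.Prop4) (hi : 1 < (G.comp i).ncard)
    (hd : 0 < G.deficiency i) (h1' : H.Prop1) (h2' : H.Prop2) :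
    MoveO G H ∧ H.IsReduced ∧ H.Prop3 ∧ H.totalDeficiency < G.totalDeficiency := by
  obtain ⟨w, hw, n, c, hc, ⟨f⟩, k, v, hv, hcard⟩ := h
  have hiw : G.comp i = G.comp w := comp_eq_iff.2 hw
  have hww : G.adj w.1 w.1 ≠ 0 := hasEdge_of_B_pos (h4 i hi w hw w hw)
  have h2'' : (G.outsplit w.1 c).Prop2 := f.symm.sameData.prop2 h2'
  have hl : ∀ j, classAdj c j w.1 ≠ 0 := by
    intro j
    by_cases hr : (G.outsplit w.1 c).IsRegular (outV c (.inr j))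
    · by_contra h0
      have hs := h2'' _ hr fun hedge => by
        rw [hasEdge_iff, adj_outV_inr] at hedge
        exact hedge h0
      exact hww (isSource_iff.1 ((isSource_outV (.inr j)).1 hs) w.1)
    · rw [isRegular_outV_inr_iff hc] at hr
      push Not at hr
      obtain ⟨x, hx⟩ := hr
      have hinf : G.adj w.1 x = ⊤ := top_le_iff.1 (hx ▸ classAdj_le c j x)
      have htop : G.adj w.1 w.1 = ⊤ :=
        (prop1_iff_adj.1 hG.prop1 _ _ w.1 hinf).resolve_left hww
      rw [← sum_classAdj c, ENat.sum_eq_top] at htop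
      obtain ⟨j', -, hj'⟩ := htop
      rw [classAdj_eq_top_unique hc hx hj', hj']
      exact ENat.top_ne_zero
  obtain ⟨hone, e, he, he'⟩ := exists_loopSplit hc hl
  have hve : e (.inr k) = v := Subtype.ext ((he' k).trans hv.symm)
  -- The component trades one vertex for `n` and is required to grow by one.
  have hn : n = 2 := by
    have hc1 := he.ncard_comp (x := .inr k) (self_mem_comp G w)
    have h' : copyOf w n (.inr k) = w := rfl
    rw [hve, h', hcard, hiw] at hc1
    omega
  subst hn
  -- At most one class is infinite; `k` denotes a class that is not.
  have hex : ∃ j k : Fin 2, j ≠ k ∧ (∀ i, i = j ∨ i = k) ∧ ∀ b : G.Vt, classAdj c k b.1 ≠ ⊤ := by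
    by_cases hfin : ∀ b : G.Vt, classAdj c 1 b.1 ≠ ⊤
    · exact ⟨0, 1, by decide, by decide, hfin⟩
    · push Not at hfin
      obtain ⟨b, hb⟩ := hfin
      refine ⟨1, 0, by decide, by decide, fun b' hb' => ?_⟩
      exact absurd (classAdj_eq_top_unique hc hb hb') (by decide)
  obtain ⟨j, k', hjk, hall, hfin⟩ := hex
  have heH := he.trans_sameData f.sameData
  refine ⟨⟨w.1, 2, c, hc, ⟨f⟩⟩, ⟨h1', h2', f.atMostOne (hone hG.atMostOne)⟩,
    heH.prop3 one_lt_two h3, heH.totalDeficiency_lt hjk hall hfin ?_⟩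
  rwa [← deficiency_eq_of_comp_eq hiw]

theorem not_condIV {G : DirGraph.{u}} (h3 : G.Prop3) (h4 : G.Prop4) {i : G.Vt}
    (h : ¬ G.CondIV i) : 1 < (G.comp i).ncard ∧ 0 < G.deficiency i := by
  rw [condIV_iff h3 h4] at h
  push Not at h
  exact ⟨h.1, Nat.sub_pos_of_lt h.2⟩

/-! ### Executions of the algorithm -/

/-- What holds at the various positions of an execution. -/
def PhaseInvariant : Phase → DirGraph.{u} → Prop
  | .step1, _ => True
  | .step2, G => G.Prop1
  | .collect, G => G.Prop1 ∧ G.Prop2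
  | .step3, G => G.IsReduced
  | .step4, G => G.IsReduced ∧ G.Prop3
  | .step5, G => G.IsReduced ∧ G.Prop3 ∧ G.Prop4
  | .step6, G => G.IsReduced ∧ G.Prop3 ∧ G.Prop4 ∧ G.IsLarge
  | .step7, G => G.IsReduced ∧ G.Prop3 ∧ G.Prop4 ∧ G.IsLarge ∧ G.Prop6
  | .step8, G => G.IsReduced ∧ G.Prop3 ∧ G.Prop4 ∧ G.IsLarge ∧ G.Prop6 ∧ G.Prop7
  | .done, G => G.IsReduced ∧ G.Prop3 ∧ G.Prop4 ∧ G.IsLarge ∧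
      ∀ i j k : G.Vt, G.HasEdge i.1 j.1 → G.HasEdge j.1 k.1 → G.HasEdge i.1 k.1

/-- A measure that decreases in every transition. -/
noncomputable def phaseRank : Phase → DirGraph.{u} → ℕ ×ₗ ℕ ×ₗ ℕ
  | .step1, _ => toLex (7, toLex (0, 0))
  | .step2, _ => toLex (6, toLex (0, 0))
  | .collect, _ => toLex (5, toLex (0, 0))
  | .step3, _ => toLex (4, toLex (0, 0))
  | .step4, G => toLex (3, toLex (G.totalDeficiency, 1))
  | .step5, G => toLex (3, toLex (G.totalDeficiency, 0))
  | .step6, _ => toLex (2, toLex (0, 0))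
  | .step7, G => toLex (1, toLex (G.nonposEntries.ncard, 1))
  | .step8, G => toLex (1, toLex (G.nonposEntries.ncard, 0))
  | .done, _ => toLex (0, toLex (0, 0))

theorem toLex_lt_of_fst {a b : ℕ} {x y : ℕ ×ₗ ℕ} (h : a < b) :
    (toLex (a, x) : ℕ ×ₗ ℕ ×ₗ ℕ) < toLex (b, y) := Prod.Lex.toLex_lt_toLex.2 (.inl h)

theorem toLex_lt_of_snd {a b c x y : ℕ} (h : b < c) :
    (toLex (a, toLex (b, x)) : ℕ ×ₗ ℕ ×ₗ ℕ) < toLex (a, toLex (c, y)) :=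
  Prod.Lex.toLex_lt_toLex.2 (.inr ⟨rfl, Prod.Lex.toLex_lt_toLex.2 (.inl h)⟩)

theorem toLex_lt_of_le {a b c : ℕ} (h : b ≤ c) :
    (toLex (a, toLex (b, 0)) : ℕ ×ₗ ℕ ×ₗ ℕ) < toLex (a, toLex (c, 1)) :=
  Prod.Lex.toLex_lt_toLex.2 (.inr ⟨rfl, Prod.Lex.toLex_lt_toLex.2
    (h.lt_or_eq.imp_right fun h => ⟨h, one_pos⟩)⟩)

/-- In the loop of Steps 4 and 5 row additions do not raise the total deficiency and outsplittings
lower it. In the loop of Steps 7 and 8 the number of nonpositive entries does not rise and falls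
with each return. The last coordinate of the rank pays for passing from 4 to 5 and from 7 to 8. -/
theorem AlgStep.properties {x y : Phase × DirGraph.{u}} (h : AlgStep x y)
    (hx : PhaseInvariant x.1 x.2) : PhaseInvariant y.1 y.2 ∧ MoveEquivalent x.2 y.2 ∧
      phaseRank y.1 y.2 < phaseRank x.1 x.2 := by
  have hMoveO : ∀ {G H : DirGraph.{u}}, ReflTransGen MoveO G H → MoveEquivalent G H := fun h =>
    moveEquivalent_of_reflTransGen (fun _ _ h => h.moveEquivalent) h
  cases h with
  | step1 h h1 => exact ⟨h1, hMoveO h, toLex_lt_of_fst (by norm_num)⟩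
  | @step2 E F h h2 =>
    have h1 : F.Prop1 := by
      have hE : E.Prop1 := hx
      clear h2 hx
      induction h with
      | refl => exact hE
      | tail _ h ih => exact h.prop1 ih
    exact ⟨⟨h1, h2⟩, moveEquivalent_of_reflTransGen (fun _ _ h => h.moveEquivalent) h,
      toLex_lt_of_fst (by norm_num)⟩
  | collect h hone =>
    obtain ⟨φ, hφ⟩ := exists_sameData_of_collectSources h
    exact ⟨⟨hφ.prop1 hx.1, hφ.prop2 hx.2, hone⟩,
      moveEquivalent_of_reflTransGen (fun _ _ h => h.moveO.moveEquivalent.symm) h,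
      toLex_lt_of_fst (by norm_num)⟩
  | step3 h h1 h2 h3 hone =>
    exact ⟨⟨⟨h1, h2, hone⟩, h3⟩, hMoveO h, toLex_lt_of_fst (by norm_num)⟩
  | step4 h h4 =>
    obtain ⟨hF, hm, φ, hφ⟩ := reflTransGen_rowAdd (fun _ _ h => h) hx.1 h
    exact ⟨⟨hF, hφ.prop3 hx.2, h4⟩, hm, toLex_lt_of_le hφ.totalDeficiency_le⟩
  | step5_back i hi h h1 h2 h4 =>
    obtain ⟨hi', hd⟩ := not_condIV hx.2.1 hx.2.2 hi
    obtain ⟨hm, hF, h3, hlt⟩ := h.properties hx.1 hx.2.1 hx.2.2 hi' hd h1 h2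
    exact ⟨⟨hF, h3⟩, hm.moveEquivalent, toLex_lt_of_snd hlt⟩
  | step5_again i hi h h1 h2 h4 =>
    obtain ⟨hi', hd⟩ := not_condIV hx.2.1 hx.2.2 hi
    obtain ⟨hm, hF, h3, hlt⟩ := h.properties hx.1 hx.2.1 hx.2.2 hi' hd h1 h2
    exact ⟨⟨hF, h3, h4⟩, hm.moveEquivalent, toLex_lt_of_snd hlt⟩
  | step5_next h =>
    exact ⟨⟨hx.1, hx.2.1, hx.2.2, (forall_condIV_iff hx.2.1 hx.2.2).1 h⟩, .refl,
      toLex_lt_of_fst (by norm_num)⟩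
  | step6 h h6 =>
    obtain ⟨hE, h3, h4, hl⟩ := hx
    obtain ⟨hF, hm, φ, hφ⟩ := reflTransGen_rowAdd (fun _ _ ⟨i, j, h⟩ => ⟨i, j, .inr h⟩) hE h
    exact ⟨⟨hF, hφ.prop3 h3, hφ.prop4 h4, hφ.isLarge hl, h6⟩, hm, toLex_lt_of_fst (by norm_num)⟩
  | step7 h h7 =>
    obtain ⟨hE, h3, h4, hl, h6⟩ := hx
    obtain ⟨hF, hm, φ, hφ⟩ := reflTransGen_rowAdd (fun _ _ ⟨i, j, h⟩ => ⟨i, j, .inr h⟩) hE h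
    exact ⟨⟨hF, hφ.prop3 h3, hφ.prop4 h4, hφ.isLarge hl, hφ.prop6 h6, h7⟩, hm,
      toLex_lt_of_le hφ.nonposEntries_le⟩
  | step8_back i j k hij hjk hik h =>
    obtain ⟨hE, h3, h4, hl, h6, h7⟩ := hx
    obtain ⟨hF, ⟨φ, hφ⟩, hlt⟩ := h.exists_grow hE (hasEdge_iff_vadj.1 hij)
      (not_not.1 fun h0 => hik (hasEdge_iff_vadj.2 h0))
    exact ⟨⟨hF, hφ.prop3 h3, hφ.prop4 h4, hφ.isLarge hl, hφ.prop6 h6⟩,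
      PermittedRowAdd.moveEquivalent hE (.inl h), toLex_lt_of_snd hlt⟩
  | step8_done h =>
    obtain ⟨hE, h3, h4, hl, h6, h7⟩ := hx
    exact ⟨⟨hE, h3, h4, hl, h⟩, .refl, toLex_lt_of_fst (by norm_num)⟩

theorem PhaseInvariant.exists_algStep {p : Phase} {G : DirGraph.{u}} (h : PhaseInvariant p G)
    (hp : p ≠ .done) : ∃ τ, AlgStep (p, G) τ := by
  cases p with
  | step1 =>
    obtain ⟨H, h1, h2⟩ := exists_moveO_prop1 G
    exact ⟨_, .step1 h1 h2⟩
  | step2 =>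
    obtain ⟨H, h1, h2⟩ := exists_moveRPlus_prop2 G
    exact ⟨_, .step2 h1 h2⟩
  | collect =>
    obtain ⟨H, h1, h2⟩ := exists_collectSources G
    exact ⟨_, .collect h1 h2⟩
  | step3 =>
    obtain ⟨H, h1, h2, h3⟩ := exists_moveO_prop3 h
    exact ⟨_, .step3 h1 h2.prop1 h2.prop2 h3 h2.atMostOne⟩
  | step4 =>
    obtain ⟨H, h1, h2⟩ := exists_prop4 h.1
    exact ⟨_, .step4 h1 h2⟩
  | step5 =>
    obtain ⟨hG, h3, h4⟩ := h
    by_cases hall : ∀ i, G.CondIV i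
    · exact ⟨_, .step5_next hall⟩
    · push Not at hall
      obtain ⟨i, hi⟩ := hall
      obtain ⟨H, hH, hH'⟩ := exists_enlargesComp hG h4 (not_condIV h3 h4 hi).1
      by_cases h4' : H.Prop4
      · exact ⟨_, .step5_again i hi hH hH'.prop1 hH'.prop2 h4'⟩
      · exact ⟨_, .step5_back i hi hH hH'.prop1 hH'.prop2 h4'⟩
  | step6 =>
    obtain ⟨H, h1, h2⟩ := exists_prop6 h.1 h.2.2.1
    exact ⟨_, .step6 h1 h2⟩
  | step7 =>
    obtain ⟨H, h1, h2⟩ := exists_prop7 h.1 h.2.2.1 h.2.2.2.2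
    exact ⟨_, .step7 h1 h2⟩
  | step8 =>
    by_cases hall : ∀ i j k : G.Vt, G.HasEdge i.1 j.1 → G.HasEdge j.1 k.1 → G.HasEdge i.1 k.1
    · exact ⟨_, .step8_done hall⟩
    · push Not at hall
      obtain ⟨i, j, k, hij, hjk, hik⟩ := hall
      have hne : j ≠ k := by
        rintro rfl
        exact hik hij
      obtain ⟨H, hH⟩ := exists_basicRowAdd h.1 hne (hasEdge_iff_vadj.1 hjk)
      exact ⟨_, .step8_back i j k hij hjk hik hH⟩
  | done => exact absurd rfl hp

/-- Transitivity of the edge relation turns paths into edges, which is (II); `Prop1` upgrades these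
to (III). Condition (I) is `Prop2`, and (IV) is `IsLarge` in view of `Prop3` and `Prop4`. -/
theorem PhaseInvariant.isAugmentedCanonical {G : DirGraph.{u}} (h : PhaseInvariant .done G) :
    G.IsAugmentedCanonical := by
  obtain ⟨hG, h3, h4, hl, ht⟩ := h
  have hpaths : ∀ i j : G.Vt, G.HasPath i.1 j.1 → G.HasEdge i.1 j.1 := by
    intro i j hij
    have hp := hasPath_iff.1 hij
    clear hij
    induction hp with
    | single h => exact hasEdge_iff_vadj.2 h
    | tail _ h ih => exact ht _ _ _ ih (hasEdge_iff_vadj.2 h)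
  refine ⟨fun v hv hs => ?_, hpaths, fun i j hij hi => ?_, (forall_condIV_iff h3 h4).2 hl⟩
  · by_contra hl
    exact hs (hG.prop2 v hv hl)
  · exact (hG.prop1 i.1 hi j.1).resolve_left (hasEdge_iff.1 (hpaths i j hij))

theorem Reaches.properties {E F : DirGraph.{u}} {p : Phase} (h : E.Reaches p F) :
    PhaseInvariant p F ∧ MoveEquivalent E F := by
  have : ∀ x : Phase × DirGraph.{u}, ReflTransGen AlgStep (.step1, E) x →
      PhaseInvariant x.1 x.2 ∧ MoveEquivalent E x.2 := by
    intro x hx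
    induction hx with
    | refl => exact ⟨trivial, .refl⟩
    | tail _ h ih =>
      obtain ⟨h1, h2, -⟩ := h.properties ih.1
      exact ⟨h1, ih.2.trans h2⟩
  exact this _ h

theorem exists_reaches_done {E F : DirGraph.{u}} {p : Phase} (h : E.Reaches p F) :
    ∃ E', E.Reaches .done E' := by
  induction hr : phaseRank p F using WellFoundedLT.induction generalizing p F with
  | _ r ih =>
    by_cases hp : p = .done
    · subst hp
      exact ⟨F, h⟩
    · obtain ⟨⟨q, H⟩, hstep⟩ := h.properties.1.exists_algStep hp
      exact ih _ (hr ▸ (hstep.properties h.properties.1).2.2) (ReflTransGen.tail h hstep) rfl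

end DirGraph

/-! ### The theorem on the algorithm -/

theorem mainTheorem4 (E : DirGraph.{u}) :
    -- the algorithm ends with a graph in augmented canonical form, reached by the moves
    (∃ E', E.Reaches .done E' ∧ DirGraph.MoveEquivalent E E' ∧ E'.IsAugmentedCanonical) ∧
    -- so does every execution that ends
    (∀ E', E.Reaches .done E' →
      DirGraph.MoveEquivalent E E' ∧ E'.IsAugmentedCanonical ∧ E'.AtMostOneRegularSource) ∧
    -- all graphs met on the way are obtained by the moves as well
    (∀ p F, E.Reaches p F → DirGraph.MoveEquivalent E F) ∧
    -- no execution gets stuck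
    (∀ p F, E.Reaches p F → p ≠ .done → ∃ τ, DirGraph.AlgStep (p, F) τ) ∧
    -- no execution runs forever
    (¬ ∃ σ : ℕ → DirGraph.Phase × DirGraph.{u},
      σ 0 = (.step1, E) ∧ ∀ k, DirGraph.AlgStep (σ k) (σ (k + 1))) := by
  refine ⟨?_, fun E' h => ?_, fun p F h => h.properties.2,
    fun p F h hp => h.properties.1.exists_algStep hp, ?_⟩
  · obtain ⟨E', h⟩ := DirGraph.exists_reaches_done (E := E) (F := E) (p := .step1) .refl
    exact ⟨E', h, h.properties.2, h.properties.1.isAugmentedCanonical⟩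
  · exact ⟨h.properties.2, h.properties.1.isAugmentedCanonical, h.properties.1.1.atMostOne⟩
  · rintro ⟨σ, h0, hσ⟩
    have hinv : ∀ k, DirGraph.PhaseInvariant (σ k).1 (σ k).2 := by
      intro k
      induction k with
      | zero =>
        rw [h0]
        trivial
      | succ k ih => exact ((hσ k).properties ih).1
    -- An endless execution would make the rank decrease forever in a well-founded order.
    obtain ⟨k, hk⟩ := WellFounded.not_rel_apply_succ (r := (· < ·))
      (fun k => DirGraph.phaseRank (σ k).1 (σ k).2)
    exact hk ((hσ k).properties (hinv k)).2.2
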